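/- **Setting.** Let $\mathcal F=\{1,\dots,m\}$ be a set of features with finite non-empty domains $\mathbb D_1,\dots,\mathbb D_m$, let $\mathbb F=\mathbb D_1\times\dots\times\mathbb D_m$, and let $\mathcal K$ be a finite set of classes. A decision tree is a finite rooted tree whose terminal nodes carry classes, each of whose non-terminal nodes is associated with a single feature $x_i$, and each of whose edges is labelled by a literal $x_i\in E$ with $E\subseteq\mathbb D_i$, $x_i$ being the feature of the node where the edge starts; it is assumed that every $\mathbf x\in\mathbb F$ is consistent with exactly one root-to-leaf path, and $\kappa(\mathbf x)\in\mathcal K$ denotes the class at the end of that path. For an instance $(\mathbf v,c)$ with $\mathbf v\in\mathbb F$ and $c=\kappa(\mathbf v)$, and for $\delta\in[0,1]$, a set $\mathcal S\subseteq\mathcal F$ is called C$\delta$-relevant if $$\Pr\nolimits_{\mathbf x}\bigl(\kappa(\mathbf x)=c \,\big|\, \mathbf x_{\mathcal S}=\mathbf v_{\mathcal S}\bigr)=\frac{|\{\mathbf x\in\mathbb F:\kappa(\mathbf x)=c,\ x_i=v_i\ \forall i\in\mathcal S\}|}{|\{\mathbf x\in\mathbb F: x_i=v_i\ \forall i\in\mathcal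 S\}|}\ \ge\ \delta .$$ If all features are boolean and there are two classes, such a set is called $\delta$-relevant. An input consists of the domain sizes, the number of classes, a decision tree (each literal being listed as a table over the domain of its feature), an instance $(\mathbf v,c)$ with $c=\kappa(\mathbf v)$, and a rational $\delta\in[0,1]$ given as a fraction; all numbers are written in binary. **Proposition.** 1. The following decision problems are in NP (as languages of encoded yes-instances): (a) given an input with boolean features and two classes, and $k\in\mathbb N$, is there a $\delta$-relevant set of size at most $k$? (b) given an arbitrary input and $k\in\mathbb N$, is there a C$\delta$-relevant set of size at most $k$? (c) given an arbitrary input and $k\in\mathbb N$, is there a subset-minimal C$\delta$-relevant set of size at most $k$? 2. For inputs with boolean features and two classes, the smallest $k$ such that there is a $\delta$-relevant set of size at most $k$ can be computed in polynomial time with at most $\lceil\log_2(m+1)\rceil$ calls to an oracle for a language in NP. A $\delta$-relevant set of smallest cardinality can be computed in polynomial time with at most $\lceil\log_2(m+1)\rceil$ calls to an NP oracle that answers each query with a certificate whenever there is one. 3. Both claims of part 2 hold for arbitrary inputs, with C$\delta$-relevant sets instead of $\delta$-relevant sets. -/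

import Mathlib

namespace DTRelevance

/-! ### Probabilities and relevant sets -/

/-- The conditional probability `Pr_x(A(x) | B(x))` under the uniform distribution on a finite set,
`|{x : A x ∧ B x}| / |{x : B x}|`. -/
noncomputable def condProb {Ω : Type*} [Fintype Ω] (A B : Ω → Prop) : ℚ :=
  (Nat.card {x : Ω // A x ∧ B x} : ℚ) / (Nat.card {x : Ω // B x} : ℚ)

/-- `S` is a (C)`δ`-relevant set for the classifier `κ` and the instance `(v, c)`:
`Pr_x(κ(x) = c | x_S = v_S) ≥ δ`. The feature space is `∀ i, D i`. -/
def IsRelevant {m : ℕ} {D : Fin m → Type*} [∀ i, Fintype (D i)] {C : Type*}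
    (κ : (∀ i, D i) → C) (v : ∀ i, D i) (c : C) (δ : ℚ) (S : Finset (Fin m)) : Prop :=
  δ ≤ condProb (fun x => κ x = c) (fun x => ∀ i ∈ S, x i = v i)

/-! ### Decision trees -/

/-- Feature space with `m` features, the `i`-th one ranging over `{0, …, d i - 1}`. -/
abbrev Point {m : ℕ} (d : Fin m → ℕ) : Type := ∀ i, Fin (d i)

/-- Univariate decision trees (possibly with tests that are not exhaustive or not exclusive):
a terminal node carries a class; a non-terminal node is associated with a feature `i` and has `r`
outgoing edges, the `j`-th one labelled by the literal `x_i ∈ label j` and leading to `child j`. -/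
inductive DTree {m : ℕ} (d : Fin m → ℕ) (K : ℕ) : Type
  | leaf (c : Fin K) : DTree d K
  | node (i : Fin m) (r : ℕ) (label : Fin r → Finset (Fin (d i))) (child : Fin r → DTree d K) :
      DTree d K

namespace DTree

variable {m : ℕ} {d : Fin m → ℕ} {K : ℕ}

/-- The predictions of the root-to-leaf paths consistent with `x`, one entry for each path. -/
def outcomes (x : Point d) : DTree d K → List (Fin K)
  | leaf c => [c]
  | node i _ label child =>
      (List.ofFn fun j => if x i ∈ label j then (child j).outcomes x else []).flatten

/-- Every point of feature space is consistent with exactly one root-to-leaf path. -/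
def Proper (T : DTree d K) : Prop := ∀ x, (T.outcomes x).length = 1

/-- The classification function: the prediction of the unique path consistent with `x`. -/
def classify (T : DTree d K) (hT : T.Proper) (x : Point d) : Fin K :=
  (T.outcomes x).head (List.ne_nil_of_length_pos (by rw [hT x]; exact Nat.one_pos))

end DTree

/-- A decision tree with features `0, …, m - 1` with finite domains and classes `0, …, K - 1`,
an instance `(v, c)` with `κ(v) = c`, and a threshold `δ = num / den ∈ [0, 1]`. -/
structure Input where
  m : ℕ
  d : Fin m → ℕ
  K : ℕ
  tree : DTree d K
  proper : tree.Proper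
  v : Point d
  c : Fin K
  classify_v : tree.classify proper v = c
  num : ℕ
  den : ℕ
  den_pos : 0 < den
  num_le_den : num ≤ den

namespace Input

/-- The threshold `δ`. -/
def δ (I : Input) : ℚ := (I.num : ℚ) / (I.den : ℚ)

/-- `S` is a (C)`δ`-relevant set for the input's classifier and instance. -/
def Relevant (I : Input) (S : Finset (Fin I.m)) : Prop :=
  IsRelevant (I.tree.classify I.proper) I.v I.c I.δ S

/-- All features are boolean and there are two classes. -/
def Boolean (I : Input) : Prop := (∀ i, I.d i = 2) ∧ I.K = 2

end Input

/-! ### Encoding of inputs as strings -/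

/-- The alphabet `{blank, 0, 1, bra, ket, comma}`. -/
abbrev Sym : Type := Computability.Γ'

/-- Self-delimiting binary code of a natural number. -/
def encNat (n : ℕ) : List Sym := Computability.encodingNatΓ'.encode n ++ [.comma]

/-- Code of a finite sequence of natural numbers whose length is known from the context. -/
def encNats {n : ℕ} (f : Fin n → ℕ) : List Sym := (List.ofFn fun i => encNat (f i)).flatten

/-- The indicator word of a subset of `{0, …, n - 1}`. -/
def encSet {n : ℕ} (S : Finset (Fin n)) : List Sym := List.ofFn fun i => .bit (decide (i ∈ S))

/-- Code of a decision tree: the code of a non-terminal node lists its feature, its number of edges,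
and for each edge the table of its literal followed by the code of the subtree it leads to. -/
def DTree.enc {m : ℕ} {d : Fin m → ℕ} {K : ℕ} : DTree d K → List Sym
  | leaf c => .blank :: encNat c
  | node i r label child =>
      .bra :: (encNat i ++ encNat r ++
        (List.ofFn fun j => encSet (label j) ++ (child j).enc).flatten ++ [.ket])

/-- Code of an input. -/
def Input.enc (I : Input) : List Sym :=
  encNat I.m ++ encNats I.d ++ encNat I.K ++ I.tree.enc ++ encNats (fun i => (I.v i : ℕ)) ++
    encNat I.c ++ encNat I.num ++ encNat I.den

/-- Code of an input together with a size bound `k`. -/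
def encQuery (I : Input) (k : ℕ) : List Sym := I.enc ++ encNat k

/-! ### The decision problems -/

/-- Decision trees over boolean features with two classes: is there a `δ`-relevant set of size at
most `k`? -/
def deltaProblem : Language Sym :=
  {w | ∃ (I : Input) (k : ℕ), w = encQuery I k ∧ I.Boolean ∧
    ∃ S : Finset (Fin I.m), S.card ≤ k ∧ I.Relevant S}

/-- Decision trees over arbitrary finite domains and arbitrarily many classes: is there a
C`δ`-relevant set of size at most `k`? -/
def cDeltaProblem : Language Sym :=
  {w | ∃ (I : Input) (k : ℕ), w = encQuery I k ∧
    ∃ S : Finset (Fin I.m), S.card ≤ k ∧ I.Relevant S}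

/-- As `cDeltaProblem`, for subset-minimal C`δ`-relevant sets. -/
def minCDeltaProblem : Language Sym :=
  {w | ∃ (I : Input) (k : ℕ), w = encQuery I k ∧
    ∃ S : Finset (Fin I.m), S.card ≤ k ∧ Minimal I.Relevant S}

/-! ### The class NP -/

/-- A polynomial-time verifier: a predicate on all pairs (word, certificate), decided in polynomial
time by a Turing machine, with a polynomial bound on the length of the certificates. -/
structure NPVerifier (Γ : Type) where
  check : List Γ × List Bool → Bool
  bound : Polynomial ℕ
  polyTime : Nonempty (Turing.TM2ComputableInPolyTime
    (Computability.encodingProd (Computability.encodingList Γ)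
      (Computability.encodingList Bool)).encode
    Computability.encodeBool check)

/-- `w` is an admissible certificate for `x`. -/
def NPVerifier.Accepts {Γ : Type} (M : NPVerifier Γ) (x : List Γ) (w : List Bool) : Prop :=
  w.length ≤ M.bound.eval x.length ∧ M.check (x, w) = true

/-- The complexity class NP. -/
def InNP {Γ : Type} (L : Language Γ) : Prop :=
  ∃ M : NPVerifier Γ, ∀ x, x ∈ L ↔ ∃ w, M.Accepts x w

/-! ### Polynomial-time computation with a bounded number of oracle calls -/

/-- Run of an oracle algorithm on `x` with oracle `O`. From `x` and the answers obtained so far,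
`step` determines either the final output (flag `true`) or the next query (flag `false`).
The run fails (`none`) when more than `n` further calls are made
or when a query is longer than `B`. -/
def oracleRun {A : Type} (step : List Sym × List A → Bool × List Sym) (O : List Sym → A) (B : ℕ)
    (x : List Sym) : ℕ → List A → Option (List Sym)
  | 0, t =>
      match step (x, t) with
      | (true, y) => some y
      | (false, _) => none
  | n + 1, t =>
      match step (x, t) with
      | (true, y) => some y
      | (false, q) => if q.length ≤ B then oracleRun step O B x n (t ++ [O q]) else none

/-- `step` is computable in polynomial time, where the answers are written by means of `encA`. -/
def PolyTimeStep {A : Type} (encA : A → List Sym)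
    (step : List Sym × List A → Bool × List Sym) : Prop :=
  Nonempty (Turing.TM2ComputableInPolyTime
    (fun p : List Sym × List A => p.1.map Sum.inl ++ (p.2.flatMap encA).map Sum.inr)
    (fun o : Bool × List Sym => (.bit o.1 : Sym) :: o.2) step)

/-- A polynomial-time oracle algorithm that, whatever oracle with the property `IsOracle` it is
given, computes from each `a` a solution of `a`, with at most `calls a` oracle calls, all of
them of length polynomial in that of the code of `a`. -/
def SolvableWithCalls {A : Type} (encA : A → List Sym) (IsOracle : (List Sym → A) → Prop)
    {α : Type} (enc : α → List Sym) (Sol : α → List Sym → Prop) (calls : α → ℕ) : Prop :=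
  ∃ (step : List Sym × List A → Bool × List Sym) (p : Polynomial ℕ), PolyTimeStep encA step ∧
    ∀ O, IsOracle O → ∀ a, ∃ y,
      oracleRun step O (p.eval (enc a).length) (enc a) (calls a) [] = some y ∧ Sol a y

/-- Solvable with at most `calls a` calls to an oracle for a language in NP. -/
def SolvableWithNPCalls {α : Type} (enc : α → List Sym) (Sol : α → List Sym → Prop)
    (calls : α → ℕ) : Prop :=
  ∃ L : Language Sym, InNP L ∧
    SolvableWithCalls (A := Bool) (fun b => [.bit b]) (fun O => ∀ q, O q = true ↔ q ∈ L)
      enc Sol calls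

/-- Solvable with at most `calls a` calls to a certificate-returning NP oracle (such as a
satisfiability solver): to each query it answers with an admissible certificate, if there is one. -/
def SolvableWithNPWitnessCalls {α : Type} (enc : α → List Sym) (Sol : α → List Sym → Prop)
    (calls : α → ℕ) : Prop :=
  ∃ M : NPVerifier Sym,
    SolvableWithCalls (A := Option (List Bool))
      (fun a => match a with
        | none => [.comma]
        | some w => .bra :: w.map .bit ++ [.ket])
      (fun O => ∀ q, (∀ w, O q = some w → M.Accepts q w) ∧ (O q = none → ∀ w, ¬ M.Accepts q w))
      enc Sol calls

/-- `y` is the binary representation of the smallest `k` such that there is a (C)`δ`-relevant set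
of size at most `k`. -/
def IsMinSize (I : Input) (y : List Sym) : Prop :=
  ∃ k, y = encNat k ∧ IsLeast {k | ∃ S : Finset (Fin I.m), S.card ≤ k ∧ I.Relevant S} k

/-- `y` is the indicator word of a (C)`δ`-relevant set of smallest cardinality. -/
def IsMinSet (I : Input) (y : List Sym) : Prop :=
  ∃ S : Finset (Fin I.m), y = encSet S ∧ I.Relevant S ∧ ∀ S', I.Relevant S' → S.card ≤ S'.card

end DTRelevance

/-! Why relevance can be checked. A root-to-leaf path imposes a separate condition on each feature,
so the points that follow it and agree with `v` on `S` form a box, whose cardinality is a product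
with one factor per feature (`pathCount_eq`). Summing over the paths of class `c` gives the
numerator of the conditional probability, the empty path gives the denominator, and clearing
denominators leaves an inequality between natural numbers (`relevantOk_iff`). Since every relevant
set contains a subset-minimal one, the variant with minimal sets is the same language
(`minCDeltaProblem_eq`).

The languages consist of codes of genuine inputs, so malformed words have to be rejected too. A
certificate therefore contains, besides `S`, all data of the input in decoded form; the verifier
encodes them again and compares the result with the given word (`exists_of_verify`). That every
point follows exactly one path is a condition on exponentially many points, but it is also a matter
of counting: if `n(x)` paths are consistent with `x`, then `∑ n(x)` and `∑ n(x)²` both equal the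
number of points iff `∑ (n(x) - 1)² = 0`. The second sum is counted by concatenating pairs of paths
(`properOk_iff`).

For the oracle algorithms, the set of all features is relevant, so the smallest size `N` is at most
`m`. Whether a relevant set of size at most `k` exists is monotone in `k`, and each answer yields
one binary digit of `N`; as many queries suffice as `m` has digits, which is `⌈log₂(m+1)⌉`
(`oracleRun_search`). If certificates are returned, the last one contains a smallest set; if there
was none, all digits of `N` are one, whence `N = m` and the full set is optimal. Queries are words,
so the code must determine the input (`encQuery_inj`).

The Turing machines come from a small language of stack programs, compiled to `TM2` by
`Run.simulate`. The programs act on binary trees written in a prefix code on one stack. The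
predicate `Poly` on functions between tree-encoded types is closed under composition, pairing, case
distinction and folds with bounded intermediate results, so that most polynomial-time claims reduce
to `fun_prop`; `Poly.computable` leads back to machines. -/

namespace PolyTM

/-! ### A structured language of stack programs -/

/-- The stacks of a program: input, output, and four working stacks of bits. -/
inductive Stk
  | inp | out | main | tmp | aux | cnt
  deriving DecidableEq

instance : Fintype Stk where
  elems := {.inp, .out, .main, .tmp, .aux, .cnt}
  complete x := by cases x <;> decide

/-- The alphabet of each stack. -/
def Alph (A B : Type) : Stk → Type
  | .inp => A
  | .out => B
  | .main => Bool
  | .tmp => Bool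
  | .aux => Bool
  | .cnt => Bool

instance Alph.fintype (A B : Type) [Fintype A] [Fintype B] : ∀ k, Fintype (Alph A B k)
  | .inp => inferInstanceAs (Fintype A)
  | .out => inferInstanceAs (Fintype B)
  | .main => inferInstanceAs (Fintype Bool)
  | .tmp => inferInstanceAs (Fintype Bool)
  | .aux => inferInstanceAs (Fintype Bool)
  | .cnt => inferInstanceAs (Fintype Bool)

/-- Programs. `pop k f` pops the stack `k` and continues with the result; `loop k f` pops the
stack `k` and runs `f` on the result until the stack is empty. -/
inductive Prog (A B : Type) : Type
  | skip : Prog A B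
  | push (k : Stk) (s : Alph A B k) : Prog A B
  | pop (k : Stk) (f : Option (Alph A B k) → Prog A B) : Prog A B
  | seq (p q : Prog A B) : Prog A B
  | loop (k : Stk) (f : Alph A B k → Prog A B) : Prog A B

/-- Contents of the stacks. -/
abbrev Store (A B : Type) : Type := ∀ k, List (Alph A B k)

open Function in
/-- Big-step semantics with running time. -/
inductive Run {A B : Type} : Prog A B → Store A B → ℕ → Store A B → Prop
  | skip (S) : Run .skip S 1 S
  | push (k s S) : Run (.push k s) S 1 (update S k (s :: S k))
  | pop (k f S t S') (h : Run (f (S k).head?) (update S k (S k).tail) t S') :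
      Run (.pop k f) S (1 + t) S'
  | seq (p q S t S' t' S'') (h : Run p S t S') (h' : Run q S' t' S'') :
      Run (.seq p q) S (t + t') S''
  | loop_nil (k f S) (h : S k = []) : Run (.loop k f) S 1 S
  | loop_cons (k f S a l t S' t' S'') (h : S k = a :: l)
      (hb : Run (f a) (update S k l) t S') (hl : Run (.loop k f) S' t' S'') :
      Run (.loop k f) S (1 + (t + t')) S''

/-! ### Compilation to `TM2` machines -/

namespace Prog

variable {A B : Type}

/-- The labels of the machine that executes a program. -/
def Label : Prog A B → Type
  | skip => Unit
  | push _ _ => Unit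
  | pop _ f => Option (Σ o, Label (f o))
  | seq p q => Label p ⊕ Label q
  | loop _ f => Option (Σ s, Label (f s))

/-- The label at which the execution starts. -/
def entry : ∀ p : Prog A B, Label p
  | skip => ()
  | push _ _ => ()
  | pop _ _ => none
  | seq p _ => .inl (entry p)
  | loop _ _ => none

/-- There are finitely many labels. -/
@[reducible]
noncomputable def labelFintype [Fintype A] [Fintype B] : ∀ p : Prog A B, Fintype (Label p)
  | skip => inferInstanceAs (Fintype Unit)
  | push _ _ => inferInstanceAs (Fintype Unit)
  | pop k f =>
      haveI := fun o => labelFintype (f o)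
      inferInstanceAs (Fintype (Option (Σ o : Option (Alph A B k), Label (f o))))
  | seq p q =>
      haveI := labelFintype p
      haveI := labelFintype q
      inferInstanceAs (Fintype (Label p ⊕ Label q))
  | loop k f =>
      haveI := fun s => labelFintype (f s)
      inferInstanceAs (Fintype (Option (Σ s : Alph A B k, Label (f s))))

/-- Internal states of the machine: the results of the last pops. -/
abbrev Mem (A B : Type) : Type := Option A × Option B × Option Bool

/-- Record the result of a pop. -/
def memSet : ∀ k, Mem A B → Option (Alph A B k) → Mem A B
  | .inp, v, o => (o, v.2)
  | .out, v, o => (v.1, o, v.2.2)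
  | .main, v, o => (v.1, v.2.1, o)
  | .tmp, v, o => (v.1, v.2.1, o)
  | .aux, v, o => (v.1, v.2.1, o)
  | .cnt, v, o => (v.1, v.2.1, o)

/-- Recall the result of the last pop. -/
def memGet : ∀ k, Mem A B → Option (Alph A B k)
  | .inp, v => v.1
  | .out, v => v.2.1
  | .main, v => v.2.2
  | .tmp, v => v.2.2
  | .aux, v => v.2.2
  | .cnt, v => v.2.2

@[simp] lemma memGet_memSet (k : Stk) (v : Mem A B) (o : Option (Alph A B k)) :
    memGet k (memSet k v o) = o := by
  cases k <;> rfl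

open Turing in
/-- The statements of the machine, where the labels of the program are embedded by `emb` and the
control passes to `ex` at the end. -/
def stmt {Λ : Type} : ∀ p : Prog A B, (Label p → Λ) → Λ → Label p → TM2.Stmt (Alph A B) Λ (Mem A B)
  | skip, _, ex, _ => .goto fun _ => ex
  | push k s, _, ex, _ => .push k (fun _ => s) (.goto fun _ => ex)
  | pop k f, emb, ex, l =>
      match l with
      | none => .pop k (memSet k) (.goto fun v => emb (some ⟨memGet k v, entry _⟩))
      | some ⟨o, l⟩ => stmt (f o) (fun l => emb (some ⟨o, l⟩)) ex l
  | seq p q, emb, ex, l =>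
      match l with
      | .inl l => stmt p (fun l => emb (.inl l)) (emb (.inr (entry q))) l
      | .inr l => stmt q (fun l => emb (.inr l)) ex l
  | loop k f, emb, ex, l =>
      match l with
      | none => .pop k (memSet k) (.goto fun v =>
          match memGet k v with
          | none => ex
          | some s => emb (some ⟨s, entry _⟩))
      | some ⟨s, l⟩ => stmt (f s) (fun l => emb (some ⟨s, l⟩)) (emb none) l

end Prog

-- A subprogram is compiled in place inside a larger machine, so the induction needs an arbitrary
-- embedding `emb` of its labels and an arbitrary exit `ex`: the first half of a sequence exits to
-- the entry of the second, a loop body to the head of the loop. One unit of running time is exactly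
-- one machine step, which is why the same `t` serves as the number of iterations.
open Turing Prog in
theorem Run.simulate {A B Λ : Type} (M : Λ → TM2.Stmt (Alph A B) Λ (Mem A B))
    {p : Prog A B} {S : Store A B} {t : ℕ} {S' : Store A B} (h : Run p S t S') :
    ∀ (emb : Label p → Λ) (ex : Λ), (∀ l, M (emb l) = stmt p emb ex l) → ∀ v : Mem A B,
      ∃ v', (flip bind (TM2.step M))^[t] (some ⟨some (emb (entry p)), v, S⟩) =
        some ⟨some ex, v', S'⟩ := by
  induction h with
  | skip S =>
    intro emb ex hM v
    refine ⟨v, ?_⟩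
    simp [flip, hM, stmt]
  | push k s S =>
    intro emb ex hM v
    refine ⟨v, ?_⟩
    simp [flip, hM, stmt]
  | pop k f S t S' h ih =>
    intro emb ex hM v
    obtain ⟨v', hv⟩ := ih (fun l => emb (some ⟨_, l⟩)) ex (fun l => hM (some ⟨_, l⟩))
      (memSet k v (S k).head?)
    refine ⟨v', ?_⟩
    rw [add_comm, Function.iterate_add_apply, ← hv]
    congr 1
    have hM' : M (emb none) = _ := hM none
    simp only [stmt] at hM'
    simp [flip, entry]
    erw [hM']
    simp only [TM2.stepAux.eq_3, TM2.stepAux.eq_6]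
    rw [memGet_memSet]
  | seq p q S t S' t' S'' h h' ih ih' =>
    intro emb ex hM v
    obtain ⟨v₁, h₁⟩ := ih (fun l => emb (.inl l)) (emb (.inr (entry q))) (fun l => hM (.inl l)) v
    obtain ⟨v₂, h₂⟩ := ih' (fun l => emb (.inr l)) ex (fun l => hM (.inr l)) v₁
    refine ⟨v₂, ?_⟩
    rw [add_comm, Function.iterate_add_apply, ← h₂, ← h₁]
    rfl
  | loop_nil k f S h =>
    intro emb ex hM v
    refine ⟨memSet k v none, ?_⟩
    have hM' : M (emb none) = _ := hM none
    simp only [stmt] at hM'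
    simp [flip, entry]
    erw [hM']
    have : Function.update S k [] = S := by rw [← h, Function.update_eq_self]
    simp [h, this]
  | loop_cons k f S a l t S' t' S'' h hb hl ihb ihl =>
    intro emb ex hM v
    obtain ⟨v₁, h₁⟩ := ihb (fun l => emb (some ⟨_, l⟩)) (emb none) (fun l => hM (some ⟨_, l⟩))
      (memSet k v (some a))
    obtain ⟨v₂, h₂⟩ := ihl emb ex hM v₁
    refine ⟨v₂, ?_⟩
    -- Iterates apply the rightmost summand first: the pop, then the body, then the remaining
    -- rounds.
    rw [show 1 + (t + t') = t' + (t + 1) by ring, Function.iterate_add_apply,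
      Function.iterate_add_apply, ← h₂]
    congr 1
    simp only [entry] at h₁ ⊢
    rw [← h₁]
    congr 1
    have hM' : M (emb none) = _ := hM none
    simp only [stmt] at hM'
    simp [flip]
    erw [hM']
    simp [h]

/-- The contents of the stacks, listed. -/
def st {A B : Type} (i : List A) (o : List B) (m t u c : List Bool) : Store A B
  | .inp => i
  | .out => o
  | .main => m
  | .tmp => t
  | .aux => u
  | .cnt => c

open Turing Prog in
/-- The machine that executes a program. -/
noncomputable def Prog.machine {A B : Type} [Fintype A] [Fintype B] (p : Prog A B) : FinTM2 where
  K := Stk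
  k₀ := .inp
  k₁ := .out
  Γ := Alph A B
  Λ := Option (Label p)
  main := some (entry p)
  ΛFin := haveI := labelFintype p; inferInstance
  σ := Mem A B
  initialState := (none, none, none)
  Γk₀Fin := Alph.fintype A B .inp
  m l := match l with
    | none => .load (fun _ => (none, none, none)) .halt
    | some l => stmt p some none l

-- A halting configuration must have the initial internal state and only the output stack filled.
-- The program has to clean up its stacks; the additional label `none` resets the internal state, at
-- the price of the extra step in `q + 1`.
open Turing Prog in
theorem Run.computable {α β A B : Type} [Fintype A] [Fintype B] (encA : α → List A)
    (encB : β → List B) (f : α → β) (p : Prog A B) (q : Polynomial ℕ)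
    (h : ∀ a, ∃ t ≤ q.eval (encA a).length,
      Run p (st (encA a) [] [] [] [] []) t (st [] (encB (f a)) [] [] [] [])) :
    Nonempty (TM2ComputableInPolyTime encA encB f) := by
  refine ⟨⟨⟨p.machine, Equiv.refl _, Equiv.refl _⟩, q + 1, fun a => Nonempty.some ?_⟩⟩
  obtain ⟨t, ht, hr⟩ := h a
  obtain ⟨v, hv⟩ := hr.simulate p.machine.m some none (fun _ => rfl) (none, none, none)
  refine ⟨⟨⟨t + 1, ?_⟩, by simpa using ht⟩⟩
  rw [add_comm, Function.iterate_add_apply]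
  have e1 : initList p.machine (List.map (Equiv.refl _).invFun (encA a)) =
      (⟨some (some (entry p)), (none, none, none), st (encA a) [] [] [] [] []⟩ :
        TM2.Cfg (Alph A B) (Option (Label p)) (Mem A B)) := by
    unfold initList
    congr 1
    funext k
    cases k <;> first | rfl | exact List.map_id _
  have e2 : haltList p.machine (List.map (Equiv.refl _).invFun (encB (f a))) =
      (⟨none, (none, none, none), st [] (encB (f a)) [] [] [] []⟩ :
        TM2.Cfg (Alph A B) (Option (Label p)) (Mem A B)) := by
    unfold haltList
    congr 1
    funext k
    cases k <;> first | rfl | exact List.map_id _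
  have e3 := congrArg (flip bind (TM2.step p.machine.m)) hv
  simp only [Option.map_some]
  erw [e1, e2]
  rw [Function.iterate_one]
  exact e3

end PolyTM

/-! ### Elementary stack programs that operate on coded binary trees. -/

namespace PolyTM

/-! ### Binary trees as universal data -/

/-- Binary trees. -/
inductive Data
  | nil
  | cons (a b : Data)
  deriving DecidableEq

namespace Data

/-- Prefix code. -/
def code : Data → List Bool
  | nil => [false]
  | cons a b => true :: (code a ++ code b)

/-- Length of the code. -/
def size : Data → ℕ
  | nil => 1
  | cons a b => 1 + size a + size b

@[simp] lemma length_code (x : Data) : x.code.length = x.size := by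
  induction x with
  | nil => rfl
  | cons a b iha ihb => simp [code, size, iha, ihb]; omega

lemma size_pos (x : Data) : 0 < x.size := by cases x <;> simp [size]

/-- First component. -/
def hd : Data → Data
  | nil => nil
  | cons a _ => a

/-- Second component. -/
def tl : Data → Data
  | nil => nil
  | cons _ b => b

/-- The truth value `true`. -/
def tru : Data := cons nil nil

/-- The equality test. -/
def eqTest : Data → Data
  | nil => nil
  | cons a b => if a = b then tru else nil

/-- The first symbol tells a leaf from an inner node, so a code ends at a determined place. This is
what permits values to lie on one stack without separators, and trees to be compared through their
codes. -/
lemma code_append_inj : ∀ {x y : Data} {r s : List Bool},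
    x.code ++ r = y.code ++ s → x = y ∧ r = s
  | nil, nil, r, s, h => by simpa [code] using h
  | nil, cons _ _, r, s, h => by simp [code] at h
  | cons _ _, nil, r, s, h => by simp [code] at h
  | cons a b, cons a' b', r, s, h => by
    simp only [code, List.cons_append, List.append_assoc, List.cons.injEq, true_and] at h
    obtain ⟨h₁, h⟩ := code_append_inj h
    obtain ⟨h₂, h⟩ := code_append_inj h
    exact ⟨by rw [h₁, h₂], h⟩

lemma code_injective : Function.Injective code := fun x y h =>
  (code_append_inj (r := []) (s := []) (by simpa using h)).1

end Data

/-! ### Programs on the main stack -/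

/-- Execution within a time bound. -/
def Runs {A B : Type} (p : Prog A B) (S : Store A B) (n : ℕ) (S' : Store A B) : Prop :=
  ∃ t ≤ n, Run p S t S'

section

variable {A B : Type} {i : List A} {o : List B} {m t u c : List Bool}

open Function

@[simp] lemma st_inp : st i o m t u c .inp = i := rfl
@[simp] lemma st_out : st i o m t u c .out = o := rfl
@[simp] lemma st_main : st i o m t u c .main = m := rfl
@[simp] lemma st_tmp : st i o m t u c .tmp = t := rfl
@[simp] lemma st_aux : st i o m t u c .aux = u := rfl
@[simp] lemma st_cnt : st i o m t u c .cnt = c := rfl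

@[simp] lemma update_inp (x : List A) : update (st i o m t u c) .inp x = st x o m t u c := by
  funext k; cases k <;> rfl
@[simp] lemma update_out (x : List B) : update (st i o m t u c) .out x = st i x m t u c := by
  funext k; cases k <;> rfl
@[simp] lemma update_main (x : List Bool) :
    update (st i o m t u c) .main x = st i o x t u c := by
  funext k; cases k <;> rfl
@[simp] lemma update_tmp (x : List Bool) :
    update (st i o m t u c) .tmp x = st i o m x u c := by
  funext k; cases k <;> rfl
@[simp] lemma update_aux (x : List Bool) :
    update (st i o m t u c) .aux x = st i o m t x c := by
  funext k; cases k <;> rfl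
@[simp] lemma update_cnt (x : List Bool) :
    update (st i o m t u c) .cnt x = st i o m t u x := by
  funext k; cases k <;> rfl

end

namespace Runs

open Function

variable {A B : Type} {S S' S'' : Store A B}

lemma mono {p : Prog A B} {n n' : ℕ} (h : Runs p S n S') (hn : n ≤ n') : Runs p S n' S' :=
  let ⟨t, ht, hr⟩ := h; ⟨t, ht.trans hn, hr⟩

lemma skip : Runs (.skip : Prog A B) S 1 S := ⟨1, le_rfl, .skip S⟩

lemma push (k : Stk) (s : Alph A B k) : Runs (.push k s) S 1 (update S k (s :: S k)) :=
  ⟨1, le_rfl, .push k s S⟩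

lemma pop {k : Stk} {f : Option (Alph A B k) → Prog A B} {n : ℕ}
    (h : Runs (f (S k).head?) (update S k (S k).tail) n S') : Runs (.pop k f) S (1 + n) S' :=
  let ⟨t, ht, hr⟩ := h; ⟨1 + t, by omega, .pop k f S t S' hr⟩

lemma pop' {k : Stk} {f : Option (Alph A B k) → Prog A B} {n : ℕ} {a : Option (Alph A B k)}
    (ha : (S k).head? = a) (hS : update S k (S k).tail = S') (h : Runs (f a) S' n S'') :
    Runs (.pop k f) S (1 + n) S'' := by
  subst ha hS
  exact pop h

lemma seq {p q : Prog A B} {n n' : ℕ} (h : Runs p S n S') (h' : Runs q S' n' S'') :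
    Runs (.seq p q) S (n + n') S'' :=
  let ⟨t, ht, hr⟩ := h
  let ⟨t', ht', hr'⟩ := h'
  ⟨t + t', by omega, .seq p q S t S' t' S'' hr hr'⟩

lemma loop_nil {k : Stk} {f : Alph A B k → Prog A B} (h : S k = []) : Runs (.loop k f) S 1 S :=
  ⟨1, le_rfl, .loop_nil k f S h⟩

lemma loop_cons {k : Stk} {f : Alph A B k → Prog A B} {a l} {n n' : ℕ} (h : S k = a :: l)
    (hb : Runs (f a) (update S k l) n S') (hl : Runs (.loop k f) S' n' S'') :
    Runs (.loop k f) S (1 + (n + n')) S'' :=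
  let ⟨t, ht, hr⟩ := hb
  let ⟨t', ht', hr'⟩ := hl
  ⟨1 + (t + t'), by omega, .loop_cons k f S a l t S' t' S'' h hr hr'⟩

end Runs

namespace Prog

variable {A B : Type}

/-- Move the value on the top of `main` to `tmp`, reversing its code. -/
def scanTmp : Prog A B :=
  .seq (.push .cnt true) <| .loop .cnt fun _ => .pop .main fun
    | some false => .push .tmp false
    | some true => .seq (.push .tmp true) (.seq (.push .cnt true) (.push .cnt true))
    | none => .skip

/-- Move the value on the top of `main` to `aux`, reversing its code. -/
def scanAux : Prog A B :=
  .seq (.push .cnt true) <| .loop .cnt fun _ => .pop .main fun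
    | some false => .push .aux false
    | some true => .seq (.push .aux true) (.seq (.push .cnt true) (.push .cnt true))
    | none => .skip

/-- Move `tmp` to `main`. -/
def tmpToMain : Prog A B := .loop .tmp fun s => .push .main s

/-- Move `aux` to `main`. -/
def auxToMain : Prog A B := .loop .aux fun s => .push .main s

/-- Move `aux` to `tmp`. -/
def auxToTmp : Prog A B := .loop .aux fun s => .push .tmp s

/-- Move `tmp` to both `main` and `aux`. -/
def tmpToBoth : Prog A B := .loop .tmp fun s => .seq (.push .main s) (.push .aux s)

/-- Empty `tmp`. -/
def clearTmp : Prog A B := .loop .tmp fun _ => .skip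

/-- Empty `aux`. -/
def clearAux : Prog A B := .loop .aux fun _ => .skip

/-- Duplicate the top value. -/
def dup : Prog A B := .seq scanTmp (.seq tmpToBoth (.seq auxToTmp tmpToMain))

/-- Remove the top value. -/
def drop : Prog A B := .seq scanTmp clearTmp

/-- Exchange the two top values. -/
def swap : Prog A B := .seq scanTmp (.seq scanAux (.seq tmpToMain auxToMain))

/-- First component of the top value. -/
def hd : Prog A B := .pop .main fun
  | some true => .seq scanTmp (.seq scanAux (.seq clearAux tmpToMain))
  | _ => .push .main false

/-- Second component of the top value. -/
def tl : Prog A B := .pop .main fun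
  | some true => drop
  | _ => .push .main false

/-- Equality test of the two components of the top value. -/
def eqTest : Prog A B := .pop .main fun
  | some true => .seq scanTmp (.seq scanAux (.seq
      (.loop .tmp fun s => .pop .aux fun o : Option Bool =>
        if o = some (show Bool from s) then .skip else .push .cnt true)
      (.seq (.loop .aux fun _ => .push .cnt true) (.pop .cnt fun
        | none => .seq (.push .main false) (.seq (.push .main false) (.push .main true))
        | some _ => .seq (.loop .cnt fun _ => .skip) (.push .main false)))))
  | _ => .push .main false

/-- Replace the top value `x` by `cons (f x) (g x)`. -/
def pair (f g : Prog A B) : Prog A B :=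
  .seq dup (.seq g (.seq swap (.seq f (.push .main true))))

/-- Replace the top value by `nil`. -/
def nil : Prog A B := .seq drop (.push .main false)

/-- Run `h` or `g` according as the value of `f` is `nil` or not. -/
def ite (f g h : Prog A B) : Prog A B :=
  .seq dup (.seq f (.pop .main fun
    | some true => .seq drop (.seq drop g)
    | _ => h))

/-- Raise the flag in `cnt` unless the first component of the top value is `nil`. -/
def flag : Prog A B :=
  .seq dup (.seq hd (.pop .main fun
    | some true => .seq drop (.seq drop (.push .cnt true))
    | _ => .skip))

/-- Run `f` until the first component of the top value is `nil`. -/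
def whileNil (f : Prog A B) : Prog A B := .seq flag (.loop .cnt fun _ => .seq f flag)

end Prog

section

open Prog Data

variable {A B : Type} {i : List A} {o : List B} {m t u c r : List Bool} {n n' : ℕ}
  {S S' S'' : Store A B}

namespace Runs

lemma conv {p : Prog A B} (h : Runs p S n S') (hn : n ≤ n') (hs : S' = S'') :
    Runs p S n' S'' := hs ▸ h.mono hn

lemma push_main (s : Bool) : Runs (.push .main s) (st i o m t u c) 1 (st i o (s :: m) t u c) := 
  (Runs.push (S := st i o m t u c) .main s).conv le_rfl (update_main _)
lemma push_tmp (s : Bool) : Runs (.push .tmp s) (st i o m t u c) 1 (st i o m (s :: t) u c) := 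
  (Runs.push (S := st i o m t u c) .tmp s).conv le_rfl (update_tmp _)
lemma push_aux (s : Bool) : Runs (.push .aux s) (st i o m t u c) 1 (st i o m t (s :: u) c) := 
  (Runs.push (S := st i o m t u c) .aux s).conv le_rfl (update_aux _)
lemma push_cnt (s : Bool) : Runs (.push .cnt s) (st i o m t u c) 1 (st i o m t u (s :: c)) := 
  (Runs.push (S := st i o m t u c) .cnt s).conv le_rfl (update_cnt _)
lemma push_out (s : B) : Runs (.push .out s) (st i o m t u c) 1 (st i (s :: o) m t u c) := 
  (Runs.push (S := st i o m t u c) .out s).conv le_rfl (update_out _)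

lemma pop_main {f : Option Bool → Prog A B} {s : Bool} (h : Runs (f (some s)) (st i o m t u c) n S') :
    Runs (.pop .main f) (st i o (s :: m) t u c) (1 + n) S' :=
  Runs.pop' rfl (update_main _) h
lemma pop_aux_nil {f : Option Bool → Prog A B} (h : Runs (f none) (st i o m t [] c) n S') :
    Runs (.pop .aux f) (st i o m t [] c) (1 + n) S' :=
  Runs.pop' rfl (update_aux _) h
lemma pop_aux {f : Option Bool → Prog A B} {s : Bool} (h : Runs (f (some s)) (st i o m t u c) n S') :
    Runs (.pop .aux f) (st i o m t (s :: u) c) (1 + n) S' :=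
  Runs.pop' rfl (update_aux _) h
lemma pop_cnt_nil {f : Option Bool → Prog A B} (h : Runs (f none) (st i o m t u []) n S') :
    Runs (.pop .cnt f) (st i o m t u []) (1 + n) S' :=
  Runs.pop' rfl (update_cnt _) h
lemma pop_cnt {f : Option Bool → Prog A B} {s : Bool} (h : Runs (f (some s)) (st i o m t u c) n S') :
    Runs (.pop .cnt f) (st i o m t u (s :: c)) (1 + n) S' :=
  Runs.pop' rfl (update_cnt _) h

lemma loop_inp_nil {f : A → Prog A B} :
    Runs (.loop .inp f) (st [] o m t u c) 1 (st [] o m t u c) := Runs.loop_nil rfl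
lemma loop_tmp_nil {f : Bool → Prog A B} :
    Runs (.loop .tmp f) (st i o m [] u c) 1 (st i o m [] u c) := Runs.loop_nil rfl
lemma loop_aux_nil {f : Bool → Prog A B} :
    Runs (.loop .aux f) (st i o m t [] c) 1 (st i o m t [] c) := Runs.loop_nil rfl
lemma loop_cnt_nil {f : Bool → Prog A B} :
    Runs (.loop .cnt f) (st i o m t u []) 1 (st i o m t u []) := Runs.loop_nil rfl

lemma loop_inp {f : A → Prog A B} {a : A} (hb : Runs (f a) (st i o m t u c) n S')
    (hl : Runs (.loop .inp f) S' n' S'') :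
    Runs (.loop .inp f) (st (a :: i) o m t u c) (1 + (n + n')) S'' :=
  Runs.loop_cons (S := st (a :: i) o m t u c) (k := .inp) (l := i) rfl (by simpa using hb) hl
lemma loop_tmp {f : Bool → Prog A B} {a : Bool} (hb : Runs (f a) (st i o m t u c) n S')
    (hl : Runs (.loop .tmp f) S' n' S'') :
    Runs (.loop .tmp f) (st i o m (a :: t) u c) (1 + (n + n')) S'' :=
  Runs.loop_cons (S := st i o m (a :: t) u c) (k := .tmp) (l := t) rfl (by simpa using hb) hl
lemma loop_aux {f : Bool → Prog A B} {a : Bool} (hb : Runs (f a) (st i o m t u c) n S')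
    (hl : Runs (.loop .aux f) S' n' S'') :
    Runs (.loop .aux f) (st i o m t (a :: u) c) (1 + (n + n')) S'' :=
  Runs.loop_cons (S := st i o m t (a :: u) c) (k := .aux) (l := u) rfl (by simpa using hb) hl
lemma loop_cnt {f : Bool → Prog A B} {a : Bool} (hb : Runs (f a) (st i o m t u c) n S')
    (hl : Runs (.loop .cnt f) S' n' S'') :
    Runs (.loop .cnt f) (st i o m t u (a :: c)) (1 + (n + n')) S'' :=
  Runs.loop_cons (S := st i o m t u (a :: c)) (k := .cnt) (l := c) rfl (by simpa using hb) hl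

end Runs

/-- The stack `cnt` holds one mark for each tree still to be read: each round removes a mark, and
reading an inner node adds two. The statement extends a run of the loop backwards by one tree, so
that the two induction hypotheses for the subtrees can be chained. -/
lemma runs_scanTmp_loop (x : Data) : ∀ {t c r : List Bool} {n : ℕ} {S' : Store A B},
    Runs (.loop .cnt fun _ => .pop .main fun
      | some false => .push .tmp false
      | some true => .seq (.push .tmp true) (.seq (.push .cnt true) (.push .cnt true))
      | none => .skip) (st i o (r) (x.code.reverse ++ t) u (c)) n S' →
    Runs (.loop .cnt fun _ => .pop .main fun
      | some false => .push .tmp false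
      | some true => .seq (.push .tmp true) (.seq (.push .cnt true) (.push .cnt true))
      | none => .skip) (st i o (x.code ++ r) (t) u (true :: c)) (5 * x.size + n) S' := by
  induction x with
  | nil =>
    intro t c r n S' h
    exact (Runs.loop_cnt (Runs.pop_main (Runs.push_tmp false)) h).mono (by simp [size]; omega)
  | cons a b iha ihb =>
    intro t c r n S' h
    have h2 := iha (ihb (t := a.code.reverse ++ (true :: t)) (c := c) (r := r) (n := n)
      (S' := S') (by simpa [code] using h))
    simp only [code, List.cons_append, List.append_assoc]
    exact (Runs.loop_cnt (Runs.pop_main ((Runs.push_tmp true).seq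
      ((Runs.push_cnt true).seq (Runs.push_cnt true)))) h2).mono (by simp [size]; omega)

lemma runs_scanTmp (x : Data) :
    Runs scanTmp (st i o (x.code ++ r) t u []) (5 * x.size + 2)
      (st i o (r) (x.code.reverse ++ t) u ([])) :=
  ((Runs.push_cnt true).seq (runs_scanTmp_loop x Runs.loop_cnt_nil)).mono (by omega)

lemma runs_scanAux_loop (x : Data) : ∀ {u c r : List Bool} {n : ℕ} {S' : Store A B},
    Runs (.loop .cnt fun _ => .pop .main fun
      | some false => .push .aux false
      | some true => .seq (.push .aux true) (.seq (.push .cnt true) (.push .cnt true))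
      | none => .skip) (st i o (r) t (x.code.reverse ++ u) (c)) n S' →
    Runs (.loop .cnt fun _ => .pop .main fun
      | some false => .push .aux false
      | some true => .seq (.push .aux true) (.seq (.push .cnt true) (.push .cnt true))
      | none => .skip) (st i o (x.code ++ r) t (u) (true :: c)) (5 * x.size + n) S' := by
  induction x with
  | nil =>
    intro u c r n S' h
    exact (Runs.loop_cnt (Runs.pop_main (Runs.push_aux false)) h).mono (by simp [size]; omega)
  | cons a b iha ihb =>
    intro u c r n S' h
    have h2 := iha (ihb (u := a.code.reverse ++ (true :: u)) (c := c) (r := r) (n := n)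
      (S' := S') (by simpa [code] using h))
    simp only [code, List.cons_append, List.append_assoc]
    exact (Runs.loop_cnt (Runs.pop_main ((Runs.push_aux true).seq
      ((Runs.push_cnt true).seq (Runs.push_cnt true)))) h2).mono (by simp [size]; omega)

lemma runs_scanAux (x : Data) :
    Runs scanAux (st i o (x.code ++ r) t u []) (5 * x.size + 2)
      (st i o (r) t (x.code.reverse ++ u) ([])) :=
  ((Runs.push_cnt true).seq (runs_scanAux_loop x Runs.loop_cnt_nil)).mono (by omega)

lemma runs_tmpToMain : Runs tmpToMain (st i o m t u c) (2 * t.length + 1)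
    (st i o (t.reverse ++ m) [] u c) := by
  induction t generalizing m with
  | nil => exact Runs.loop_tmp_nil
  | cons a t ih =>
    exact (Runs.loop_tmp (Runs.push_main a) ih).conv (by simp; omega) (by simp)

lemma runs_auxToMain : Runs auxToMain (st i o m t u c) (2 * u.length + 1)
    (st i o (u.reverse ++ m) t [] c) := by
  induction u generalizing m with
  | nil => exact Runs.loop_aux_nil
  | cons a u ih =>
    exact (Runs.loop_aux (Runs.push_main a) ih).conv (by simp; omega) (by simp)

lemma runs_auxToTmp : Runs auxToTmp (st i o m t u c) (2 * u.length + 1)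
    (st i o m (u.reverse ++ t) [] c) := by
  induction u generalizing t with
  | nil => exact Runs.loop_aux_nil
  | cons a u ih =>
    exact (Runs.loop_aux (Runs.push_tmp a) ih).conv (by simp; omega) (by simp)

lemma runs_tmpToBoth : Runs tmpToBoth (st i o m t u c) (3 * t.length + 1)
    (st i o (t.reverse ++ m) [] (t.reverse ++ u) c) := by
  induction t generalizing m u with
  | nil => exact Runs.loop_tmp_nil
  | cons a t ih =>
    exact (Runs.loop_tmp ((Runs.push_main a).seq (Runs.push_aux a)) ih).conv (by simp; omega) (by simp)

lemma runs_clearTmp : Runs clearTmp (st i o m t u c) (2 * t.length + 1)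
    (st i o m [] u c) := by
  induction t with
  | nil => exact Runs.loop_tmp_nil
  | cons a t ih =>
    exact (Runs.loop_tmp Runs.skip ih).conv (by simp; omega) (by simp)

lemma runs_clearAux : Runs clearAux (st i o m t u c) (2 * u.length + 1)
    (st i o m t [] c) := by
  induction u with
  | nil => exact Runs.loop_aux_nil
  | cons a u ih =>
    exact (Runs.loop_aux Runs.skip ih).conv (by simp; omega) (by simp)

lemma runs_dup (x : Data) : Runs dup (st i o (x.code ++ r) [] [] []) (12 * x.size + 5)
    (st i o (x.code ++ (x.code ++ r)) [] [] []) := by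
  apply Runs.conv
  · exact (runs_scanTmp x).seq (runs_tmpToBoth.seq (runs_auxToTmp.seq runs_tmpToMain))
  · simp; omega
  · simp

lemma runs_drop (x : Data) : Runs drop (st i o (x.code ++ r) [] [] []) (7 * x.size + 3)
    (st i o r [] [] []) := by
  apply Runs.mono
  · exact (runs_scanTmp x).seq runs_clearTmp
  · simp; omega

lemma runs_swap (x y : Data) : Runs swap (st i o (x.code ++ (y.code ++ r)) [] [] [])
    (7 * (x.size + y.size) + 6) (st i o (y.code ++ (x.code ++ r)) [] [] []) := by
  apply Runs.conv
  · exact (runs_scanTmp x).seq ((runs_scanAux y).seq (runs_tmpToMain.seq runs_auxToMain))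
  · simp; omega
  · simp

lemma runs_hd (x : Data) : Runs Prog.hd (st i o (x.code ++ r) [] [] []) (7 * x.size + 7)
    (st i o (x.hd.code ++ r) [] [] []) := by
  cases x with
  | nil => exact (Runs.pop_main (Runs.push_main false)).mono (by simp)
  | cons a b =>
    simp only [code, List.cons_append, List.append_assoc]
    apply Runs.conv
    · exact Runs.pop_main ((runs_scanTmp a).seq ((runs_scanAux b).seq
        (runs_clearAux.seq runs_tmpToMain)))
    · simp [size]; omega
    · simp [Data.hd]

lemma runs_tl (x : Data) : Runs Prog.tl (st i o (x.code ++ r) [] [] []) (7 * x.size + 4)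
    (st i o (x.tl.code ++ r) [] [] []) := by
  cases x with
  | nil => exact (Runs.pop_main (Runs.push_main false)).mono (by simp)
  | cons a b =>
    simp only [code, List.cons_append, List.append_assoc]
    exact (Runs.pop_main (runs_drop a)).mono (by simp [size]; omega)

lemma runs_nil (x : Data) : Runs Prog.nil (st i o (x.code ++ r) [] [] []) (7 * x.size + 4)
    (st i o (Data.nil.code ++ r) [] [] []) :=
  ((runs_drop x).seq (Runs.push_main false)).mono (by omega)

/-- The comparison loop of the equality test. -/
def compareTmpAux : Prog A B :=
  .loop .tmp fun s => .pop .aux fun o : Option Bool =>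
    if o = some (show Bool from s) then .skip else .push .cnt true

/-- A difference shows either as a mark on `cnt` (two distinct symbols, or `aux` exhausted too
early) or as an unread rest `u'` of `aux`. Both have to be recorded, since the words may have
different lengths. -/
lemma runs_compareTmpAux : ∃ k u' , (k = 0 ∧ u' = [] ↔ t = u) ∧ k ≤ t.length ∧
    u'.length ≤ u.length ∧
    Runs compareTmpAux (st i o m t u c) (3 * t.length + 1)
      (st i o m [] u' (List.replicate k true ++ c)) := by
  induction t generalizing u c with
  | nil => exact ⟨0, u, by simp [eq_comm], by simp, le_rfl, Runs.loop_tmp_nil⟩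
  | cons a t ih =>
    cases u with
    | nil =>
      obtain ⟨k, u', h, hk, hu, hr⟩ := ih (u := []) (c := true :: c)
      refine ⟨k + 1, u', by simp, by simpa using hk, hu, ?_⟩
      exact (Runs.loop_tmp (Runs.pop_aux_nil (Runs.push_cnt true)) hr).conv
        (by simp; omega) (by simp [List.replicate_succ'])
    | cons b u =>
      by_cases hab : b = a
      · subst hab
        obtain ⟨k, u', h, hk, hu, hr⟩ := ih (u := u) (c := c)
        refine ⟨k, u', by simpa using h, hk.trans (by simp), hu.trans (by simp), ?_⟩
        exact (Runs.loop_tmp (Runs.pop_aux (by rw [if_pos rfl]; exact Runs.skip)) hr).conv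
          (by simp; omega) (by simp)
      · obtain ⟨k, u', h, hk, hu, hr⟩ := ih (u := u) (c := true :: c)
        refine ⟨k + 1, u', by simp [Ne.symm hab], by simpa using hk, hu.trans (by simp), ?_⟩
        exact (Runs.loop_tmp (Runs.pop_aux
          (by rw [if_neg (by simpa using hab)]; exact Runs.push_cnt true)) hr).conv
          (by simp; omega) (by simp [List.replicate_succ'])

lemma runs_markAux : Runs (.loop .aux fun _ => .push .cnt true) (st i o m t u c)
    (2 * u.length + 1) (st i o m t [] (List.replicate u.length true ++ c)) := by
  induction u generalizing c with
  | nil => exact Runs.loop_aux_nil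
  | cons a u ih =>
    exact (Runs.loop_aux (f := fun _ => .push .cnt true) (Runs.push_cnt true) ih).conv (by simp; omega)
      (by simp [List.replicate_succ'])

lemma runs_clearCnt : Runs (.loop .cnt fun _ => .skip) (st i o m t u c)
    (2 * c.length + 1) (st i o m t u []) := by
  induction c with
  | nil => exact Runs.loop_cnt_nil
  | cons a c ih => exact (Runs.loop_cnt Runs.skip ih).conv (by simp; omega) rfl

lemma runs_eqTest (x : Data) : Runs Prog.eqTest (st i o (x.code ++ r) [] [] []) (20 * x.size + 20)
    (st i o (x.eqTest.code ++ r) [] [] []) := by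
  cases x with
  | nil => exact (Runs.pop_main (Runs.push_main false)).mono (by simp)
  | cons a b =>
    simp only [code, List.cons_append, List.append_assoc]
    obtain ⟨k, u', h, hk, hu, hr⟩ := runs_compareTmpAux (i := i) (o := o) (m := r)
      (t := a.code.reverse ++ []) (u := b.code.reverse ++ []) (c := [])
    have hm := runs_markAux (i := i) (o := o) (m := r) (t := []) (u := u')
      (c := List.replicate k true ++ [])
    simp only [List.append_nil, List.reverse_inj, Data.code_injective.eq_iff, List.length_reverse,
      length_code] at h hk hu
    by_cases hab : a = b
    · obtain ⟨rfl, rfl⟩ := h.2 hab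
      apply Runs.conv
      · exact Runs.pop_main ((runs_scanTmp a).seq ((runs_scanAux b).seq (hr.seq (hm.seq
          (Runs.pop_cnt_nil ((Runs.push_main false).seq ((Runs.push_main false).seq
            (Runs.push_main true))))))))
      · simp [size]; omega
      · simp [Data.eqTest, hab, tru, code]
    -- The unread rest of `aux` has been turned into further marks; distinct trees leave at least
    -- one mark, so the next pop of `cnt` succeeds.
    · have hl : ∃ l : List Bool, List.replicate u'.length true ++ (List.replicate k true ++ []) =
          true :: l ∧ l.length ≤ k + u'.length := by
        rcases hq : u'.length + k with _ | q
        · exact absurd (h.1 ⟨by omega, List.length_eq_zero_iff.1 (by omega)⟩) hab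
        · refine ⟨List.replicate q true, ?_, by simp; omega⟩
          rw [List.append_nil, ← List.replicate_add, hq, List.replicate_succ]
      obtain ⟨l, hl, hll⟩ := hl
      rw [hl] at hm
      apply Runs.conv
      · exact Runs.pop_main ((runs_scanTmp a).seq ((runs_scanAux b).seq (hr.seq (hm.seq
          (Runs.pop_cnt (runs_clearCnt.seq (Runs.push_main false)))))))
      · simp [size]; omega
      · simp [Data.eqTest, hab, code]

end

end PolyTM

/-! ### Polynomial-time functions between tree-encoded types, and the conversion of words to trees
and back. -/

namespace PolyTM

open Polynomial

lemma polynomial_eval_mono (q : ℕ[X]) {a b : ℕ} (h : a ≤ b) : q.eval a ≤ q.eval b := by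
  rw [eval_eq_sum, eval_eq_sum]
  exact Finset.sum_le_sum fun i _ => Nat.mul_le_mul_left _ (Nat.pow_le_pow_left h i)

/-! ### Polynomial-time functions -/

/-- Types whose elements are represented by binary trees. -/
class Enc (α : Type) where
  toD : α → Data
  inj : Function.Injective toD

open Enc (toD)

/-- The size of an element. -/
def sz {α : Type} [Enc α] (a : α) : ℕ := (toD a).size

instance : Enc Data := ⟨fun x => x, fun _ _ h => h⟩

instance : Enc Bool := ⟨fun b => if b then .tru else .nil, fun a b h => by
  cases a <;> cases b <;> simp_all [Data.tru]⟩

instance {α β : Type} [Enc α] [Enc β] : Enc (α × β) := ⟨fun p => .cons (toD p.1) (toD p.2),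
  fun p q h => by
    rw [Data.cons.injEq] at h
    exact Prod.ext (Enc.inj h.1) (Enc.inj h.2)⟩

@[simp] lemma toD_data (x : Data) : toD x = x := rfl
@[simp] lemma toD_true : toD true = .tru := rfl
@[simp] lemma toD_false : toD false = .nil := rfl
@[simp] lemma toD_prod {α β : Type} [Enc α] [Enc β] (p : α × β) :
    toD p = .cons (toD p.1) (toD p.2) := rfl

lemma sz_pos {α : Type} [Enc α] (a : α) : 0 < sz a := Data.size_pos _
lemma sz_prod {α β : Type} [Enc α] [Enc β] (p : α × β) : sz p = 1 + sz p.1 + sz p.2 := rfl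
lemma sz_data (x : Data) : sz x = x.size := rfl

/-- `f` is computed on the main stack in polynomial time. -/
@[fun_prop]
def Poly {α β : Type} [Enc α] [Enc β] (f : α → β) : Prop :=
  ∃ q : ℕ[X], (∀ x, sz (f x) ≤ q.eval (sz x)) ∧
    ∀ A B : Type, ∃ P : Prog A B, ∀ x i o r,
      Runs P (st i o ((toD x).code ++ r) [] [] []) (q.eval (sz x))
        (st i o ((toD (f x)).code ++ r) [] [] [])

namespace Poly

variable {α β γ δ : Type} [Enc α] [Enc β] [Enc γ] [Enc δ]

/-- A function that acts on the representing trees like a polynomial-time function of trees. -/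
lemma of_data {F : Data → Data} (hF : Poly F) {f : α → β} (h : ∀ a, toD (f a) = F (toD a)) :
    Poly f := by
  obtain ⟨q, hq, hQ⟩ := hF
  refine ⟨q, fun x => ?_, fun A B => ?_⟩
  · rw [sz, h]
    exact hq (toD x)
  · obtain ⟨Q, hQ⟩ := hQ A B
    exact ⟨Q, fun x i o r => by rw [h]; exact hQ (toD x) i o r⟩

@[fun_prop]
lemma id' : Poly fun x : α => x :=
  ⟨X + 1, fun x => by simp, fun A B => ⟨.skip, fun x i o r => Runs.skip.mono (by simp)⟩⟩

-- The inner function's output size bounds the argument of the outer one; polynomials over `ℕ` are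
-- monotone, so the outer running time is polynomial in the original argument. This is the reason
-- for including a size bound in `Poly`.
@[fun_prop]
lemma comp {f : β → γ} {g : α → β} (hf : Poly f) (hg : Poly g) : Poly fun x => f (g x) := by
  obtain ⟨p, hp, hP⟩ := hf
  obtain ⟨q, hq, hQ⟩ := hg
  refine ⟨q + p.comp q, fun x => ?_, fun A B => ?_⟩
  · rw [eval_add, eval_comp]
    exact ((hp _).trans (polynomial_eval_mono p (hq x))).trans (Nat.le_add_left _ _)
  · obtain ⟨P, hP⟩ := hP A B
    obtain ⟨Q, hQ⟩ := hQ A B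
    refine ⟨.seq Q P, fun x i o r => ((hQ x i o r).seq (hP (g x) i o r)).mono ?_⟩
    rw [eval_add, eval_comp]
    exact Nat.add_le_add_left (polynomial_eval_mono p (hq x)) _

lemma data_nil : Poly fun _ : Data => Data.nil :=
  ⟨7 * X + 4, fun x => by simp [sz_data, Data.size], fun A B => ⟨Prog.nil, fun x i o r =>
    (runs_nil x).mono (by simp [sz_data])⟩⟩

lemma data_hd : Poly Data.hd :=
  ⟨7 * X + 7, fun x => by cases x <;> simp [sz_data, Data.size, Data.hd]; omega,
    fun A B => ⟨Prog.hd, fun x i o r => (runs_hd x).mono (by simp [sz_data])⟩⟩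

lemma data_tl : Poly Data.tl :=
  ⟨7 * X + 4, fun x => by cases x <;> simp [sz_data, Data.size, Data.tl]; omega,
    fun A B => ⟨Prog.tl, fun x i o r => (runs_tl x).mono (by simp [sz_data])⟩⟩

lemma data_eqTest : Poly Data.eqTest := by
  refine ⟨20 * X + 20, fun x => ?_,
    fun A B => ⟨Prog.eqTest, fun x i o r => (runs_eqTest x).mono (by simp [sz_data])⟩⟩
  cases x
  · simp [sz_data, Data.size, Data.eqTest]
  · simp only [sz_data, Data.eqTest]
    split_ifs <;> simp [Data.size, Data.tru]

-- The argument is duplicated, `g` is applied to the upper copy, and after a swap `f` to the other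
-- one. In this order the code of `f x` ends above that of `g x`, and one more symbol on top makes a
-- pair of them.
@[fun_prop]
lemma prodMk {f : α → β} {g : α → γ} (hf : Poly f) (hg : Poly g) : Poly fun x => (f x, g x) := by
  obtain ⟨p, hp, hP⟩ := hf
  obtain ⟨q, hq, hQ⟩ := hg
  refine ⟨8 * (p + q) + 19 * X + 20, fun x => ?_, fun A B => ?_⟩
  · have := hp x
    have := hq x
    simp [sz_prod]
    omega
  · obtain ⟨P, hP⟩ := hP A B
    obtain ⟨Q, hQ⟩ := hQ A B
    refine ⟨Prog.pair P Q, fun x i o r => ?_⟩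
    apply Runs.conv
    · exact (runs_dup (toD x)).seq ((hQ x i o _).seq ((runs_swap (toD (g x)) (toD x)).seq
        ((hP x i o _).seq (Runs.push_main true))))
    · have := hp x
      have := hq x
      simp only [sz] at *
      simp
      omega
    · simp [Data.code]

@[fun_prop]
lemma cond {f : α → Bool} {g h : α → β} (hf : Poly f) (hg : Poly g) (hh : Poly h) :
    Poly fun x => cond (f x) (g x) (h x) := by
  obtain ⟨p, hp, hP⟩ := hf
  obtain ⟨q, hq, hQ⟩ := hg
  obtain ⟨s, hs, hS⟩ := hh
  refine ⟨12 * X + 20 + 8 * p + q + s + 30, fun x => ?_, fun A B => ?_⟩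
  · have := hq x
    have := hs x
    beta_reduce
    cases f x <;> simp <;> omega
  · obtain ⟨P, hP⟩ := hP A B
    obtain ⟨Q, hQ⟩ := hQ A B
    obtain ⟨S, hS⟩ := hS A B
    refine ⟨Prog.ite P Q S, fun x i o r => ?_⟩
    have h1 := hP x i o ((toD x).code ++ r)
    have h2 := hp x
    beta_reduce
    cases hx : f x with
    | false =>
      rw [hx] at h1
      simp only [cond_false]
      refine ((runs_dup (toD x)).seq (h1.seq (Runs.pop_main (hS x i o r)))).mono ?_
      simp [sz]
      omega
    | true =>
      rw [hx] at h1 h2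
      simp only [cond_true]
      -- The code of the truth value consists of the inner-node symbol and two leaves. Popping the
      -- symbol decides the test, and the two leaves must still be dropped before `x` is on top
      -- again.
      replace h1 := h1.conv (S'' := st i o (true :: (Data.nil.code ++ (Data.nil.code ++
        ((toD x).code ++ r)))) [] [] []) le_rfl (by simp [Data.tru, Data.code])
      refine ((runs_dup (toD x)).seq (h1.seq (Runs.pop_main ((runs_drop .nil).seq
        ((runs_drop .nil).seq (hQ x i o r)))))).mono ?_
      simp [Data.size, sz]
      omega

/-- The contents of `cnt` after the evaluation of the loop condition on `x`. -/
def flagOf : Data → List Bool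
  | .cons (.cons _ _) _ => [true]
  | _ => []

lemma runs_flag {A B : Type} {i : List A} {o : List B} {r : List Bool} (x : Data) :
    Runs Prog.flag (st i o (x.code ++ r) [] [] []) (26 * x.size + 22)
      (st i o (x.code ++ r) [] [] (flagOf x)) := by
  match x with
  | .nil =>
    exact ((runs_dup _).seq ((runs_hd _).seq (Runs.pop_main Runs.skip))).mono (by omega)
  | .cons .nil b =>
    exact ((runs_dup _).seq ((runs_hd _).seq (Runs.pop_main Runs.skip))).mono (by omega)
  | .cons (.cons a a') b =>
    have h := runs_hd (i := i) (o := o) (r := (Data.cons (.cons a a') b).code ++ r)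
      (Data.cons (.cons a a') b)
    replace h := h.conv (S'' := st i o (true :: (a.code ++ (a'.code ++
      ((Data.cons (.cons a a') b).code ++ r)))) [] [] []) le_rfl (by simp [Data.hd, Data.code])
    refine ((runs_dup _).seq (h.seq (Runs.pop_main ((runs_drop a).seq ((runs_drop a').seq
      (Runs.push_cnt true)))))).mono ?_
    simp [Data.size]
    omega

/-- With `M` bounding all iterates, each round costs one step for the loop, at most `q.eval M` for
the body and `26 * M + 22` for testing the condition anew; the last unit is the exit from the loop.
-/
lemma runs_whileLoop {A B : Type} {i : List A} {o : List B} {r : List Bool} {P : Prog A B}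
    {q : ℕ[X]} {M : ℕ} {f : α → α}
    (hP : ∀ x, Runs P (st i o ((toD x).code ++ r) [] [] []) (q.eval (sz x))
      (st i o ((toD (f x)).code ++ r) [] [] [])) (n : ℕ) :
    ∀ x, (∀ k ≤ n, sz (f^[k] x) ≤ M) → (∀ k < n, (toD (f^[k] x)).hd ≠ .nil) →
      (toD (f^[n] x)).hd = .nil →
      Runs (.loop .cnt fun _ => .seq P .flag) (st i o ((toD x).code ++ r) [] [] (flagOf (toD x)))
        (n * (q.eval M + 26 * M + 23) + 1) (st i o ((toD (f^[n] x)).code ++ r) [] [] []) := by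
  induction n with
  | zero =>
    intro x _ _ h
    have : flagOf (toD x) = [] := by
      match toD x, h with
      | .nil, _ => rfl
      | .cons .nil _, _ => rfl
    rw [this]
    exact Runs.loop_cnt_nil.mono (by simp)
  | succ n ih =>
    intro x h1 h2 h3
    have : flagOf (toD x) = [true] := by
      match toD x, h2 0 (by omega) with
      | .nil, h => exact absurd rfl h
      | .cons .nil _, h => exact absurd rfl h
      | .cons (.cons _ _) _, _ => rfl
    rw [this]
    have h4 := ih (f x) (fun k hk => h1 (k + 1) (by omega)) (fun k hk => h2 (k + 1) (by omega)) h3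
    refine (Runs.loop_cnt ((hP x).seq (runs_flag _)) h4).mono ?_
    have h5 := polynomial_eval_mono q (h1 0 (by omega))
    have h6 := h1 1 (by omega)
    simp only [Function.iterate_zero, id_eq, Function.iterate_one] at h5 h6
    rw [Nat.add_mul, Nat.one_mul]
    simp only [sz] at *
    omega

/-- Iteration of a polynomial-time function until the first component is empty. -/
lemma whileNil {f : β → β} {g init : α → β} (hf : Poly f) (hi : Poly init) (p : ℕ[X])
    (h : ∀ x, ∃ n ≤ p.eval (sz x), (∀ k ≤ n, sz (f^[k] (init x)) ≤ p.eval (sz x)) ∧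
      (∀ k < n, (toD (f^[k] (init x))).hd ≠ .nil) ∧ (toD (f^[n] (init x))).hd = .nil ∧
      g x = f^[n] (init x)) : Poly g := by
  obtain ⟨q, hq, hQ⟩ := hf
  obtain ⟨s, hs, hS⟩ := hi
  refine ⟨s + 23 + 27 * p + p * (q.comp p + 26 * p + 23), fun x => ?_, fun A B => ?_⟩
  · obtain ⟨n, hn, h1, h2, h3, h4⟩ := h x
    rw [h4]
    have := h1 n le_rfl
    simp
    omega
  · obtain ⟨Q, hQ⟩ := hQ A B
    obtain ⟨S, hS⟩ := hS A B
    refine ⟨.seq S (Prog.whileNil Q), fun x i o r => ?_⟩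
    obtain ⟨n, hn, h1, h2, h3, h4⟩ := h x
    rw [h4]
    refine ((hS x i o r).seq ((runs_flag _).seq
      (runs_whileLoop (fun y => hQ y i o r) n _ h1 h2 h3))).mono ?_
    have := Nat.mul_le_mul_right (q.eval (p.eval (sz x)) + 26 * p.eval (sz x) + 23) hn
    have := h1 0 (Nat.zero_le _)
    rw [Function.iterate_zero, id_eq] at this
    simp [eval_comp]
    simp only [sz] at *
    omega

lemma data_const : ∀ c : Data, Poly fun _ : Data => c
  | .nil => data_nil
  | .cons a b => ((data_const a).prodMk (data_const b)).of_data fun _ => rfl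

@[fun_prop]
lemma const (c : β) : Poly fun _ : α => c := (data_const (toD c)).of_data fun _ => rfl

end Poly

/-! ### Input and output -/

/-- A list of trees as a tree. -/
def Data.ofList : List Data → Data
  | [] => .nil
  | a :: l => .cons a (ofList l)

/-- Unary numbers as trees. -/
def Data.unary : ℕ → Data
  | 0 => .nil
  | n + 1 => .cons .nil (unary n)

namespace Prog

variable {A B : Type}

/-- Push the symbols of a word one by one to `tmp`. -/
def pushTmp : List Bool → Prog A B
  | [] => .skip
  | a :: l => .seq (.push .tmp a) (pushTmp l)

/-- Read the input. -/
def read (e : A → Data) : Prog A B :=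
  .seq (.loop .inp fun a => .seq (.push .tmp true) (pushTmp (e a).code))
    (.seq (.push .tmp false) tmpToMain)

/-- Raise a flag if the top value is a nonempty list. -/
def uncons : Prog A B := .pop .main fun
  | some true => .push .cnt true
  | _ => .skip

/-- Move the symbol with a given number to the output stack. -/
def writeSym : List B → Prog A B
  | [] => .skip
  | b :: l => .pop .main fun
    | some true => .pop .main fun _ => writeSym l
    | _ => .push .out b

/-- Write the output, in reverse order. -/
def write (l : List B) : Prog A B :=
  .seq uncons (.loop .cnt fun _ => .seq (writeSym l) uncons)

end Prog

section

open Prog Data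

variable {A B : Type} {i : List A} {o : List B} {m t u c r : List Bool}

lemma runs_pushTmp (l : List Bool) :
    Runs (pushTmp l) (st i o m t u c) (l.length + 1) (st i o m (l.reverse ++ t) u c) := by
  induction l generalizing t with
  | nil => exact Runs.skip
  | cons a l ih => exact ((Runs.push_tmp a).seq ih).conv (by simp; omega) (by simp)

/-- A list is coded as the codes of its entries, each preceded by an inner-node symbol, with a leaf
at the end. Here `w` is the part without the final leaf; it is produced in input order on `tmp`,
hence reversed, and the later move to `main` restores the order. -/
lemma runs_readLoop (e : A → Data) {N : ℕ} (hN : ∀ a, (e a).size ≤ N) (l : List A) :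
    ∃ w : List Bool, (ofList (l.map e)).code = w ++ [false] ∧ w.length ≤ (N + 1) * l.length ∧
      Runs (.loop .inp fun a => .seq (.push .tmp true) (pushTmp (e a).code))
        (st l o m t u c) ((N + 3) * l.length + 1) (st [] o m (w.reverse ++ t) u c) := by
  induction l generalizing t with
  | nil => exact ⟨[], rfl, by simp, Runs.loop_inp_nil⟩
  | cons a l ih =>
    obtain ⟨w, h1, h2, h3⟩ := ih (t := (e a).code.reverse ++ true :: t)
    have h4 := hN a
    refine ⟨true :: (e a).code ++ w, by simp [ofList, code, h1], ?_, ?_⟩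
    · simp [Nat.mul_add]
      lia
    · exact (Runs.loop_inp ((Runs.push_tmp true).seq (runs_pushTmp _)) h3).conv
        (by simp [Nat.mul_add]; omega) (by simp)

lemma runs_read (e : A → Data) {N : ℕ} (hN : ∀ a, (e a).size ≤ N) (l : List A) :
    Runs (read e) (st l o [] [] [] []) (3 * (N + 3) * l.length + 5)
      (st [] o (ofList (l.map e)).code [] [] []) := by
  obtain ⟨w, h1, h2, h3⟩ := runs_readLoop (o := o) (m := []) (t := []) (u := []) (c := []) e hN l
  apply Runs.conv
  · exact h3.seq ((Runs.push_tmp false).seq runs_tmpToMain)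
  · simp only [List.append_nil, List.length_cons, List.length_reverse]
    nlinarith
  · simp [h1]

lemma size_ofList_le (e : A → Data) {N : ℕ} (hN : ∀ a, (e a).size ≤ N) (l : List A) :
    (ofList (l.map e)).size ≤ (N + 1) * l.length + 1 := by
  induction l with
  | nil => simp [ofList, size]
  | cons a l ih =>
    have := hN a
    simp [ofList, size, Nat.mul_add]
    omega

lemma runs_writeSym (l : List B) (k : ℕ) (b : B) (h : l[k]? = some b) :
    Runs (writeSym l) (st i o ((unary k).code ++ r) t u c) (2 * l.length)
      (st i (b :: o) r t u c) := by
  induction l generalizing k with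
  | nil => simp at h
  | cons a l ih =>
    cases k with
    | zero =>
      obtain rfl : a = b := by simpa using h
      exact (Runs.pop_main (Runs.push_out a)).mono (by simp)
    | succ k =>
      exact (Runs.pop_main (Runs.pop_main (ih k (by simpa using h)))).mono (by simp; omega)

lemma runs_uncons_false :
    Runs (A := A) (B := B) uncons (st i o (false :: m) t u c) 2 (st i o m t u c) := by
  unfold uncons
  exact (Runs.pop_main Runs.skip).mono le_rfl

lemma runs_uncons_true :
    Runs (A := A) (B := B) uncons (st i o (true :: m) t u c) 2 (st i o m t u (true :: c)) := by
  unfold uncons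
  exact (Runs.pop_main (Runs.push_cnt true)).mono le_rfl

/-- Pushing the symbols one after the other reverses the word, so the program has to be run on a
reversed list. In `key` the first execution of `uncons` is split off, because in the loop it comes
at the end of the body. -/
lemma runs_write (bs : List B) (e : B → ℕ) (he : ∀ b, bs[e b]? = some b) (l : List B) :
    Runs (write bs) (st i o (ofList (l.map fun b => unary (e b))).code [] [] [])
      ((2 * bs.length + 4) * l.length + 5) (st i (l.reverse ++ o) [] [] [] []) := by
  have key : ∀ l : List B, ∀ o, ∃ m c, Runs uncons
      (st i o (ofList (l.map fun b => unary (e b))).code [] [] []) 2 (st i o m [] [] c) ∧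
      Runs (.loop .cnt fun _ => .seq (writeSym bs) uncons) (st i o m [] [] c)
        ((2 * bs.length + 4) * l.length + 1) (st i (l.reverse ++ o) [] [] [] []) := by
    intro l
    induction l with
    | nil =>
      intro o
      exact ⟨[], [], runs_uncons_false, Runs.loop_cnt_nil.mono (by simp)⟩
    | cons b l ih =>
      intro o
      obtain ⟨m, c, h1, h2⟩ := ih (b :: o)
      refine ⟨_, [true], runs_uncons_true, ?_⟩
      exact (Runs.loop_cnt ((runs_writeSym bs (e b) b (he b)).seq h1) h2).conv
        (by simp [Nat.mul_add]; omega) (by simp)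
  obtain ⟨m, c, h1, h2⟩ := key l o
  exact (h1.seq h2).mono (by omega)

end

end PolyTM

/-! ### List operations in polynomial time, all derived from bounded folds. -/

namespace PolyTM

open Polynomial Enc

variable {α β γ σ : Type} [Enc α] [Enc β] [Enc γ] [Enc σ]

/-! ### Lists -/

lemma Data.ofList_injective : Function.Injective Data.ofList
  | [], [], _ => rfl
  | a :: l, b :: l', h => by
    rw [Data.ofList, Data.ofList, Data.cons.injEq] at h
    rw [h.1, ofList_injective h.2]

instance : Enc (List α) :=
  ⟨fun l => .ofList (l.map toD), fun _ _ h => List.map_injective_iff.2 inj (Data.ofList_injective h)⟩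

@[simp] lemma toD_nil : toD ([] : List α) = .nil := rfl
@[simp] lemma toD_cons (a : α) (l : List α) : toD (a :: l) = .cons (toD a) (toD l) := rfl
@[simp] lemma sz_nil : sz ([] : List α) = 1 := rfl
@[simp] lemma sz_cons (a : α) (l : List α) : sz (a :: l) = 1 + sz a + sz l := rfl
lemma sz_append (l l' : List α) : sz (l ++ l') + 1 = sz l + sz l' := by
  induction l with
  | nil => simp; omega
  | cons a l ih => simp only [List.cons_append, sz_cons]; omega
lemma length_lt_sz (l : List α) : l.length < sz l := by
  induction l with
  | nil => simp
  | cons a l ih => simp; omega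
lemma sz_le_of_mem {a : α} {l : List α} (h : a ∈ l) : sz a < sz l := by
  induction l with
  | nil => simp at h
  | cons b l ih =>
    rcases List.mem_cons.1 h with rfl | h
    · simp; have := sz_pos l; omega
    · have := ih h; simp; omega
@[simp] lemma sz_reverse (l : List α) : sz l.reverse = sz l := by
  induction l with
  | nil => simp
  | cons a l ih =>
    have := sz_append l.reverse [a]
    simp only [sz_cons, sz_nil, List.reverse_cons] at this ⊢
    omega
lemma sz_drop_le (l : List α) (k : ℕ) : sz (l.drop k) ≤ sz l := by
  induction l generalizing k with
  | nil => simp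
  | cons a l ih =>
    cases k with
    | zero => simp
    | succ k => have := ih k; simp; omega

namespace Poly

lemma exists_bound {f : α → β} (hf : Poly f) : ∃ q : ℕ[X], ∀ x, sz (f x) ≤ q.eval (sz x) :=
  let ⟨q, hq, _⟩ := hf; ⟨q, hq⟩

@[fun_prop]
lemma fst {f : α → β × γ} (hf : Poly f) : Poly fun x => (f x).1 :=
  (data_hd.of_data (f := Prod.fst) fun _ => rfl).comp hf

@[fun_prop]
lemma snd {f : α → β × γ} (hf : Poly f) : Poly fun x => (f x).2 :=
  (data_tl.of_data (f := Prod.snd) fun _ => rfl).comp hf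

-- Since representations are injective, equality of elements is equality of trees, for which there
-- is a stack program.
@[fun_prop]
lemma decide_eq [DecidableEq β] {f g : α → β} (hf : Poly f) (hg : Poly g) :
    Poly fun x => decide (f x = g x) := by
  have : Poly fun p : β × β => decide (p.1 = p.2) := data_eqTest.of_data fun p => by
    by_cases h : p.1 = p.2 <;> simp [Data.eqTest, h, inj.eq_iff]
  exact this.comp (hf.prodMk hg)

@[fun_prop]
lemma not {f : α → Bool} (hf : Poly f) : Poly fun x => !f x := by
  have : Poly fun x => _root_.cond (f x) false true := by fun_prop
  convert this using 2 with x
  cases f x <;> rfl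

@[fun_prop]
lemma and {f g : α → Bool} (hf : Poly f) (hg : Poly g) : Poly fun x => f x && g x := by
  have : Poly fun x => _root_.cond (f x) (g x) false := by fun_prop
  convert this using 2 with x
  cases f x <;> rfl

@[fun_prop]
lemma or {f g : α → Bool} (hf : Poly f) (hg : Poly g) : Poly fun x => f x || g x := by
  have : Poly fun x => _root_.cond (f x) true (g x) := by fun_prop
  convert this using 2 with x
  cases f x <;> rfl

@[fun_prop]
lemma xor {f g : α → Bool} (hf : Poly f) (hg : Poly g) : Poly fun x => f x ^^ g x := by
  have : Poly fun x => _root_.cond (f x) (!g x) (g x) := by fun_prop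
  convert this using 2 with x
  cases f x <;> simp

@[fun_prop]
lemma cons {f : α → β} {g : α → List β} (hf : Poly f) (hg : Poly g) :
    Poly fun x => f x :: g x :=
  ((id' (α := Data)).of_data (f := fun p : β × List β => p.1 :: p.2) fun _ => rfl).comp (hf.prodMk hg)

@[fun_prop]
lemma tail {f : α → List β} (hf : Poly f) : Poly fun x => (f x).tail :=
  (data_tl.of_data (f := List.tail (α := β)) fun l => by cases l <;> rfl).comp hf

@[fun_prop]
lemma isEmpty {f : α → List β} (hf : Poly f) : Poly fun x => (f x).isEmpty := by
  have : Poly fun x : Data => _root_.cond (decide (x = Data.nil)) Data.tru Data.nil := by fun_prop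
  exact (this.of_data (f := List.isEmpty (α := β)) fun l => by cases l <;> simp).comp hf

@[fun_prop]
lemma headD {f : α → List β} {g : α → β} (hf : Poly f) (hg : Poly g) :
    Poly fun x => (f x).headD (g x) := by
  have h1 : Poly fun x : Data => _root_.cond (decide (x.hd = Data.nil)) x.tl x.hd.hd := by
    have := data_hd
    have := data_tl
    fun_prop
  exact (h1.of_data (f := fun p : List β × β => p.1.headD p.2) fun p => by
    rcases p with ⟨l | ⟨b, l⟩, a⟩ <;> simp [Data.hd, Data.tl]).comp (hf.prodMk hg)

/-- Folds whose intermediate results have polynomial size. -/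
lemma foldl_of_bound [Inhabited α] {l : σ → List α} {init : σ → β} {f : σ → β → α → β}
    (hl : Poly l) (hi : Poly init) (hf : Poly fun p : σ × β × α => f p.1 p.2.1 p.2.2)
    (p : ℕ[X]) (hp : ∀ s, ∀ k ≤ (l s).length,
      sz (((l s).take k).foldl (f s) (init s)) ≤ p.eval (sz s)) :
    Poly fun s => (l s).foldl (f s) (init s) := by
  obtain ⟨q, hq⟩ := hl.exists_bound
  -- The fold becomes an iteration on triples (unread list, parameters, accumulator). The unread
  -- list comes first because the iteration ends when the first component is empty; the default
  -- entry is never used before that.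
  let step : List α × σ × β → List α × σ × β := fun x =>
    (x.1.tail, x.2.1, f x.2.1 x.2.2 (x.1.headD default))
  have hstep : Poly step := by
    have : Poly fun x : List α × σ × β => f x.2.1 x.2.2 (x.1.headD default) :=
      hf.comp (f := fun p : σ × β × α => f p.1 p.2.1 p.2.2)
        (g := fun x : List α × σ × β => (x.2.1, x.2.2, x.1.headD default)) (by fun_prop)
    fun_prop
  have key : ∀ s (l : List α) b, ∀ k ≤ l.length, step^[k] (l, s, b) =
      (l.drop k, s, (l.take k).foldl (f s) b) := by
    intro s l
    induction l with
    | nil => intro b k hk; simp at hk; subst hk; rfl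
    | cons a l ih =>
      intro b k hk
      cases k with
      | zero => rfl
      | succ k =>
        rw [Function.iterate_succ_apply]
        exact ih (f s b a) k (by simpa using hk)
  have hw : Poly fun s => (([] : List α), s, (l s).foldl (f s) (init s)) := by
    refine whileNil hstep (init := fun s => (l s, s, init s)) (by fun_prop) (q + X + p + 2)
      fun s => ⟨(l s).length, ?_, fun k hk => ?_, fun k hk => ?_, ?_, ?_⟩
    · have := hq s
      have := length_lt_sz (l s)
      simp
      omega
    · rw [key _ _ _ _ hk]
      have := hq s
      have := hp s k hk
      have := sz_drop_le (l s) k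
      simp [sz_prod]
      omega
    · rw [key _ _ _ _ hk.le]
      simp only [toD_prod, Data.hd]
      rw [List.drop_eq_getElem_cons hk, toD_cons]
      simp
    · rw [key _ _ _ _ le_rfl]
      simp [Data.hd]
    · rw [key _ _ _ _ le_rfl]
      simp
  exact hw.snd.snd

/-- Folds each step of which increases a measure of the size by a polynomial in the size of the
data. -/
lemma foldl_of_measure [Inhabited α] {l : σ → List α} {init : σ → β} {f : σ → β → α → β}
    (μ : β → ℕ) (c d : ℕ[X]) (hc : ∀ b, sz b ≤ c.eval (μ b)) (hd : ∀ b, μ b ≤ d.eval (sz b))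
    (hl : Poly l) (hi : Poly init) (hf : Poly fun p : σ × β × α => f p.1 p.2.1 p.2.2)
    (q : ℕ[X]) (hq : ∀ s b a, μ (f s b a) ≤ μ b + q.eval (sz s + sz a)) :
    Poly fun s => (l s).foldl (f s) (init s) := by
  obtain ⟨pl, hpl⟩ := hl.exists_bound
  obtain ⟨pi, hpi⟩ := hi.exists_bound
  refine foldl_of_bound hl hi hf (c.comp (d.comp pi + pl * q.comp (X + pl))) fun s k hk => ?_
  -- Increments add up: after `l'.length` steps the measure has grown by that many copies of one
  -- bound, which is uniform because every entry is smaller than the whole list. The polynomials `d`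
  -- and `c` translate from size to measure and back.
  have key : ∀ l' : List α, (∀ a ∈ l', sz a ≤ sz (l s)) → ∀ b,
      μ (l'.foldl (f s) b) ≤ μ b + l'.length * q.eval (sz s + sz (l s)) := by
    intro l'
    induction l' with
    | nil => simp
    | cons a l' ih =>
      intro h b
      have h1 := ih (fun a ha => h a (List.mem_cons_of_mem _ ha)) (f s b a)
      have h2 := hq s b a
      have h3 := polynomial_eval_mono q (Nat.add_le_add_left (h a List.mem_cons_self) (sz s))
      simp only [List.foldl_cons, List.length_cons, Nat.add_mul]
      omega
  have h1 := key ((l s).take k) (fun a ha => (sz_le_of_mem (List.mem_of_mem_take ha)).le) (init s)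
  refine (hc _).trans ?_
  rw [eval_comp]
  refine polynomial_eval_mono c (h1.trans ?_)
  simp only [eval_add, eval_mul, eval_comp, eval_X]
  refine Nat.add_le_add ((hd _).trans (polynomial_eval_mono d (hpi s))) (Nat.mul_le_mul ?_ ?_)
  · rw [List.length_take]
    have := length_lt_sz (l s)
    have := hpl s
    omega
  · exact polynomial_eval_mono q (Nat.add_le_add_left (hpl s) _)

/-- Folds each step of which increases the size by a polynomial in the size of the data. -/
lemma foldl [Inhabited α] {l : σ → List α} {init : σ → β} {f : σ → β → α → β}
    (hl : Poly l) (hi : Poly init) (hf : Poly fun p : σ × β × α => f p.1 p.2.1 p.2.2)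
    (q : ℕ[X]) (hq : ∀ s b a, sz (f s b a) ≤ sz b + q.eval (sz s + sz a)) :
    Poly fun s => (l s).foldl (f s) (init s) :=
  foldl_of_measure sz X X (by simp) (by simp) hl hi hf q hq

@[fun_prop]
lemma reverse [Inhabited β] {f : α → List β} (hf : Poly f) : Poly fun x => (f x).reverse := by
  have : Poly fun x => (f x).foldl (fun b a => a :: b) [] := by
    refine foldl hf (by fun_prop) (by fun_prop) (X + 1) fun s b a => ?_
    simp
    omega
  simpa only [List.foldl_flip_cons_eq_append', List.append_nil] using this

@[fun_prop]
lemma append [Inhabited β] {f g : α → List β} (hf : Poly f) (hg : Poly g) :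
    Poly fun x => f x ++ g x := by
  have : Poly fun x => (f x).reverse.foldl (fun b a => a :: b) (g x) := by
    refine foldl (by fun_prop) hg (by fun_prop) (X + 1) fun s b a => ?_
    simp
    omega
  simpa only [List.foldl_flip_cons_eq_append', List.reverse_reverse] using this

@[fun_prop]
lemma map [Inhabited β] [Inhabited γ] {l : α → List β} {f : α → β → γ} (hl : Poly l)
    (hf : Poly fun p : α × β => f p.1 p.2) : Poly fun x => (l x).map (f x) := by
  obtain ⟨q, hq⟩ := hf.exists_bound
  have : Poly fun x => ((l x).foldl (fun b a => f x a :: b) []).reverse := by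
    refine reverse (foldl hl (by fun_prop) ?_ (q.comp (X + 1) + 1) fun s b a => ?_)
    · exact (hf.comp (g := fun p : α × List γ × β => (p.1, p.2.2)) (by fun_prop)).cons
        (by fun_prop)
    · have : sz (f s a) ≤ q.eval (1 + sz s + sz a) := hq (s, a)
      simp only [sz_cons, eval_add, eval_comp, eval_X, eval_one]
      rw [show sz s + sz a + 1 = 1 + sz s + sz a by ring]
      omega
  convert this using 2 with x
  have key : ∀ l : List β, ∀ b, l.foldl (fun b a => f x a :: b) b = (l.map (f x)).reverse ++ b := by
    intro l
    induction l with
    | nil => simp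
    | cons a l ih => simp [ih]
  simp [key]

@[fun_prop]
lemma flatten [Inhabited β] {f : α → List (List β)} (hf : Poly f) :
    Poly fun x => (f x).flatten := by
  have : Poly fun x => (f x).foldl (fun b a => b ++ a) [] := by
    refine foldl hf (by fun_prop) (by fun_prop) X fun s b a => ?_
    have := sz_append b a
    simp
    omega
  convert this using 2 with x
  have key : ∀ l : List (List β), ∀ b, l.foldl (fun b a => b ++ a) b = b ++ l.flatten := by
    intro l
    induction l with
    | nil => simp
    | cons a l ih => simp [ih]
  simp [key]

@[fun_prop]
lemma flatMap [Inhabited β] [Inhabited γ] {l : α → List β} {f : α → β → List γ} (hl : Poly l)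
    (hf : Poly fun p : α × β => f p.1 p.2) : Poly fun x => (l x).flatMap (f x) := by
  simp only [List.flatMap_def]
  fun_prop

@[fun_prop]
lemma filter [Inhabited β] {l : α → List β} {f : α → β → Bool} (hl : Poly l)
    (hf : Poly fun p : α × β => f p.1 p.2) : Poly fun x => (l x).filter (f x) := by
  have : Poly fun x => (l x).flatMap fun a => _root_.cond (f x a) [a] [] := by fun_prop
  convert this using 2 with x
  generalize l x = l
  induction l with
  | nil => rfl
  | cons a l ih => cases h : f x a <;> simp [h, ih]

@[fun_prop]
lemma all [Inhabited β] {l : α → List β} {f : α → β → Bool} (hl : Poly l)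
    (hf : Poly fun p : α × β => f p.1 p.2) : Poly fun x => (l x).all (f x) := by
  have : Poly fun x => ((l x).filter fun a => !f x a).isEmpty := by fun_prop
  convert this using 2 with x
  generalize l x = l
  induction l with
  | nil => rfl
  | cons a l ih => cases h : f x a <;> simp [h, ih]

@[fun_prop]
lemma zip [Inhabited β] [Inhabited γ] {f : α → List β} {g : α → List γ} (hf : Poly f)
    (hg : Poly g) : Poly fun x => (f x).zip (g x) := by
  -- The accumulator carries the unread part of the second list; once that is empty, the remaining
  -- entries of the first list change nothing.
  have : Poly fun x => ((f x).foldl (fun (b : List γ × List (β × γ)) a => _root_.cond b.1.isEmpty b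
      (b.1.tail, (a, b.1.headD default) :: b.2)) (g x, [])).2.reverse := by
    have := foldl (l := f) (init := fun x => (g x, ([] : List (β × γ))))
      (f := fun _ b a => _root_.cond b.1.isEmpty b (b.1.tail, (a, b.1.headD default) :: b.2))
      hf (by fun_prop) (by fun_prop) (X + 1) ?_
    · fun_prop
    · rintro s ⟨_ | ⟨c, l⟩, b⟩ a
      · simp
      · simp [sz_prod]
        omega
  convert this using 2 with x
  have key : ∀ (l : List β) (m : List γ) b,
      (l.foldl (fun (b : List γ × List (β × γ)) a => _root_.cond b.1.isEmpty b
      (b.1.tail, (a, b.1.headD default) :: b.2)) (m, b)).2 = (l.zip m).reverse ++ b := by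
    intro l
    induction l with
    | nil => simp
    | cons a l ih =>
      intro m b
      cases m with
      | nil =>
        have h2 := ih [] b
        simp at h2 ⊢
        exact h2
      | cons c m => simp [ih, -List.headD_eq_head?_getD, List.headD_cons]
  simp [key, -List.headD_eq_head?_getD]

/-- Functions on finite types. -/
lemma of_finite [Finite α] [Nonempty α] (f : α → β) : Poly f := by
  classical
  have key : ∀ l : List α, ∃ g : α → β, Poly g ∧ ∀ a ∈ l, g a = f a := by
    intro l
    induction l with
    | nil => exact ⟨fun _ => f (Classical.arbitrary α), by fun_prop, by simp⟩
    | cons a l ih =>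
      obtain ⟨g, hg, h⟩ := ih
      refine ⟨fun x => _root_.cond (decide (x = a)) (f a) (g x), by fun_prop, fun b hb => ?_⟩
      by_cases hba : b = a
      · simp [hba]
      · simpa [hba] using h b ((List.mem_cons.1 hb).resolve_left hba)
  cases nonempty_fintype α
  obtain ⟨g, hg, h⟩ := key Finset.univ.toList
  rwa [show f = g from funext fun a => (h a (by simp)).symm]

end Poly

end PolyTM

/-! ### Arithmetic of natural numbers given by their binary digits. -/

namespace PolyTM

open Polynomial Enc

variable {α β γ σ : Type} [Enc α] [Enc β] [Enc γ] [Enc σ]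

/-! ### Binary numbers -/

/-- The number with given binary digits, the least significant one first. -/
def ofBits : List Bool → ℕ
  | [] => 0
  | b :: l => Nat.bit b (ofBits l)

@[simp] lemma ofBits_bits (n : ℕ) : ofBits n.bits = n := by
  induction n using Nat.binaryRec' with
  | zero => simp [ofBits]
  | bit b n h ih => rw [Nat.bits_append_bit n b h, ofBits, ih]

lemma bits_injective : Function.Injective Nat.bits :=
  Function.LeftInverse.injective ofBits_bits

lemma ofBits_append (l l' : List Bool) :
    ofBits (l ++ l') = ofBits l + 2 ^ l.length * ofBits l' := by
  induction l with
  | nil => simp [ofBits]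
  | cons a l ih =>
    simp only [List.cons_append, ofBits, ih, Nat.bit_val, List.length_cons, pow_succ]
    ring

lemma ofBits_lt (l : List Bool) : ofBits l < 2 ^ l.length := by
  induction l with
  | nil => simp [ofBits]
  | cons a l ih =>
    simp only [ofBits, Nat.bit_val, List.length_cons, pow_succ]
    have := a.toNat_le
    omega

instance : Enc ℕ := ⟨fun n => toD n.bits, fun _ _ h => bits_injective (inj h)⟩

lemma toD_nat (n : ℕ) : toD n = toD n.bits := rfl

lemma sz_bits_le (l : List Bool) : sz l ≤ 4 * l.length + 1 := by
  induction l with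
  | nil => simp
  | cons a l ih =>
    have : sz a ≤ 3 := by cases a <;> simp [sz, Data.size, Data.tru]
    simp
    omega

lemma sz_nat_le (n : ℕ) : sz n ≤ 4 * n.size + 1 := by
  rw [← Nat.size_eq_bits_len]
  exact sz_bits_le n.bits

lemma size_lt_sz (n : ℕ) : n.size < sz n := by
  rw [← Nat.size_eq_bits_len]
  exact length_lt_sz n.bits

lemma size_add_le (a b : ℕ) : (a + b).size ≤ a.size + b.size + 1 := by
  rw [Nat.size_le]
  have h1 := Nat.lt_size_self a
  have h2 := Nat.lt_size_self b
  have h3 : 2 ^ a.size ≤ 2 ^ (a.size + b.size) := Nat.pow_le_pow_right (by simp) (by simp)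
  have h4 : 2 ^ b.size ≤ 2 ^ (a.size + b.size) := Nat.pow_le_pow_right (by simp) (by simp)
  rw [pow_succ]
  omega

lemma size_mul_le (a b : ℕ) : (a * b).size ≤ a.size + b.size := by
  rw [Nat.size_le, pow_add]
  exact Nat.mul_lt_mul'' (Nat.lt_size_self a) (Nat.lt_size_self b)

namespace Poly

@[fun_prop]
lemma bits {f : α → ℕ} (hf : Poly f) : Poly fun x => (f x).bits :=
  (id'.of_data (F := fun x => x) (f := Nat.bits) fun _ => rfl).comp hf

-- Numbers are represented without leading zeros. Prepending a digit is thus a mere cons of lists,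
-- except that a zero digit before the number zero must again give the empty list.
@[fun_prop]
lemma bit {f : α → Bool} {g : α → ℕ} (hf : Poly f) (hg : Poly g) :
    Poly fun x => Nat.bit (f x) (g x) := by
  have h1 : Poly fun p : Data × Data =>
      _root_.cond (decide (p.1 = .nil) && decide (p.2 = .nil)) Data.nil (Data.cons p.1 p.2) := by
    have : Poly fun p : Data × Data => Data.cons p.1 p.2 := id'.of_data (F := fun x => x) fun _ => rfl
    fun_prop
  have h2 : Poly fun x : Data =>
      _root_.cond (decide (x.hd = .nil) && decide (x.tl = .nil)) Data.nil (Data.cons x.hd x.tl) :=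
    h1.comp (data_hd.prodMk data_tl)
  refine (h2.of_data (f := fun p : Bool × ℕ => Nat.bit p.1 p.2) fun p => ?_).comp (hf.prodMk hg)
  obtain ⟨b, n⟩ := p
  simp only [toD_prod, Data.hd, Data.tl]
  by_cases h : n = 0 → b = true
  · rw [toD_nat, Nat.bits_append_bit n b h, toD_cons]
    by_cases hn : n = 0
    · simp [h hn, Data.tru]
      rfl
    · have : toD n ≠ .nil := fun h => hn (inj (α := ℕ) (h.trans (by rw [toD_nat]; simp)))
      simp [this]
      rfl
  · push Not at h
    obtain ⟨rfl, h⟩ := h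
    simp at h
    subst h
    simp [toD_nat]

@[fun_prop]
lemma bodd {f : α → ℕ} (hf : Poly f) : Poly fun x => (f x).bodd := by
  have : Poly fun x => (f x).bits.headD false := by fun_prop
  convert this using 2 with x
  rw [Nat.bodd_eq_bits_head]
  cases (f x).bits <;> rfl

@[fun_prop]
lemma div2 {f : α → ℕ} (hf : Poly f) : Poly fun x => (f x).div2 := by
  have : Poly fun x => (f x).bits.tail := by fun_prop
  have h : Poly fun n : ℕ => n.div2 :=
    (data_tl).of_data fun n => by
      rw [toD_nat, Nat.div2_bits_eq_tail, toD_nat]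
      cases n.bits <;> rfl
  exact h.comp hf

/-- The number with given binary digits, the most significant one first. -/
lemma foldl_bit (l : List Bool) (n : ℕ) :
    l.foldl (fun n b => Nat.bit b n) n = ofBits l.reverse + 2 ^ l.length * n := by
  induction l generalizing n with
  | nil => simp [ofBits]
  | cons a l ih =>
    rw [List.foldl_cons, ih]
    simp only [List.reverse_cons, ofBits_append, PolyTM.ofBits, Nat.bit_val, List.length_reverse, List.length_cons, pow_succ]
    ring

lemma foldl_nat [Inhabited α] {l : σ → List α} {init : σ → ℕ} {f : σ → ℕ → α → ℕ}
    (hl : Poly l) (hi : Poly init) (hf : Poly fun p : σ × ℕ × α => f p.1 p.2.1 p.2.2)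
    (q : ℕ[X]) (hq : ∀ s b a, (f s b a).size ≤ b.size + q.eval (sz s + sz a)) :
    Poly fun s => (l s).foldl (f s) (init s) :=
  foldl_of_measure Nat.size (4 * X + 1) X (fun b => by simpa using sz_nat_le b)
    (fun b => by simpa using (size_lt_sz b).le) hl hi hf q hq

lemma size_bit_le (b : Bool) (n : ℕ) : (Nat.bit b n).size ≤ n.size + 1 := by
  by_cases h : Nat.bit b n = 0
  · simp [h]
  · rw [Nat.size_bit h]

@[fun_prop]
lemma ofBits {f : α → List Bool} (hf : Poly f) : Poly fun x => ofBits (f x) := by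
  have : Poly fun x => (f x).reverse.foldl (fun n b => Nat.bit b n) 0 :=
    foldl_nat (by fun_prop) (by fun_prop) (by fun_prop) 1 fun s b a => by
      simpa using size_bit_le a b
  convert this using 2 with x
  rw [foldl_bit]
  simp

/-- One step of the addition of binary numbers. -/
def addStep (x : ℕ × ℕ × Bool × List Bool) : ℕ × ℕ × Bool × List Bool :=
  (x.1.div2, x.2.1.div2,
    (x.1.bodd && x.2.1.bodd) || (x.2.2.1 && (x.1.bodd ^^ x.2.1.bodd)),
    ((x.1.bodd ^^ x.2.1.bodd) ^^ x.2.2.1) :: x.2.2.2)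

/-- The invariant of schoolbook addition: digits already written plus the weighted sum of both
remainders and the carry. The hypothesis says that enough rounds are left, so that at the end
remainders and carry vanish. -/
lemma addStep_spec (l : List Bool) (x : ℕ × ℕ × Bool × List Bool)
    (h : x.1 + x.2.1 + x.2.2.1.toNat < 2 ^ l.length) :
    PolyTM.ofBits (l.foldl (fun x _ => addStep x) x).2.2.2.reverse =
      PolyTM.ofBits x.2.2.2.reverse + 2 ^ x.2.2.2.length * (x.1 + x.2.1 + x.2.2.1.toNat) := by
  induction l generalizing x with
  | nil =>
    obtain ⟨a, b, c, out⟩ := x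
    simp at h
    simp [h]
  | cons t l ih =>
    obtain ⟨a, b, c, out⟩ := x
    have ha := Nat.bodd_add_div2 a
    have hb := Nat.bodd_add_div2 b
    simp only [List.length_cons, pow_succ] at h
    rw [List.foldl_cons, ih]
    · simp only [addStep, List.reverse_cons, PolyTM.ofBits_append, PolyTM.ofBits,
        List.length_reverse, List.length_cons, pow_succ, Nat.bit_val]
      conv_rhs => rw [← ha, ← hb]
      cases a.bodd <;> cases b.bodd <;> cases c <;> simp <;> ring
    · simp only [addStep]
      revert ha hb
      cases a.bodd <;> cases b.bodd <;> cases c <;> simp at h ⊢ <;> omega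

@[fun_prop]
lemma add {f g : α → ℕ} (hf : Poly f) (hg : Poly g) : Poly fun x => f x + g x := by
  -- Only the length of this list matters: it is a number of rounds that suffices for all digits of
  -- the sum, including a final carry.
  have h1 : Poly fun x => (f x).bits ++ (g x).bits ++ [true] := by fun_prop
  have h2 : Poly addStep := by
    unfold addStep
    fun_prop
  have h3 : Poly fun x => ((f x).bits ++ (g x).bits ++ [true]).foldl (fun x _ => addStep x)
      (f x, g x, false, ([] : List Bool)) := by
    refine foldl_of_measure (fun y => y.1.size + y.2.1.size + y.2.2.2.length) (8 * X + 12) X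
      (fun b => ?_) (fun b => ?_) h1 (by fun_prop) (by fun_prop) 1 fun s b a => ?_
    · have h1 := sz_nat_le b.1
      have h2 := sz_nat_le b.2.1
      have h3 := sz_bits_le b.2.2.2
      have : sz b.2.2.1 ≤ 3 := by cases b.2.2.1 <;> simp [sz, Data.size, Data.tru]
      simp [sz_prod]
      omega
    · have h1 := size_lt_sz b.1
      have h2 := size_lt_sz b.2.1
      have h3 := length_lt_sz b.2.2.2
      simp [sz_prod]
      omega
    · have h1 : b.1.div2.size ≤ b.1.size :=
        Nat.size_le_size (by rw [Nat.div2_val]; exact Nat.div_le_self _ _)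
      have h2 : b.2.1.div2.size ≤ b.2.1.size :=
        Nat.size_le_size (by rw [Nat.div2_val]; exact Nat.div_le_self _ _)
      simp [addStep]
      omega
  have h4 : Poly fun x => PolyTM.ofBits (((f x).bits ++ (g x).bits ++ [true]).foldl
      (fun x _ => addStep x) (f x, g x, false, ([] : List Bool))).2.2.2.reverse := by fun_prop
  convert h4 using 2 with x
  rw [addStep_spec]
  · simp [PolyTM.ofBits]
  · have := Nat.lt_size_self (f x + g x)
    have h5 := Nat.pow_le_pow_right (n := 2) (by simp) (size_add_le (f x) (g x))
    simp only [List.length_append, Nat.size_eq_bits_len, List.length_singleton, Bool.toNat_false,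
      add_zero]
    omega

@[fun_prop]
lemma mul {f g : α → ℕ} (hf : Poly f) (hg : Poly g) : Poly fun x => f x * g x := by
  -- Horner's scheme from the most significant digit: double, and add `f x` if the digit is one.
  -- Each round adds only boundedly many digits relative to `f x`.
  have h1 : Poly fun x => (g x).bits.reverse.foldl
      (fun n b => Nat.bit false n + _root_.cond b (f x) 0) 0 := by
    obtain ⟨q, hq⟩ := hf.exists_bound
    have hf' : Poly fun p : α × ℕ × Bool => f p.1 := by fun_prop
    refine foldl_nat (by fun_prop) (by fun_prop) (by fun_prop) (q.comp X + 2) fun s b a => ?_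
    refine (size_add_le _ _).trans ?_
    have h1 := size_bit_le false b
    have h2 : (_root_.cond a (f s) 0).size ≤ q.eval (sz s + sz a) := by
      cases a
      · simp
      · exact ((size_lt_sz _).le.trans (hq s)).trans (polynomial_eval_mono q (by simp))
    simp only [eval_add, eval_comp, eval_X, eval_ofNat]
    omega
  convert h1 using 2 with x
  have key : ∀ (l : List Bool) n, l.foldl
      (fun n b => Nat.bit false n + _root_.cond b (f x) 0) n =
      2 ^ l.length * n + f x * PolyTM.ofBits l.reverse := by
    intro l
    induction l with
    | nil => simp [PolyTM.ofBits]
    | cons a l ih =>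
      intro n
      rw [List.foldl_cons, ih]
      simp only [Nat.bit_val, List.length_cons, List.reverse_cons,
        PolyTM.ofBits_append, PolyTM.ofBits, List.length_reverse, pow_succ]
      cases a <;> simp <;> ring
  rw [key]
  simp

/-- One step of the comparison of binary numbers. -/
def leStep (x : ℕ × ℕ × Bool) : ℕ × ℕ × Bool :=
  (x.1.div2, x.2.1.div2, _root_.cond (x.1.bodd ^^ x.2.1.bodd) x.2.1.bodd x.2.2)

/-- Digits are compared from the least significant one upwards and each difference overwrites the
verdict, so that the most significant difference decides; the initial verdict survives only if there
is none. -/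
lemma leStep_spec (l : List Bool) (x : ℕ × ℕ × Bool) (h : x.1 < 2 ^ l.length)
    (h' : x.2.1 < 2 ^ l.length) :
    ((l.foldl (fun x _ => leStep x) x).2.2 = true ↔
      x.1 < x.2.1 ∨ (x.1 = x.2.1 ∧ x.2.2 = true)) := by
  induction l generalizing x with
  | nil =>
    simp at h h'
    simp [h, h']
  | cons t l ih =>
    obtain ⟨a, b, c⟩ := x
    have ha := Nat.bodd_add_div2 a
    have hb := Nat.bodd_add_div2 b
    simp only [List.length_cons, pow_succ] at h h'
    rw [List.foldl_cons, ih]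
    · simp only [leStep]
      revert ha hb
      cases a.bodd <;> cases b.bodd <;> cases c <;> simp <;> omega
    · simp only [leStep]
      omega
    · simp only [leStep]
      omega

@[fun_prop]
lemma decide_le {f g : α → ℕ} (hf : Poly f) (hg : Poly g) :
    Poly fun x => decide (f x ≤ g x) := by
  have h1 : Poly fun x => (f x).bits ++ (g x).bits := by fun_prop
  have h2 : Poly leStep := by
    unfold leStep
    fun_prop
  have h3 : Poly fun x => ((f x).bits ++ (g x).bits).foldl (fun x _ => leStep x)
      (f x, g x, true) := by
    refine foldl_of_measure (fun y => y.1.size + y.2.1.size) (8 * X + 8) X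
      (fun b => ?_) (fun b => ?_) h1 (by fun_prop) (by fun_prop) 1 fun s b a => ?_
    · have h1 := sz_nat_le b.1
      have h2 := sz_nat_le b.2.1
      have : sz b.2.2 ≤ 3 := by cases b.2.2 <;> simp [sz, Data.size, Data.tru]
      simp [sz_prod]
      omega
    · have h1 := size_lt_sz b.1
      have h2 := size_lt_sz b.2.1
      simp [sz_prod]
      omega
    · have h1 : b.1.div2.size ≤ b.1.size :=
        Nat.size_le_size (by rw [Nat.div2_val]; exact Nat.div_le_self _ _)
      have h2 : b.2.1.div2.size ≤ b.2.1.size :=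
        Nat.size_le_size (by rw [Nat.div2_val]; exact Nat.div_le_self _ _)
      simp [leStep]
      omega
  convert h3.snd.snd using 2 with x
  rw [Bool.eq_iff_iff, leStep_spec]
  · simp
    omega
  · refine (Nat.lt_size_self _).trans_le (Nat.pow_le_pow_right (by simp) ?_)
    simp [Nat.size_eq_bits_len]
  · refine (Nat.lt_size_self _).trans_le (Nat.pow_le_pow_right (by simp) ?_)
    simp [Nat.size_eq_bits_len]

@[fun_prop]
lemma decide_lt {f g : α → ℕ} (hf : Poly f) (hg : Poly g) :
    Poly fun x => decide (f x < g x) := by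
  have : Poly fun x => decide (f x + 1 ≤ g x) := by fun_prop
  exact this

@[fun_prop]
lemma length [Inhabited β] {f : α → List β} (hf : Poly f) : Poly fun x => (f x).length := by
  have : Poly fun x => (f x).foldl (fun n _ => n + 1) 0 :=
    foldl_nat hf (by fun_prop) (by fun_prop) 2 fun s b a => by
      have := size_add_le b 1
      simp at this ⊢
      omega
  convert this using 2 with x
  have key : ∀ (l : List β) n, l.foldl (fun n _ => n + 1) n = n + l.length := by
    intro l
    induction l with
    | nil => simp
    | cons a l ih => intro n; simp [ih]; omega
  simp [key]

@[fun_prop]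
lemma sum {f : α → List ℕ} (hf : Poly f) : Poly fun x => (f x).sum := by
  have : Poly fun x => (f x).foldl (fun n a => n + a) 0 :=
    foldl_nat hf (by fun_prop) (by fun_prop) (X + 1) fun s b a => by
      have := size_add_le b a
      have := size_lt_sz a
      simp
      omega
  simpa only [List.sum_eq_foldl] using this

@[fun_prop]
lemma prod {f : α → List ℕ} (hf : Poly f) : Poly fun x => (f x).prod := by
  have : Poly fun x => (f x).foldl (fun n a => n * a) 1 :=
    foldl_nat hf (by fun_prop) (by fun_prop) X fun s b a => by
      have := size_mul_le b a
      have := size_lt_sz a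
      simp
      omega
  simpa only [List.prod_eq_foldl] using this

end Poly

end PolyTM

/-! ### Passage to Turing machines, and total decoding of certificates. -/

namespace PolyTM

open Polynomial Enc Computability

variable {α β γ σ : Type} [Enc α] [Enc β] [Enc γ] [Enc σ]

/-! ### From polynomial-time functions to Turing machines -/

-- The machine reads its word into a tree, computes the reversal of `G`, and writes the result
-- symbol by symbol; writing reverses once more. Output symbols are represented in unary because the
-- writing program identifies a symbol by counting its position in `bs`.
open Data in
theorem Poly.computable {α β A B : Type} [Fintype A] [Fintype B] [Enc A] [Enc B] [Inhabited B]
    {G : List A → List B} (hG : Poly G)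
    (encA : α → List A) (encB : β → List B) (f : α → β) (eB : B → ℕ)
    (bs : List B) (hbs : ∀ b, bs[eB b]? = some b) (heB : ∀ b, toD b = unary (eB b))
    (h : ∀ a, G (encA a) = encB (f a)) :
    Nonempty (Turing.TM2ComputableInPolyTime encA encB f) := by
  obtain ⟨q, hq, hQ⟩ := hG.reverse
  obtain ⟨Q, hQ⟩ := hQ A B
  obtain ⟨N, hN⟩ : ∃ N, ∀ a : A, (toD a).size ≤ N :=
    ⟨∑ a : A, (toD a).size, fun a =>
      Finset.single_le_sum (f := fun a : A => (toD a).size) (fun _ _ => Nat.zero_le _)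
        (Finset.mem_univ a)⟩
  let s : ℕ[X] := C (N + 1) * X + 1
  let T : ℕ[X] := C (3 * (N + 3)) * X + 5 + (q.comp s + (C (2 * bs.length + 4) * q.comp s + 5))
  refine Run.computable encA encB f (.seq (.read toD) (.seq Q (.write bs))) T fun a => ?_
  have hs : sz (encA a) ≤ _ := size_ofList_le toD hN (encA a)
  have h1 : (encB (f a)).length ≤ q.eval ((N + 1) * (encA a).length + 1) := by
    have h2 := (hq _).trans (polynomial_eval_mono q hs)
    beta_reduce at h2
    rw [h, sz_reverse] at h2
    exact (length_lt_sz _).le.trans h2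
  have h2 := hQ (encA a) [] [] []
  have h4 : toD (encB (f a)).reverse = ofList ((encB (f a)).reverse.map fun b => unary (eB b)) := by
    simp only [toD, ← heB]
  beta_reduce at h2
  rw [List.append_nil, List.append_nil, h, h4] at h2
  have h3 := runs_write (i := ([] : List A)) (o := []) bs eB hbs (encB (f a)).reverse
  rw [List.reverse_reverse, List.append_nil] at h3
  obtain ⟨t, ht, hr⟩ := (runs_read (o := ([] : List B)) toD hN (encA a)).seq (h2.seq h3)
  refine ⟨t, ht.trans ?_, hr⟩
  have h4 := polynomial_eval_mono q hs
  have h5 := Nat.mul_le_mul_left (2 * bs.length + 4) h1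
  simp only [T, s, eval_add, eval_mul, eval_C, eval_X, eval_comp, eval_one, eval_ofNat,
    List.length_reverse]
  omega

instance : Enc (α ⊕ β) :=
  ⟨fun x => x.elim (fun a => .cons .nil (toD a)) (fun b => .cons .tru (toD b)), by
    rintro (a | a) (b | b) h
    · simpa [inj.eq_iff] using h
    · simp [Data.tru] at h
    · simp [Data.tru] at h
    · simpa [inj.eq_iff] using h⟩

/-- The position of a symbol in the alphabet. -/
def symIndex : Γ' → ℕ
  | .blank => 0
  | .bit false => 1
  | .bit true => 2
  | .bra => 3
  | .ket => 4
  | .comma => 5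

lemma Data.unary_injective : Function.Injective Data.unary
  | 0, 0, _ => rfl
  | n + 1, m + 1, h => by
    simp only [unary, cons.injEq, true_and] at h
    rw [unary_injective h]

instance : Enc Γ' := ⟨fun a => .unary (symIndex a), by
  refine Data.unary_injective.comp fun a b h => ?_
  rcases a with _ | (_ | _) | _ | _ | _ <;> rcases b with _ | (_ | _) | _ | _ | _ <;>
    simp_all [symIndex]⟩

theorem Poly.computable_sym {α β A : Type} [Fintype A] [Enc A]
    {G : List A → List Γ'} (hG : Poly G)
    (encA : α → List A) (encB : β → List Γ') (f : α → β) (h : ∀ a, G (encA a) = encB (f a)) :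
    Nonempty (Turing.TM2ComputableInPolyTime encA encB f) :=
  hG.computable encA encB f symIndex [.blank, .bit false, .bit true, .bra, .ket, .comma]
    (by rintro (_ | (_ | _) | _ | _ | _) <;> rfl) (fun _ => rfl) h

theorem Poly.computable_bool {α A : Type} [Fintype A] [Enc A]
    {G : List A → Bool} (hG : Poly G)
    (encA : α → List A) (f : α → Bool) (h : ∀ a, G (encA a) = f a) :
    Nonempty (Turing.TM2ComputableInPolyTime encA encodeBool f) :=
  Poly.computable (G := fun l => [G l]) (by fun_prop) encA encodeBool f Bool.toNat [false, true]
    (by rintro (_ | _) <;> rfl) (by rintro (_ | _) <;> rfl) (by simp [h]; intro; rfl)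

/-! ### Decoding -/

/-- Types whose elements can be recovered from arbitrary trees by a total polynomial-time
function. -/
class Dec (α : Type) [Enc α] where
  ofD : Data → α
  ofD_toD : ∀ a, ofD (toD a) = a
  poly : Poly ofD

open Dec

instance : Dec Bool where
  ofD x := !decide (x = .nil)
  ofD_toD a := by cases a <;> simp [Data.tru]
  poly := by fun_prop

instance [Dec α] [Dec β] : Dec (α × β) where
  ofD x := (ofD x.hd, ofD x.tl)
  ofD_toD a := by simp [Data.hd, Data.tl, ofD_toD]
  poly := (poly.comp Poly.data_hd).prodMk (poly.comp Poly.data_tl)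

/-- The list of trees represented by a tree. -/
def Data.toList : Data → List Data
  | nil => []
  | cons a b => a :: toList b

lemma Data.toD_toList : ∀ x : Data, toD x.toList = x
  | nil => rfl
  | cons a b => by rw [toList, toD_cons, toD_toList b]; rfl

lemma Data.toList_toD (l : List α) : (toD l).toList = l.map toD := by
  induction l with
  | nil => rfl
  | cons a l ih => simp [toList, ih]

instance : Inhabited Data := ⟨.nil⟩

instance [Dec α] [Inhabited α] : Dec (List α) where
  ofD x := x.toList.map ofD
  ofD_toD l := by simp [Data.toList_toD, Function.comp_def, ofD_toD]
  poly := by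
    have h1 : Poly Data.toList := Poly.id'.of_data (F := fun x => x) Data.toD_toList
    have h2 : Poly fun p : Data × Data => (ofD p.2 : α) := poly.comp (by fun_prop)
    exact h1.map h2

instance : Dec ℕ where
  ofD x := ofBits (ofD x)
  ofD_toD n := by rw [toD_nat, ofD_toD, ofBits_bits]
  poly := poly.ofBits

/-- The trees whose codes make up a word. -/
def parse : List Bool → List Data
  | [] => []
  | false :: l => .nil :: parse l
  | true :: l => .cons ((parse l).headD .nil) ((parse l).tail.headD .nil) :: (parse l).tail.tail

/-- Read from the right, a prefix code is evaluated by a stack of trees: a leaf symbol pushes a leaf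
and an inner-node symbol joins the two top trees. Default leaves make this total on arbitrary words.
-/
lemma parse_code (x : Data) (l : List Bool) : parse (x.code ++ l) = x :: parse l := by
  induction x generalizing l with
  | nil => rfl
  | cons a b iha ihb => simp [Data.code, parse, iha, ihb]

lemma poly_parse : Poly parse := by
  have : Poly fun l : List Bool => l.reverse.foldl (fun (s : List Data) b =>
      cond b (.cons (s.headD .nil) (s.tail.headD .nil) :: s.tail.tail) (.nil :: s)) [] := by
    refine Poly.foldl (by fun_prop) (by fun_prop) ?_ 6 fun _ s b => ?_
    · have : Poly fun p : Data × Data => Data.cons p.1 p.2 :=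
        Poly.id'.of_data (F := fun x => x) fun _ => rfl
      have : Poly fun p : List Bool × List Data × Bool =>
          Data.cons (p.2.1.headD .nil) (p.2.1.tail.headD .nil) :=
        this.comp (g := fun p : List Bool × List Data × Bool =>
          (p.2.1.headD .nil, p.2.1.tail.headD .nil)) (by fun_prop)
      fun_prop
    · rcases s with _ | ⟨x, _ | ⟨y, s⟩⟩ <;> cases b <;>
        simp [sz_data, Data.size] <;> omega
  convert this using 2 with l
  rw [List.foldl_reverse]
  induction l with
  | nil => rfl
  | cons a l ih => cases a <;> simp only [parse, ih, List.foldr_cons] <;> rfl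

/-- The element represented by a word. -/
def decodeBits (α : Type) [Enc α] [Dec α] (w : List Bool) : α := ofD ((parse w).headD .nil)

/-- The word that represents an element. -/
def encodeBits (a : α) : List Bool := (toD a).code

lemma decodeBits_encodeBits [Dec α] (a : α) : decodeBits α (encodeBits a) = a := by
  have := parse_code (toD a) []
  rw [List.append_nil] at this
  rw [decodeBits, encodeBits, this, List.headD_cons, ofD_toD]

lemma length_encodeBits (a : α) : (encodeBits a).length = sz a := Data.length_code _

@[fun_prop]
lemma Poly.decodeBits [Dec β] {f : α → List Bool} (hf : Poly f) :
    Poly fun x => decodeBits β (f x) :=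
  poly.comp (((poly_parse.comp hf).headD (Poly.const _)))

end PolyTM

/-! ### Further list operations, and folds controlled by two measures. -/

namespace PolyTM

open Polynomial Enc

variable {α β γ σ : Type} [Enc α] [Enc β] [Enc γ] [Enc σ]

namespace Poly

@[fun_prop]
lemma any [Inhabited β] {l : α → List β} {f : α → β → Bool} (hl : Poly l)
    (hf : Poly fun p : α × β => f p.1 p.2) : Poly fun x => (l x).any (f x) := by
  have : Poly fun x => !(l x).all fun a => !f x a := by fun_prop
  convert this using 2 with x
  generalize l x = l
  induction l with
  | nil => rfl
  | cons a l ih => simp [ih]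

@[fun_prop]
lemma drop_length [Inhabited β] [Inhabited γ] {l : α → List β} {f : α → List γ} (hl : Poly l)
    (hf : Poly f) : Poly fun x => (f x).drop (l x).length := by
  have : Poly fun x => (l x).foldl (fun b _ => b.tail) (f x) :=
    foldl hl hf (by fun_prop) 0 fun s b a => by
      cases b <;> simp
  convert this using 2 with x
  generalize f x = b
  induction l x generalizing b with
  | nil => rfl
  | cons a l ih =>
    rw [List.foldl_cons, ← ih]
    simp

lemma sz_zipIdx_le (N : ℕ) (l : List β) : ∀ n, n + l.length ≤ N →
    sz (l.zipIdx n) ≤ sz l + l.length * (4 * N + 2) := by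
  induction l with
  | nil => simp
  | cons a l ih =>
    intro n hn
    rw [List.length_cons] at hn
    have h1 := ih (n + 1) (by omega)
    have h2 := sz_nat_le n
    have h3 : n.size ≤ n := Nat.size_le.2 n.lt_two_pow_self
    simp only [List.zipIdx_cons, sz_cons, sz_prod, List.length_cons, Nat.add_mul]
    omega

@[fun_prop]
lemma zipIdx [Inhabited β] {l : α → List β} (hl : Poly l) : Poly fun x => (l x).zipIdx := by
  obtain ⟨q, hq⟩ := hl.exists_bound
  have key : ∀ (l : List β) (n : ℕ) acc, l.foldl
      (fun (s : ℕ × List (β × ℕ)) a => (s.1 + 1, (a, s.1) :: s.2)) (n, acc) =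
      (n + l.length, (l.zipIdx n).reverse ++ acc) := by
    intro l
    induction l with
    | nil => simp
    | cons a l ih => intro n acc; simp [ih]; omega
  have : Poly fun x => (l x).foldl
      (fun (s : ℕ × List (β × ℕ)) a => (s.1 + 1, (a, s.1) :: s.2)) (0, []) := by
    refine foldl_of_bound hl (by fun_prop) (by fun_prop) (4 * q + 2 + q + q * (4 * q + 2))
      fun s k hk => ?_
    have h1 := sz_zipIdx_le k ((l s).take k) 0 (by simp)
    have h2 := sz_nat_le k
    have h3 : k.size ≤ k := Nat.size_le.2 k.lt_two_pow_self
    have h4 := hq s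
    have h5 := length_lt_sz (l s)
    have h6 : sz ((l s).take k) ≤ sz (l s) := by
      have := sz_append ((l s).take k) ((l s).drop k)
      rw [List.take_append_drop] at this
      have := sz_pos ((l s).drop k)
      omega
    rw [key]
    simp only [sz_prod, zero_add, List.append_nil, sz_reverse, List.length_take, eval_add, eval_mul,
      eval_ofNat, min_eq_left hk] at h1 ⊢
    have h7 := Nat.mul_le_mul (show k ≤ q.eval (sz s) by omega)
      (show 4 * k + 2 ≤ 4 * q.eval (sz s) + 2 by omega)
    omega
  have h2 : Poly fun x => ((l x).foldl
      (fun (s : ℕ × List (β × ℕ)) a => (s.1 + 1, (a, s.1) :: s.2)) (0, [])).2.reverse := by fun_prop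
  simpa only [key, List.append_nil, List.reverse_reverse] using h2

/-- Folds whose steps increase a first measure by at most one and a second one by a polynomial
times the first one. -/
lemma foldl_of_measures [Inhabited α] {l : σ → List α} {init : β} {f : σ → β → α → β}
    (μ ν : β → ℕ) (hμ : ∀ b, sz b ≤ μ b)
    (hl : Poly l) (hf : Poly fun p : σ × β × α => f p.1 p.2.1 p.2.2)
    (hν : ∀ s b a, ν (f s b a) ≤ ν b + 1)
    (q : ℕ[X]) (hq : ∀ s b a, μ (f s b a) ≤ μ b + (ν b + 1) * q.eval (sz s + sz a)) :
    Poly fun s => (l s).foldl (f s) init := by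
  obtain ⟨p, hp⟩ := hl.exists_bound
  refine foldl_of_bound hl (by fun_prop) hf
    (C (μ init) + p * ((C (ν init) + p + 1) * q.comp (X + p))) fun s k hk => ?_
  -- `N` bounds the second measure during the entire fold, since that measure grows by at most one
  -- per step; it makes the increments of the first measure uniform.
  have key : ∀ l' : List α, (∀ a ∈ l', sz a ≤ sz (l s)) → ∀ b N, ν b + l'.length ≤ N →
      μ (l'.foldl (f s) b) ≤ μ b + l'.length * ((N + 1) * q.eval (sz s + sz (l s))) := by
    intro l'
    induction l' with
    | nil => simp
    | cons a l' ih =>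
      intro h b N hN
      rw [List.length_cons] at hN
      have h1 := ih (fun a ha => h a (List.mem_cons_of_mem _ ha)) (f s b a) N
        (by have := hν s b a; omega)
      have h2 := hq s b a
      have h3 := Nat.mul_le_mul (show ν b + 1 ≤ N + 1 by omega)
        (polynomial_eval_mono q (Nat.add_le_add_left (h a List.mem_cons_self) (sz s)))
      rw [List.foldl_cons, List.length_cons, Nat.add_mul l'.length 1, Nat.one_mul]
      omega
  have h1 := key ((l s).take k) (fun a ha => (sz_le_of_mem (List.mem_of_mem_take ha)).le) init
    (ν init + k) (by simp)
  refine (hμ _).trans (h1.trans ?_)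
  have h2 := hp s
  have h3 := length_lt_sz (l s)
  simp only [eval_add, eval_mul, eval_comp, eval_X, eval_C, eval_one]
  refine Nat.add_le_add le_rfl (Nat.mul_le_mul ?_ (Nat.mul_le_mul ?_ ?_))
  · rw [List.length_take]
    omega
  · omega
  · exact polynomial_eval_mono q (Nat.add_le_add_left h2 _)

@[fun_prop]
lemma countTrue {f : α → List Bool} (hf : Poly f) : Poly fun x => (f x).count true := by
  have : Poly fun x => ((f x).filter fun b => b).length := by fun_prop
  convert this using 2 with x
  rw [List.count, List.countP_eq_length_filter]
  congr 2
  funext b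
  cases b <;> rfl

end Poly

end PolyTM

/-! ### The verifier as a polynomial-time function of word and certificate. -/

namespace DTRelevance

open PolyTM Computability Polynomial

/-! ### The verifier as a function on lists -/

lemma encodeNat_eq_bits (n : ℕ) : encodeNat n = n.bits := by
  have key : ∀ p : PosNum, encodePosNum p = (p : ℕ).bits := by
    intro p
    induction p with
    | one => simp [encodePosNum]
    | bit0 p ih =>
      rw [PosNum.cast_bit0, ← two_mul, encodePosNum, ih,
        Nat.bit0_bits _ (Nat.pos_iff_ne_zero.1 p.cast_pos)]
    | bit1 p ih =>
      rw [PosNum.cast_bit1, ← two_mul, encodePosNum, ih, Nat.bit1_bits]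
  rw [encodeNat]
  conv_rhs => rw [← Num.to_of_nat n]
  cases (n : Num) with
  | zero => simp [encodeNum]
  | pos p => simp [encodeNum, key]

lemma encNat_eq (n : ℕ) : encNat n = n.bits.map .bit ++ [.comma] := by
  rw [encNat, encodingNatΓ', ← encodeNat_eq_bits]
  rfl

@[fun_prop]
lemma poly_bit {α : Type} [Enc α] {f : α → Bool} (hf : Poly f) : Poly fun x => Γ'.bit (f x) :=
  (Poly.of_finite Γ'.bit).comp hf

@[fun_prop]
lemma poly_encNat {α : Type} [Enc α] {f : α → ℕ} (hf : Poly f) : Poly fun x => encNat (f x) := by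
  simp only [encNat_eq]
  fun_prop

/-- Tests along a root-to-leaf path: features and tables of literals. -/
abbrev Path : Type := List (ℕ × List Bool)

/-- The `n`-th entry of a table. -/
def getBit (t : List Bool) (n : ℕ) : Bool := t.zipIdx.any fun p => decide (p.2 = n) && p.1

/-- The tables of the tests of feature `i`. -/
def tablesAt (i : ℕ) (π : Path) : List (List Bool) :=
  (π.filter fun p => decide (p.1 = i)).map fun p => p.2

/-- The pointwise conjunction of two tables. -/
def andTable (t t' : List Bool) : List Bool := (t.zip t').map fun p => p.1 && p.2

/-- The pointwise conjunction of nonempty lists of tables. -/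
def meetTables (ts : List (List Bool)) : List Bool := ts.tail.foldl andTable (ts.headD [])

/-- A feature: size of the domain, value in the instance, whether it is fixed, index. -/
abbrev Feat : Type := (ℕ × ℕ × Bool) × ℕ

/-- The number of values of a feature that pass the tests of a path. -/
def featCount (π : Path) (f : Feat) : ℕ :=
  bif f.1.2.2 then bif (tablesAt f.2 π).all fun t => getBit t f.1.2.1 then 1 else 0
  else bif (tablesAt f.2 π).isEmpty then f.1.1 else (meetTables (tablesAt f.2 π)).count true

/-- The number of points that pass the tests of a path. -/
def pathCount (fs : List Feat) (π : Path) : ℕ := (fs.map (featCount π)).prod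

/-- The list of features. -/
def feats (ds vs : List ℕ) (S : List Bool) : List Feat := (ds.zip (vs.zip S)).zipIdx

/-- The number of pairs of a path and a point that passes its tests. -/
def totalCount (fs : List Feat) (ps : List (Path × ℕ)) : ℕ :=
  (ps.map fun p => pathCount fs p.1).sum

/-- All pairs of paths, concatenated. -/
def pairPaths (ps : List (Path × ℕ)) : List (Path × ℕ) :=
  ps.flatMap fun p => ps.map fun q => (p.1 ++ q.1, 0)

/-- The paths to leaves of class `c`. -/
def classPaths (c : ℕ) (ps : List (Path × ℕ)) : List (Path × ℕ) :=
  ps.filter fun p => decide (p.2 = c)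

section

variable {α : Type} [Enc α]

@[fun_prop]
lemma poly_getBit {t : α → List Bool} {n : α → ℕ} (ht : Poly t) (hn : Poly n) :
    Poly fun x => getBit (t x) (n x) := by
  unfold getBit
  fun_prop

@[fun_prop]
lemma poly_tablesAt {i : α → ℕ} {π : α → Path} (hi : Poly i) (hπ : Poly π) :
    Poly fun x => tablesAt (i x) (π x) := by
  unfold tablesAt
  fun_prop

@[fun_prop]
lemma poly_andTable {t t' : α → List Bool} (ht : Poly t) (ht' : Poly t') :
    Poly fun x => andTable (t x) (t' x) := by
  unfold andTable
  fun_prop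

lemma sz_andTable_le (t t' : List Bool) : sz (andTable t t') ≤ sz t := by
  induction t generalizing t' with
  | nil => simp [andTable]
  | cons a t ih =>
    cases t' with
    | nil => simp [andTable]; omega
    | cons b t' =>
      have h1 := ih t'
      have h2 : sz (a && b) ≤ sz a := by cases a <;> cases b <;> simp [sz, Data.size, Data.tru]
      simp only [andTable, List.zip_cons_cons, List.map_cons, sz_cons] at h1 ⊢
      omega

@[fun_prop]
lemma poly_meetTables {ts : α → List (List Bool)} (ht : Poly ts) :
    Poly fun x => meetTables (ts x) := by
  unfold meetTables
  exact Poly.foldl (f := fun _ => andTable) (by fun_prop) (by fun_prop) (by fun_prop) 0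
    fun s b a => (sz_andTable_le b a).trans (Nat.le_add_right _ _)

@[fun_prop]
lemma poly_featCount {π : α → Path} {f : α → Feat} (hπ : Poly π) (hf : Poly f) :
    Poly fun x => featCount (π x) (f x) := by
  unfold featCount
  fun_prop

@[fun_prop]
lemma poly_pathCount {fs : α → List Feat} {π : α → Path} (hf : Poly fs) (hπ : Poly π) :
    Poly fun x => pathCount (fs x) (π x) := by
  unfold pathCount
  fun_prop

@[fun_prop]
lemma poly_feats {ds vs : α → List ℕ} {S : α → List Bool} (hd : Poly ds) (hv : Poly vs)
    (hS : Poly S) : Poly fun x => feats (ds x) (vs x) (S x) := by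
  unfold feats
  fun_prop

@[fun_prop]
lemma poly_totalCount {fs : α → List Feat} {ps : α → List (Path × ℕ)} (hf : Poly fs)
    (hp : Poly ps) : Poly fun x => totalCount (fs x) (ps x) := by
  unfold totalCount
  fun_prop

@[fun_prop]
lemma poly_pairPaths {ps : α → List (Path × ℕ)} (hp : Poly ps) :
    Poly fun x => pairPaths (ps x) := by
  unfold pairPaths
  fun_prop

@[fun_prop]
lemma poly_classPaths {c : α → ℕ} {ps : α → List (Path × ℕ)} (hc : Poly c) (hp : Poly ps) :
    Poly fun x => classPaths (c x) (ps x) := by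
  unfold classPaths
  fun_prop

end

/-- Nodes of a decision tree: whether it is a leaf, its class or feature, its literals. -/
abbrev Token : Type := Bool × ℕ × List (List Bool)

/-- Code and paths of a subtree. -/
abbrev Entry : Type := List Sym × List (Path × ℕ)

/-- Code and paths of a tree with a given root and given subtrees. -/
def nodeEntry (i : ℕ) (ts : List (List Bool)) (es : List Entry) : Entry :=
  (.bra :: (encNat i ++ encNat ts.length ++
      ((ts.zip es).flatMap fun p => p.1.map Γ'.bit ++ p.2.1) ++ [.ket]),
    (ts.zip es).flatMap fun p => p.2.2.map fun q => ((i, p.1) :: q.1, q.2))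

/-- Addition of a node on top of the trees listed so far. -/
def tokenStep (ds : List ℕ) (K : ℕ) (st : Bool × List Entry) (t : Token) : Bool × List Entry :=
  bif t.1 then (st.1 && decide (t.2.1 < K), (.blank :: encNat t.2.1, [([], t.2.1)]) :: st.2)
  else (st.1 && (decide (t.2.1 < ds.length) && (decide (t.2.2.length ≤ st.2.length) &&
      t.2.2.all fun l => ds.zipIdx.any fun p => decide (p.2 = t.2.1) && decide (p.1 = l.length))),
    nodeEntry t.2.1 t.2.2 st.2 :: st.2.drop t.2.2.length)

/-- The trees with a given list of nodes in prefix order. -/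
def buildTrees (ds : List ℕ) (K : ℕ) (ts : List Token) : Bool × List Entry :=
  ts.reverse.foldl (tokenStep ds K) (true, [])

section

variable {α : Type} [Enc α]

@[fun_prop]
lemma poly_nodeEntry {i : α → ℕ} {ts : α → List (List Bool)} {es : α → List Entry} (hi : Poly i)
    (ht : Poly ts) (he : Poly es) : Poly fun x => nodeEntry (i x) (ts x) (es x) := by
  unfold nodeEntry
  fun_prop

@[fun_prop]
lemma poly_tokenStep {ds : α → List ℕ} {K : α → ℕ} {st : α → Bool × List Entry} {t : α → Token}
    (hd : Poly ds) (hK : Poly K) (hs : Poly st) (ht : Poly t) :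
    Poly fun x => tokenStep (ds x) (K x) (st x) (t x) := by
  unfold tokenStep
  fun_prop

lemma sz_map_bit_le (t : List Bool) : sz (t.map Γ'.bit) ≤ 2 * sz t := by
  induction t with
  | nil => simp
  | cons a t ih =>
    have : sz (Γ'.bit a) ≤ sz a + 2 := by
      cases a <;> simp [sz, Enc.toD, symIndex, Data.unary, Data.size, Data.tru]
    have := sz_pos a
    simp
    omega

lemma sz_map_test (i : ℕ) (t : List Bool) (ps : List (Path × ℕ)) :
    sz (ps.map fun q => (((i, t) :: q.1, q.2) : Path × ℕ)) =
      sz ps + ps.length * (2 + sz i + sz t) := by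
  induction ps with
  | nil => simp
  | cons p ps ih =>
    simp only [List.map_cons, sz_cons, sz_prod, ih, List.length_cons, Nat.add_mul]
    omega

/-- The number of paths in a list of subtrees. -/
def numPaths (es : List Entry) : ℕ := (es.map fun e => e.2.length).sum

/-- The codes and paths of the subtrees are moved from the stack into the new entry, not copied. The
growth comes from the tables and from one additional test on each path, whence the term with the
number of paths. -/
lemma sz_nodeEntry_aux (i N : ℕ) (ts : List (List Bool)) :
    ∀ es : List Entry, (∀ t ∈ ts, 2 + sz i + sz t ≤ N) →
    sz ((ts.zip es).flatMap fun p => p.1.map Γ'.bit ++ p.2.1) +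
      sz ((ts.zip es).flatMap fun p => p.2.2.map fun q => (((i, p.1) :: q.1, q.2) : Path × ℕ)) +
      sz (es.drop ts.length) ≤ sz es + 2 * sz ts + numPaths es * N := by
  induction ts with
  | nil => intro es _; simp; omega
  | cons t ts ih =>
    intro es h
    cases es with
    | nil => simp; omega
    | cons e es =>
      have h1 := ih es fun t ht => h t (List.mem_cons_of_mem _ ht)
      have h2 := Nat.mul_le_mul_left e.2.length (h t List.mem_cons_self)
      have h3 := sz_map_bit_le t
      have h4 := sz_map_test i t e.2
      simp only [List.zip_cons_cons, List.flatMap_cons, List.length_cons, List.drop_succ_cons,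
        sz_cons, sz_prod, numPaths, List.map_cons, List.sum_cons, Nat.add_mul] at h1 ⊢
      have h5 := sz_append (t.map Γ'.bit ++ e.1)
        ((ts.zip es).flatMap fun p => p.1.map Γ'.bit ++ p.2.1)
      have h6 := sz_append (t.map Γ'.bit) e.1
      have h7 := sz_append (e.2.map fun q => (((i, t) :: q.1, q.2) : Path × ℕ))
        ((ts.zip es).flatMap fun p => p.2.2.map fun q => (((i, p.1) :: q.1, q.2) : Path × ℕ))
      omega

/-- A new inner node uses each path of its subtrees once, so the number of paths does not grow; only
leaves create new ones. -/
lemma numPaths_nodeEntry_aux (i : ℕ) (ts : List (List Bool)) : ∀ es : List Entry,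
    ((ts.zip es).flatMap fun p =>
      p.2.2.map fun q => (((i, p.1) :: q.1, q.2) : Path × ℕ)).length +
      numPaths (es.drop ts.length) ≤ numPaths es := by
  induction ts with
  | nil => intro es; simp
  | cons t ts ih =>
    intro es
    cases es with
    | nil => simp
    | cons e es =>
      have h1 := ih es
      simp only [List.zip_cons_cons, List.flatMap_cons, List.length_append, List.length_map,
        List.length_cons, List.drop_succ_cons, numPaths, List.map_cons, List.sum_cons] at h1 ⊢
      omega

lemma sz_and_le (a b : Bool) : sz (a && b) ≤ sz a := by
  cases a <;> cases b <;> simp [sz, Data.size, Data.tru]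

lemma numPaths_tokenStep (ds : List ℕ) (K : ℕ) (st : Bool × List Entry) (t : Token) :
    numPaths (tokenStep ds K st t).2 ≤ numPaths st.2 + 1 := by
  obtain ⟨l, i, ts⟩ := t
  obtain ⟨b, es⟩ := st
  cases l
  · have := numPaths_nodeEntry_aux i ts es
    simp only [tokenStep, nodeEntry, numPaths, List.map_cons, List.sum_cons, cond_false] at this ⊢
    omega
  · simp [tokenStep, numPaths]
    omega

lemma exists_sz_tokenStep_le : ∃ q : ℕ[X], ∀ (ds : List ℕ) (K : ℕ) (st : Bool × List Entry)
    (t : Token), sz (tokenStep ds K st t) ≤ sz st + (numPaths st.2 + 1) * q.eval (sz t) := by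
  have h1 : Poly fun t : Token =>
      ((.blank :: encNat t.2.1, [([], t.2.1)]) : Entry) := by fun_prop
  have h2 : Poly fun t : Token =>
      (.bra :: (encNat t.2.1 ++ encNat t.2.2.length ++ [.ket]) : List Sym) := by fun_prop
  obtain ⟨q₁, hq₁⟩ := h1.exists_bound
  obtain ⟨q₂, hq₂⟩ := h2.exists_bound
  -- `q₁` pays for a leaf, `q₂` for the brackets and numbers of an inner node, and the rest for its
  -- tables, the added tests and the list cells.
  refine ⟨q₁ + q₂ + 3 * X + 10, fun ds K st t => ?_⟩
  obtain ⟨l, i, ts⟩ := t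
  obtain ⟨b, es⟩ := st
  have e1 := hq₁ (l, i, ts)
  have e2 := hq₂ (l, i, ts)
  simp only [eval_add, eval_mul, eval_X, eval_ofNat]
  generalize eval (sz (l, i, ts)) q₁ = M₁ at *
  generalize eval (sz (l, i, ts)) q₂ = M₂ at *
  simp only [sz_prod, sz_cons] at e1 e2
  generalize hM : M₁ + M₂ + 3 * sz (l, i, ts) + 10 = M
  simp only [sz_prod] at hM
  cases l
  · have h4 := sz_nodeEntry_aux i (sz i + sz ts + 2) ts es
      fun t ht => by have := sz_le_of_mem ht; omega
    have h5 := Nat.mul_le_mul_left (numPaths es) (show sz i + sz ts + 2 ≤ M by omega)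
    have h6 := sz_and_le b (decide (i < ds.length) && (decide (ts.length ≤ es.length) &&
      ts.all fun l => ds.zipIdx.any fun p => decide (p.2 = i) && decide (p.1 = l.length)))
    have h7 := sz_append (encNat i ++ encNat ts.length ++
      ((ts.zip es).flatMap fun p => p.1.map Γ'.bit ++ p.2.1)) [.ket]
    have h8 := sz_append (encNat i ++ encNat ts.length)
      ((ts.zip es).flatMap fun p => p.1.map Γ'.bit ++ p.2.1)
    have h9 := sz_append (encNat i ++ encNat ts.length) [.ket]
    simp only [tokenStep, nodeEntry, cond_false, sz_prod, sz_cons, Nat.add_mul (numPaths es) 1,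
      Nat.one_mul]
    omega
  · have h6 := sz_and_le b (decide (i < K))
    simp only [tokenStep, cond_true, sz_prod, sz_cons, Nat.add_mul (numPaths es) 1, Nat.one_mul]
    omega

-- A per-token bound proportional to the current size would allow exponential growth. What rescues
-- polynomiality is that the factor is the number of paths, which increases by at most one with each
-- token.
@[fun_prop]
lemma poly_buildTrees {ds : α → List ℕ} {K : α → ℕ} {ts : α → List Token} (hd : Poly ds)
    (hK : Poly K) (ht : Poly ts) : Poly fun x => buildTrees (ds x) (K x) (ts x) := by
  obtain ⟨q, hq⟩ := exists_sz_tokenStep_le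
  have h3 : Poly fun s : (List ℕ × ℕ) × List Token => buildTrees s.1.1 s.1.2 s.2 :=
    Poly.foldl_of_measures (l := fun s : (List ℕ × ℕ) × List Token => s.2.reverse)
      (init := (true, [])) (f := fun s => tokenStep s.1.1 s.1.2) sz (fun st => numPaths st.2)
      (fun _ => le_rfl) (by fun_prop) (by fun_prop)
      (fun s st t => numPaths_tokenStep s.1.1 s.1.2 st t) q
      (fun s st t => (hq _ _ _ _).trans (Nat.add_le_add_left (Nat.mul_le_mul_left _
        (polynomial_eval_mono q (Nat.le_add_left _ _))) _))
  exact h3.comp (g := fun x => ((ds x, K x), ts x)) (by fun_prop)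

end

/-- The data of an input, a size bound and a set: the set, the sizes of the domains, the number of
classes, the nodes of the tree, the instance, its class, the threshold, and the size bound. -/
abbrev Cert : Type :=
  List Bool × List ℕ × ℕ × List Token × List ℕ × ℕ × ℕ × ℕ × ℕ

/-- The code of the query with given data. -/
def certCode (ds : List ℕ) (K : ℕ) (t : List Sym) (vs : List ℕ) (c num den k : ℕ) : List Sym :=
  encNat ds.length ++ ds.flatMap encNat ++ encNat K ++ t ++ vs.flatMap encNat ++ encNat c ++
    encNat num ++ encNat den ++ encNat k

/-- The data are well-formed, except possibly for the tree. -/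
def dataOk (S : List Bool) (ds : List ℕ) (K : ℕ) (vs : List ℕ) (c num den k : ℕ) : Bool :=
  decide (vs.length = ds.length) && decide (S.length = ds.length) &&
    ((vs.zip ds).all fun p => decide (p.1 < p.2)) && decide (c < K) && decide (0 < den) &&
    decide (num ≤ den) && decide (S.count true ≤ k)

/-- Every point is consistent with exactly one path. -/
def properOk (ds vs : List ℕ) (ps : List (Path × ℕ)) : Bool :=
  decide (totalCount (feats ds vs (ds.map fun _ => false)) ps = ds.prod) &&
    decide (totalCount (feats ds vs (ds.map fun _ => false)) (pairPaths ps) = ds.prod)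

/-- The instance has class `c`, and the set is relevant. -/
def relevantOk (S : List Bool) (ds vs : List ℕ) (c num den : ℕ) (ps : List (Path × ℕ)) : Bool :=
  decide (0 < totalCount (feats ds vs (ds.map fun _ => true)) (classPaths c ps)) &&
    decide (num * pathCount (feats ds vs S) [] ≤
      den * totalCount (feats ds vs S) (classPaths c ps))

/-- All features are boolean, and there are two classes. -/
def booleanOk (ds : List ℕ) (K : ℕ) : Bool := (ds.all fun d => decide (d = 2)) && decide (K = 2)

/-- The verification of a certificate; `b` tells whether the input is required to be boolean. -/
def verify (b : Bool) (w : List Sym) : Cert → Bool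
  | (S, ds, K, ts, vs, c, num, den, k) =>
    (buildTrees ds K ts).1 && decide ((buildTrees ds K ts).2.length = 1) &&
    decide (w = certCode ds K ((buildTrees ds K ts).2.headD ([], [])).1 vs c num den k) &&
    dataOk S ds K vs c num den k &&
    properOk ds vs ((buildTrees ds K ts).2.headD ([], [])).2 &&
    relevantOk S ds vs c num den ((buildTrees ds K ts).2.headD ([], [])).2 &&
    (!b || booleanOk ds K)

lemma poly_verify (b : Bool) : Poly fun p : List Sym × Cert => verify b p.1 p.2 := by
  unfold verify dataOk properOk relevantOk booleanOk certCode
  fun_prop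

end DTRelevance

/-! ### Correctness of the counting: boxes, properness and relevance. -/

namespace DTRelevance

open PolyTM Computability

/-! ### Counting points -/

lemma getBit_iff (t : List Bool) (n : ℕ) : getBit t n = true ↔ t[n]? = some true := by
  simp only [getBit, List.any_eq_true, Bool.and_eq_true, decide_eq_true_eq]
  constructor
  · rintro ⟨⟨b, i⟩, h, rfl, rfl⟩
    simpa [List.mem_zipIdx_iff_getElem?] using h
  · intro h
    exact ⟨(true, n), by simpa [List.mem_zipIdx_iff_getElem?] using h, rfl, rfl⟩

/-- The table of a subset of `{0, …, n - 1}`. -/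
def table {n : ℕ} (S : Finset (Fin n)) : List Bool := List.ofFn fun i => decide (i ∈ S)

lemma encSet_eq {n : ℕ} (S : Finset (Fin n)) : encSet S = (table S).map .bit := by
  simp [encSet, table, List.map_ofFn, Function.comp_def]

lemma getBit_ofFn {n : ℕ} (g : Fin n → Bool) (x : Fin n) : getBit (List.ofFn g) x = g x := by
  rw [Bool.eq_iff_iff, getBit_iff]
  simp

lemma eq_ofFn_getBit {n : ℕ} {t : List Bool} (h : t.length = n) :
    t = List.ofFn fun y : Fin n => getBit t y := by
  apply List.ext_getElem
  · simp [h]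
  · intro i h1 h2
    rw [List.getElem_ofFn, Bool.eq_iff_iff, getBit_iff]
    simp [h1]

lemma andTable_ofFn {n : ℕ} (g : Fin n → Bool) {t : List Bool} (h : t.length = n) :
    andTable (List.ofFn g) t = List.ofFn fun y : Fin n => g y && getBit t y := by
  conv_lhs => rw [eq_ofFn_getBit h]
  apply List.ext_getElem
  · simp [andTable]
  · intro i h1 h2
    simp [andTable]

lemma foldl_andTable {n : ℕ} (ts : List (List Bool)) : ∀ g : Fin n → Bool,
    (∀ t ∈ ts, t.length = n) → ts.foldl andTable (List.ofFn g) =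
      List.ofFn fun y : Fin n => g y && ts.all fun t => getBit t y := by
  induction ts with
  | nil => simp
  | cons t ts ih =>
    intro g h
    rw [List.foldl_cons, andTable_ofFn g (h t List.mem_cons_self),
      ih _ fun t ht => h t (List.mem_cons_of_mem _ ht)]
    simp [Bool.and_assoc]

lemma meetTables_eq {n : ℕ} {ts : List (List Bool)} (h : ∀ t ∈ ts, t.length = n) (h0 : ts ≠ []) :
    meetTables ts = List.ofFn fun y : Fin n => ts.all fun t => getBit t y := by
  cases ts with
  | nil => exact absurd rfl h0
  | cons t ts =>
    rw [meetTables, List.headD_cons, List.tail_cons, eq_ofFn_getBit (h t List.mem_cons_self),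
      foldl_andTable _ _ fun t ht => h t (List.mem_cons_of_mem _ ht)]
    simp [getBit_ofFn]

lemma count_ofFn {n : ℕ} (g : Fin n → Bool) :
    (List.ofFn g).count true = (Finset.univ.filter fun y => g y = true).card := by
  induction n with
  | zero => simp
  | succ n ih =>
    rw [List.ofFn_succ, List.count_cons, ih, Fin.card_filter_univ_succ]
    cases g 0 <;> simp

lemma count_table {n : ℕ} (S : Finset (Fin n)) : (table S).count true = S.card := by
  rw [table, count_ofFn]
  simp

section

variable {m : ℕ} {d : Fin m → ℕ} {K : ℕ}

/-- The value of the `i`-th feature. -/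
def pointVal (x : Point d) (i : ℕ) : ℕ := if h : i < m then x ⟨i, h⟩ else 0

/-- A point passes the tests of a path. -/
def passes (x : Point d) (π : Path) : Bool := π.all fun p => getBit p.2 (pointVal x p.1)

@[simp] lemma pointVal_fin (x : Point d) (i : Fin m) : pointVal x i = x i := by simp [pointVal]

lemma passes_append (x : Point d) (π ρ : Path) :
    passes x (π ++ ρ) = (passes x π && passes x ρ) := by
  simp [passes]

/-- The tests of a path belong to features, and the tables have the right lengths. -/
def WfPath (d : Fin m → ℕ) (π : Path) : Prop :=
  ∀ p ∈ π, ∃ i : Fin m, p.1 = i ∧ p.2.length = d i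

lemma passes_iff (x : Point d) {π : Path} (h : WfPath d π) :
    passes x π = true ↔ ∀ i : Fin m, ∀ t ∈ tablesAt i π, getBit t (x i) = true := by
  simp only [passes, List.all_eq_true, tablesAt, List.mem_map, List.mem_filter, decide_eq_true_eq]
  constructor
  · rintro h1 i _ ⟨p, ⟨hp, hi⟩, rfl⟩
    simpa [hi] using h1 p hp
  · intro h1 p hp
    obtain ⟨i, hi, -⟩ := h p hp
    simpa [hi] using h1 i p.2 ⟨p, ⟨hp, hi⟩, rfl⟩

lemma feats_ofFn (v : Fin m → ℕ) (s : Fin m → Bool) :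
    feats (List.ofFn d) (List.ofFn v) (List.ofFn s) =
      List.ofFn fun i => ((d i, v i, s i), (i : ℕ)) := by
  apply List.ext_getElem
  · simp [feats]
  · intro i h1 h2
    simp [feats]

/-- A fixed feature leaves one candidate. A free feature without tests must be treated apart: its
domain size is given in binary and may be too large to enumerate. With at least one test a table
over the domain is part of the tree, so counting its surviving entries is feasible. -/
lemma featCount_eq (v : Point d) (s : Fin m → Bool) {π : Path} (h : WfPath d π) (i : Fin m) :
    featCount π ((d i, (v i : ℕ), s i), (i : ℕ)) = (Finset.univ.filter fun y : Fin (d i) =>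
      (∀ t ∈ tablesAt i π, getBit t y = true) ∧ (s i = true → y = v i)).card := by
  have hl : ∀ t ∈ tablesAt i π, t.length = d i := by
    intro t ht
    simp only [tablesAt, List.mem_map, List.mem_filter, decide_eq_true_eq] at ht
    obtain ⟨p, ⟨hp, hi⟩, rfl⟩ := ht
    obtain ⟨j, hj, hl⟩ := h p hp
    rw [hl, show j = i from Fin.ext (hj.symm.trans hi)]
  unfold featCount
  cases hs : s i with
  | true =>
    simp only [cond_true, forall_const]
    cases ha : (tablesAt i π).all fun t => getBit t (v i) with
    | true =>
      rw [cond_true, eq_comm, Finset.card_eq_one]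
      refine ⟨v i, ?_⟩
      ext y
      simp only [Finset.mem_filter, Finset.mem_univ, true_and, Finset.mem_singleton]
      refine ⟨fun h => h.2, ?_⟩
      rintro rfl
      simpa using ha
    | false =>
      rw [cond_false, eq_comm, Finset.card_eq_zero, Finset.filter_eq_empty_iff]
      rintro y - ⟨h1, rfl⟩
      have : ((tablesAt i π).all fun t => getBit t (v i)) = true := by simpa using h1
      simp [this] at ha
  | false =>
    simp only [cond_false, Bool.false_eq_true, false_implies, and_true]
    cases ht : (tablesAt i π).isEmpty with
    | true => simp [List.isEmpty_iff.1 ht]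
    | false =>
      rw [cond_false, meetTables_eq hl (by rintro h; simp [h] at ht), count_ofFn]
      simp

/-- Each test and each fixed value concerns a single feature, so the set of points is a product of
sets of values. -/
lemma pathCount_eq (v : Point d) (s : Fin m → Bool) {π : Path} (h : WfPath d π) :
    pathCount (feats (List.ofFn d) (List.ofFn fun i => (v i : ℕ)) (List.ofFn s)) π =
      (Finset.univ.filter fun x : Point d =>
        passes x π = true ∧ ∀ i, s i = true → x i = v i).card := by
  rw [pathCount, feats_ofFn, List.map_ofFn, List.prod_ofFn]
  simp only [Function.comp_apply, featCount_eq v s h]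
  rw [← Fintype.card_piFinset]
  congr 1
  ext x
  simp only [Fintype.mem_piFinset, Finset.mem_filter, Finset.mem_univ, true_and, passes_iff x h,
    forall_and]

/-- Double counting of the incidences between paths and points. -/
lemma sum_card_passes (A : Point d → Prop) [DecidablePred A] (ps : List (Path × ℕ)) :
    (ps.map fun p => (Finset.univ.filter fun x : Point d => passes x p.1 = true ∧ A x).card).sum =
      ∑ x ∈ Finset.univ.filter A, ps.countP fun p => passes x p.1 := by
  induction ps with
  | nil => simp
  | cons p ps ih =>
    simp only [List.map_cons, List.sum_cons, ih, List.countP_cons, Finset.sum_add_distrib]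
    rw [add_comm, Finset.sum_boole, Finset.filter_filter]
    simp [and_comm]

lemma totalCount_eq (v : Point d) (s : Fin m → Bool) {ps : List (Path × ℕ)}
    (h : ∀ p ∈ ps, WfPath d p.1) :
    totalCount (feats (List.ofFn d) (List.ofFn fun i => (v i : ℕ)) (List.ofFn s)) ps =
      ∑ x ∈ Finset.univ.filter fun x : Point d => ∀ i, s i = true → x i = v i,
        ps.countP fun p => passes x p.1 := by
  rw [← sum_card_passes, totalCount]
  congr 1
  refine List.map_congr_left fun p hp => ?_
  rw [pathCount_eq v s (h p hp)]

/-- A point passes a concatenation iff it passes both parts, so ordered pairs of consistent paths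
are counted, repetitions included. -/
lemma countP_pairPaths (x : Point d) (ps : List (Path × ℕ)) :
    (pairPaths ps).countP (fun p => passes x p.1) = (ps.countP fun p => passes x p.1) ^ 2 := by
  have key : ∀ l : List (Path × ℕ), (l.flatMap fun p => ps.map fun q =>
      ((p.1 ++ q.1, 0) : Path × ℕ)).countP (fun p => passes x p.1) =
      (l.countP fun p => passes x p.1) * (ps.countP fun p => passes x p.1) := by
    intro l
    induction l with
    | nil => simp
    | cons p l ih =>
      rw [List.flatMap_cons, List.countP_append, ih, List.countP_map, List.countP_cons]
      cases h : passes x p.1 <;> simp [passes_append, Function.comp_def, h, Nat.add_mul]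
      ring
  rw [pairPaths, key, sq]

/-! ### Paths of decision trees -/

namespace DTree

/-- The root-to-leaf paths of a decision tree with the classes of their leaves. -/
def paths : DTree d K → List (Path × ℕ)
  | leaf c => [([], c)]
  | node i _ label child => (List.ofFn fun j =>
      (child j).paths.map fun q => (((i : ℕ), table (label j)) :: q.1, q.2)).flatten

lemma wfPath (T : DTree d K) : ∀ p ∈ T.paths, WfPath d p.1 := by
  induction T with
  | leaf c => simp [paths, WfPath]
  | node i r label child ih =>
    intro p hp
    simp only [paths, List.mem_flatten, List.mem_ofFn] at hp
    obtain ⟨_, ⟨j, rfl⟩, hp⟩ := hp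
    obtain ⟨q, hq, rfl⟩ := List.mem_map.1 hp
    intro t ht
    rcases List.mem_cons.1 ht with rfl | ht
    · exact ⟨i, rfl, by simp [table]⟩
    · exact ih j q hq t ht

lemma map_outcomes (T : DTree d K) (x : Point d) :
    (T.outcomes x).map Fin.val = (T.paths.filter fun p => passes x p.1).map Prod.snd := by
  induction T with
  | leaf c => rfl
  | node i r label child ih =>
    simp only [outcomes, paths, List.map_flatten, List.filter_flatten, List.map_ofFn]
    congr 2
    funext j
    have h1 : ∀ q : Path × ℕ, passes x (((i : ℕ), table (label j)) :: q.1) =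
        (decide (x i ∈ label j) && passes x q.1) := by
      intro q
      simp [passes, table, getBit_ofFn]
    simp only [Function.comp_apply, List.filter_map, List.map_map, Function.comp_def, h1]
    by_cases h : x i ∈ label j
    · simp [h, ih j]
    · simp [h]

lemma length_outcomes (T : DTree d K) (x : Point d) :
    (T.outcomes x).length = T.paths.countP fun p => passes x p.1 := by
  rw [← List.length_map (f := Fin.val), map_outcomes, List.length_map, List.countP_eq_length_filter]

lemma countP_classPaths (T : DTree d K) (hT : T.Proper) (c : Fin K) (x : Point d) :
    (classPaths c T.paths).countP (fun p => passes x p.1) =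
      if T.classify hT x = c then 1 else 0 := by
  have h1 : (classPaths c T.paths).countP (fun p => passes x p.1) =
      ((T.outcomes x).map Fin.val).count (c : ℕ) := by
    rw [map_outcomes, classPaths, List.count, List.countP_map, List.countP_filter,
      List.countP_filter]
    congr 1
    funext p
    simp [Bool.and_comm, Bool.beq_eq_decide_eq]
  rw [h1]
  obtain ⟨a, ha⟩ := List.length_eq_one_iff.1 (hT x)
  have h2 : T.classify hT x = a := by simp [classify, ha]
  rw [h2, ha]
  simp [List.count_cons, Fin.ext_iff]

end DTree

lemma card_point : Fintype.card (Point d) = (List.ofFn d).prod := by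
  rw [List.prod_ofFn, Fintype.card_pi]
  simp

lemma map_false_ofFn : (List.ofFn d).map (fun _ => false) = List.ofFn fun _ : Fin m => false := by
  rw [List.map_ofFn]; rfl

lemma map_true_ofFn : (List.ofFn d).map (fun _ => true) = List.ofFn fun _ : Fin m => true := by
  rw [List.map_ofFn]; rfl

/-- No feature is fixed in either count, so the first and second moments of the number of consistent
paths are taken over the whole feature space. Two moments suffice because a sum of squares of
deviations from one vanishes only termwise. -/
lemma properOk_iff (T : DTree d K) (v : Point d) :
    properOk (List.ofFn d) (List.ofFn fun i => (v i : ℕ)) T.paths = true ↔ T.Proper := by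
  have hp : ∀ p ∈ pairPaths T.paths, WfPath d p.1 := by
    intro p hp
    simp only [pairPaths, List.mem_flatMap, List.mem_map] at hp
    obtain ⟨q, hq, q', hq', rfl⟩ := hp
    intro t ht
    rcases List.mem_append.1 ht with ht | ht
    · exact T.wfPath q hq t ht
    · exact T.wfPath q' hq' t ht
  simp only [properOk, Bool.and_eq_true, decide_eq_true_eq, map_false_ofFn, ← card_point]
  rw [totalCount_eq v _ T.wfPath, totalCount_eq v _ hp]
  simp only [Bool.false_eq_true, false_implies, implies_true, Finset.filter_true,
    countP_pairPaths, ← T.length_outcomes]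
  constructor
  · rintro ⟨h1, h2⟩ x
    -- Integers are needed here, as a point may be consistent with no path at all.
    have h3 : ∑ x : Point d, (((T.outcomes x).length : ℤ) - 1) ^ 2 = 0 := by
      have h1' : ∑ x : Point d, ((T.outcomes x).length : ℤ) = Fintype.card (Point d) := by
        exact_mod_cast h1
      have h2' : ∑ x : Point d, ((T.outcomes x).length : ℤ) ^ 2 = Fintype.card (Point d) := by
        exact_mod_cast h2
      calc _ = ∑ x : Point d, (((T.outcomes x).length : ℤ) ^ 2 -
            2 * ((T.outcomes x).length : ℤ) + 1) := Finset.sum_congr rfl fun x _ => by ring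
        _ = 0 := by
          rw [Finset.sum_add_distrib, Finset.sum_sub_distrib, ← Finset.mul_sum, h1', h2']
          simp
          ring
    rw [Finset.sum_eq_zero_iff_of_nonneg fun _ _ => sq_nonneg _] at h3
    have h4 := pow_eq_zero_iff (two_ne_zero) |>.1 (h3 x (Finset.mem_univ x))
    omega
  · intro h
    simp [show ∀ x, (T.outcomes x).length = 1 from h]

lemma totalCount_classPaths (T : DTree d K) (hT : T.Proper) (v : Point d) (s : Fin m → Bool)
    (c : Fin K) :
    totalCount (feats (List.ofFn d) (List.ofFn fun i => (v i : ℕ)) (List.ofFn s))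
      (classPaths c T.paths) = (Finset.univ.filter fun x : Point d =>
        T.classify hT x = c ∧ ∀ i, s i = true → x i = v i).card := by
  rw [totalCount_eq v s (ps := classPaths c T.paths)
    fun p hp => T.wfPath p (List.mem_filter.1 hp).1]
  simp only [T.countP_classPaths hT]
  rw [Finset.sum_boole, Finset.filter_filter]
  simp [and_comm]

lemma condProb_ge_iff {Ω : Type*} [Fintype Ω] (A B : Ω → Prop) [DecidablePred A] [DecidablePred B]
    (hB : ∃ x, B x) {n k : ℕ} (hk : 0 < k) : (n : ℚ) / k ≤ condProb A B ↔
      n * (Finset.univ.filter B).card ≤ k * (Finset.univ.filter fun x => A x ∧ B x).card := by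
  obtain ⟨x, hx⟩ := hB
  have h : 0 < (Finset.univ.filter B).card := Finset.card_pos.2 ⟨x, by simpa using hx⟩
  rw [condProb, Nat.card_eq_fintype_card, Nat.card_eq_fintype_card, Fintype.card_subtype,
    Fintype.card_subtype, div_le_div_iff₀ (by exact_mod_cast hk) (by exact_mod_cast h)]
  rw [mul_comm k]
  norm_cast

/-- Fixing all features isolates `v`, so the same count that measures relevance also tests the class
of the instance: it is positive iff `v` itself is counted. The denominator of the probability is the
count for the empty path. -/
lemma relevantOk_iff (T : DTree d K) (hT : T.Proper) (v : Point d) (c : Fin K) (num : ℕ) {den : ℕ}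
    (hden : 0 < den) (S : Finset (Fin m)) :
    relevantOk (table S) (List.ofFn d) (List.ofFn fun i => (v i : ℕ)) c num den T.paths = true ↔
      T.classify hT v = c ∧ IsRelevant (T.classify hT) v c ((num : ℚ) / den) S := by
  classical
  have h1 := totalCount_classPaths T hT v (fun _ => true) c
  have h2 := totalCount_classPaths T hT v (fun i => decide (i ∈ S)) c
  have h3 := pathCount_eq v (fun i => decide (i ∈ S)) (π := []) (by simp [WfPath])
  rw [relevantOk, Bool.and_eq_true, decide_eq_true_eq, decide_eq_true_eq, map_true_ofFn, h1,
    table, h2, h3, Finset.card_pos]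
  refine and_congr ?_ ?_
  · constructor
    · rintro ⟨x, hx⟩
      simp only [forall_const, Finset.mem_filter, Finset.mem_univ, true_and] at hx
      rw [show v = x from funext fun i => (hx.2 i).symm, hx.1]
    · intro h
      exact ⟨v, by simp [h]⟩
  · rw [IsRelevant, condProb_ge_iff _ _ ⟨v, fun _ _ => rfl⟩ hden]
    simp [passes]

end

end DTRelevance

/-! ### Trees from their node lists, soundness and completeness of certificates, membership in NP.
-/

namespace DTRelevance

open PolyTM Computability

/-! ### Reconstruction of decision trees -/

lemma table_filter {n : ℕ} (g : Fin n → Bool) :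
    table (Finset.univ.filter fun y => g y = true) = List.ofFn g := by
  simp [table]

lemma exists_table_eq {n : ℕ} {t : List Bool} (h : t.length = n) :
    ∃ S : Finset (Fin n), t = table S :=
  ⟨_, (eq_ofFn_getBit h).trans (table_filter _).symm⟩

lemma table_injective {n : ℕ} : Function.Injective (table (n := n)) := by
  intro S S' h
  ext i
  simpa using congrFun (List.ofFn_injective h) i

lemma zip_ofFn_append {α β : Type*} {r : ℕ} (f : Fin r → α) (g : Fin r → β) (l : List β) :
    (List.ofFn f).zip (List.ofFn g ++ l) = List.ofFn fun j => (f j, g j) := by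
  apply List.ext_getElem
  · simp
  · intro i h1 h2
    have : i < r := by simpa using h2
    simp [this]

variable {m : ℕ} {d : Fin m → ℕ} {K : ℕ}

namespace DTree

/-- The nodes of a decision tree in prefix order. -/
def tokens : DTree d K → List Token
  | leaf c => [(true, (c : ℕ), [])]
  | node i _ label child => (false, (i : ℕ), List.ofFn fun j => table (label j)) ::
      (List.ofFn fun j => (child j).tokens).flatten

/-- The code and the paths of a decision tree. -/
def entry (T : DTree d K) : Entry := (T.enc, T.paths)

lemma nodeEntry_eq (i : Fin m) (r : ℕ) (label : Fin r → Finset (Fin (d i)))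
    (child : Fin r → DTree d K) (st : List Entry) :
    nodeEntry i (List.ofFn fun j => table (label j)) ((List.ofFn fun j => (child j).entry) ++ st) =
      (node i r label child).entry := by
  simp only [nodeEntry, zip_ofFn_append, List.flatMap_def, List.map_ofFn, List.length_ofFn, entry,
    enc, paths, Function.comp_def, encSet_eq]

end DTree

lemma zipIdx_any_iff (n : ℕ) (i : Fin m) :
    ((List.ofFn d).zipIdx.any fun p => decide (p.2 = (i : ℕ)) && decide (p.1 = n)) = true ↔
      n = d i := by
  simp only [List.any_eq_true, Bool.and_eq_true, decide_eq_true_eq, Prod.exists,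
    List.mem_zipIdx_iff_getElem?]
  constructor
  · rintro ⟨a, b, h, rfl, rfl⟩
    simpa using h.symm
  · rintro rfl
    exact ⟨d i, i, by simp, rfl, rfl⟩

lemma tokenStep_node (i : Fin m) (r : ℕ) (label : Fin r → Finset (Fin (d i)))
    (child : Fin r → DTree d K) (st : List Entry) :
    tokenStep (List.ofFn d) K (true, (List.ofFn fun j => (child j).entry) ++ st)
      (false, (i : ℕ), List.ofFn fun j => table (label j)) =
        (true, (DTree.node i r label child).entry :: st) := by
  have h1 : ∀ l ∈ List.ofFn fun j => table (label j),
      ((List.ofFn d).zipIdx.any fun p => decide (p.2 = (i : ℕ)) && decide (p.1 = l.length)) =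
        true := by
    intro l hl
    obtain ⟨j, rfl⟩ := List.mem_ofFn.1 hl
    rw [zipIdx_any_iff]
    simp [table]
  have h2 := List.all_eq_true.2 h1
  have h3 : ((List.ofFn fun j => (child j).entry) ++ st).drop r = st :=
    List.drop_left' (by simp)
  simp only [tokenStep, cond_false, DTree.nodeEntry_eq, h2, List.length_ofFn, h3]
  simp

/-- Processing a prefix listing from its end leaves the children of a node on top of the stack, in
order, when the node itself is reached. Arbitrary stack contents below are needed for the induction
over siblings. -/
lemma foldr_tokens (T : DTree d K) : ∀ st : List Entry,
    T.tokens.foldr (fun t st => tokenStep (List.ofFn d) K st t) (true, st) =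
      (true, T.entry :: st) := by
  induction T with
  | leaf c => intro st; simp [DTree.tokens, tokenStep, DTree.entry, DTree.enc, DTree.paths]
  | node i r label child ih =>
    intro st
    have key : ∀ Ts : List (DTree d K), (∀ T ∈ Ts, ∀ st : List Entry,
        T.tokens.foldr (fun t st => tokenStep (List.ofFn d) K st t) (true, st) =
          (true, T.entry :: st)) →
        (Ts.map DTree.tokens).flatten.foldr (fun t st => tokenStep (List.ofFn d) K st t)
          (true, st) = (true, Ts.map DTree.entry ++ st) := by
      intro Ts
      induction Ts with
      | nil => simp
      | cons T Ts ih =>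
        intro h
        rw [List.map_cons, List.flatten_cons, List.foldr_append,
          ih fun T hT => h T (List.mem_cons_of_mem _ hT), h T List.mem_cons_self]
        rfl
    have h := key (List.ofFn child) fun T hT => by
      obtain ⟨j, rfl⟩ := List.mem_ofFn.1 hT
      exact ih j
    rw [List.map_ofFn, List.map_ofFn] at h
    rw [DTree.tokens, List.foldr_cons]
    exact (congrArg (fun s => tokenStep (List.ofFn d) K s _) h).trans (tokenStep_node ..)

lemma buildTrees_tokens (T : DTree d K) :
    buildTrees (List.ofFn d) K T.tokens = (true, [T.entry]) := by
  rw [buildTrees, List.foldl_reverse, foldr_tokens]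

/-- Node lists in a certificate are arbitrary. The validity flag ensures at each node that the
feature exists, that enough subtrees are available, and that the tables have the length of the
domain, so every entry on the stack comes from a genuine tree. -/
lemma exists_trees (ts : List Token) :
    (ts.foldr (fun t st => tokenStep (List.ofFn d) K st t) (true, [])).1 = true →
    ∃ Ts : List (DTree d K), (ts.foldr (fun t st => tokenStep (List.ofFn d) K st t) (true, [])).2 =
      Ts.map DTree.entry := by
  induction ts with
  | nil => exact fun _ => ⟨[], rfl⟩
  | cons t ts ih =>
    rw [List.foldr_cons]
    revert ih
    generalize ts.foldr (fun t st => tokenStep (List.ofFn d) K st t) (true, []) = st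
    obtain ⟨b, es⟩ := st
    obtain ⟨leaf, i, tabs⟩ := t
    intro ih h
    cases leaf with
    | true =>
      simp only [tokenStep, cond_true, Bool.and_eq_true, decide_eq_true_eq] at h ⊢
      obtain ⟨Ts, rfl⟩ := ih h.1
      exact ⟨.leaf ⟨i, h.2⟩ :: Ts, rfl⟩
    | false =>
      simp only [tokenStep, cond_false, Bool.and_eq_true, decide_eq_true_eq,
        List.length_ofFn] at h
      obtain ⟨rfl, hi, hr, hl⟩ := h
      obtain ⟨Ts, rfl⟩ := ih rfl
      rw [List.length_map] at hr
      have h1 : ∀ j : Fin tabs.length, ∃ S : Finset (Fin (d ⟨i, hi⟩)), tabs[j] = table S :=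
        fun j => exists_table_eq ((zipIdx_any_iff _ ⟨i, hi⟩).1
          (List.all_eq_true.1 hl _ (List.getElem_mem j.2)))
      choose label hlabel using h1
      have h2 : tabs = List.ofFn fun j => table (label j) := by
        conv_lhs => rw [← List.ofFn_getElem (xs := tabs)]
        exact congrArg List.ofFn (funext hlabel)
      have h3 : Ts.map DTree.entry = (List.ofFn fun j : Fin tabs.length =>
          (Ts[j]'(j.2.trans_le hr)).entry) ++ (Ts.drop tabs.length).map DTree.entry := by
        conv_lhs => rw [← List.take_append_drop tabs.length Ts, List.map_append]
        congr 1
        apply List.ext_getElem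
        · simp [hr]
        · intro j h1 h2
          simp
      refine ⟨.node ⟨i, hi⟩ tabs.length label (fun j => Ts[j]'(j.2.trans_le hr)) ::
        Ts.drop tabs.length, ?_⟩
      have h4 := tokenStep_node ⟨i, hi⟩ tabs.length label
        (fun j => Ts[j]'(j.2.trans_le hr)) ((Ts.drop tabs.length).map DTree.entry)
      rw [← h3, ← h2] at h4
      rw [h4]
      rfl

/-! ### Certificates -/

lemma certCode_eq (I : Input) (k : ℕ) : certCode (List.ofFn I.d) I.K I.tree.enc
    (List.ofFn fun i => (I.v i : ℕ)) I.c I.num I.den k = encQuery I k := by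
  simp only [certCode, encQuery, Input.enc, encNats, List.flatMap_def, List.map_ofFn,
    List.length_ofFn, Function.comp_def, List.append_assoc]

/-- The certificate for a set. -/
def cert (I : Input) (k : ℕ) (S : Finset (Fin I.m)) : Cert :=
  (table S, List.ofFn I.d, I.K, I.tree.tokens, List.ofFn fun i => (I.v i : ℕ), (I.c : ℕ), I.num,
    I.den, k)

lemma booleanOk_iff : booleanOk (List.ofFn d) K = true ↔ (∀ i, d i = 2) ∧ K = 2 := by
  simp [booleanOk]

lemma verify_cert (b : Bool) (I : Input) (k : ℕ) (S : Finset (Fin I.m)) (hb : b = true → I.Boolean)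
    (hS : S.card ≤ k) (h : I.Relevant S) : verify b (encQuery I k) (cert I k S) = true := by
  have h1 := (properOk_iff I.tree I.v).2 I.proper
  have h2 := (relevantOk_iff I.tree I.proper I.v I.c I.num I.den_pos S).2 ⟨I.classify_v, h⟩
  have h3 : dataOk (table S) (List.ofFn I.d) I.K (List.ofFn fun i => (I.v i : ℕ)) I.c I.num I.den
      k = true := by
    have : ∀ p ∈ (List.ofFn fun i => (I.v i : ℕ)).zip (List.ofFn I.d), p.1 < p.2 := by
      have h := zip_ofFn_append (fun i => (I.v i : ℕ)) I.d []
      rw [List.append_nil] at h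
      simp [h]
    have := List.all_eq_true.2 fun p hp => decide_eq_true (this p hp)
    rw [dataOk, count_table, this]
    simp [table, I.den_pos, I.num_le_den, hS]
  have h4 : (!b || booleanOk (List.ofFn I.d) I.K) = true := by
    cases b
    · rfl
    · exact booleanOk_iff.2 (hb rfl)
  simp only [verify, cert, buildTrees_tokens, List.length_singleton, List.headD_cons, DTree.entry,
    certCode_eq, h1, h2, h3, h4]
  simp

lemma exists_point_eq {vs : List ℕ} (h : vs.length = m)
    (hv : ((vs.zip (List.ofFn d)).all fun p => decide (p.1 < p.2)) = true) :
    ∃ v : Point d, vs = List.ofFn fun i => (v i : ℕ) := by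
  subst h
  refine ⟨fun i => ⟨vs[i], ?_⟩, List.ofFn_getElem.symm⟩
  have := List.all_eq_true.1 hv (vs[i], d i) (by
    rw [List.mem_iff_getElem]
    exact ⟨i, by simp, by simp⟩)
  simpa using this

/-- The word is compared with the code computed from the certificate, so no parser for inputs is
required: an accepted certificate is itself a decoding, and the remaining tests supply the proof
fields of `Input`. -/
lemma exists_of_verify {b : Bool} {w : List Sym} {C : Cert} (h : verify b w C = true) :
    ∃ (I : Input) (k : ℕ) (S : Finset (Fin I.m)), w = encQuery I k ∧ (b = true → I.Boolean) ∧
      C.1 = table S ∧ S.card ≤ k ∧ I.Relevant S := by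
  obtain ⟨s, ds, K, ts, vs, c, num, den, k⟩ := C
  simp only [verify, dataOk, Bool.and_eq_true, decide_eq_true_eq, and_assoc] at h
  obtain ⟨ht, hl, hw, hvl, hsl, hv, hc, hden, hnum, hk, hp, hr, hb⟩ := h
  obtain ⟨m, d, rfl⟩ : ∃ (m : ℕ) (d : Fin m → ℕ), ds = List.ofFn d :=
    ⟨_, _, (List.ofFn_getElem (xs := ds)).symm⟩
  rw [List.length_ofFn] at hvl hsl
  obtain ⟨S, rfl⟩ := exists_table_eq hsl
  obtain ⟨v, rfl⟩ := exists_point_eq hvl hv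
  obtain ⟨Ts, hTs⟩ : ∃ Ts : List (DTree d K), (buildTrees (List.ofFn d) K ts).2 =
      Ts.map DTree.entry := by
    rw [buildTrees, List.foldl_reverse] at ht ⊢
    exact exists_trees ts ht
  rw [hTs, List.length_map] at hl
  obtain ⟨T, rfl⟩ := List.length_eq_one_iff.1 hl
  simp only [hTs, List.map_cons, List.headD_cons, DTree.entry] at hw hp hr
  have hT := (properOk_iff T v).1 hp
  obtain ⟨hcl, hrel⟩ := (relevantOk_iff T hT v ⟨c, hc⟩ num hden S).1 hr
  let I : Input := ⟨_, d, K, T, hT, v, ⟨c, hc⟩, hcl, num, den, hden, hnum⟩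
  refine ⟨I, k, S, hw.trans (certCode_eq I k), ?_, rfl, by rwa [count_table] at hk, hrel⟩
  rintro rfl
  exact booleanOk_iff.1 (by simpa using hb)

lemma length_encNat (n : ℕ) : (encNat n).length = n.size + 1 := by
  simp [encNat_eq, Nat.size_eq_bits_len]

lemma sz_nat_le_encNat (n : ℕ) : sz n + 3 ≤ 4 * (encNat n).length := by
  have := sz_nat_le n
  rw [length_encNat]
  omega

lemma sz_nats_le (l : List ℕ) : sz l ≤ 4 * (l.flatMap encNat).length + 1 := by
  induction l with
  | nil => simp
  | cons a l ih =>
    have := sz_nat_le_encNat a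
    rw [sz_cons, List.flatMap_cons, List.length_append]
    omega

lemma length_le_flatMap_encNat (l : List ℕ) : l.length ≤ (l.flatMap encNat).length := by
  induction l with
  | nil => simp
  | cons a l ih => simp [length_encNat]; omega

/-- The code of a tree lists the same data as its nodes. The slack of 3 absorbs, for each subtree,
the list cells of the table on its incoming edge. -/
lemma sz_tokens_le (T : DTree d K) : sz T.tokens + 3 ≤ 10 * T.enc.length := by
  induction T with
  | leaf c =>
    have h1 := sz_nat_le_encNat c
    have h2 : sz true = 3 := rfl
    simp only [DTree.tokens, DTree.enc, sz_cons, sz_prod, sz_nil, List.length_cons, h2]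
    omega
  | node i r label child ih =>
    have key : ∀ l : List (Fin r), sz (l.map fun j => table (label j)) +
        sz (l.map fun j => (child j).tokens).flatten ≤
        10 * (l.map fun j => encSet (label j) ++ (child j).enc).flatten.length + 2 := by
      intro l
      induction l with
      | nil => simp
      | cons j l ihl =>
        have h1 := ih j
        have h2 := sz_bits_le (table (label j))
        have h3 := sz_append (child j).tokens (l.map fun j => (child j).tokens).flatten
        simp only [List.map_cons, List.flatten_cons, List.length_append, sz_cons, encSet_eq,
          List.length_map] at ihl ⊢
        omega
    have h1 := key (List.finRange r)
    have h2 := sz_nat_le_encNat i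
    have h3 : sz false = 1 := rfl
    simp only [← List.ofFn_eq_map] at h1
    simp only [DTree.tokens, DTree.enc, sz_cons, sz_prod, List.length_cons, List.length_append, h3,
      List.length_nil]
    omega

/-- Each component is linear in its part of the code; the table of `S` is bounded by the list of
domain sizes, which has one entry per feature. -/
lemma sz_cert_le (I : Input) (k : ℕ) (S : Finset (Fin I.m)) :
    sz (cert I k S) ≤ 20 * (encQuery I k).length := by
  have h1 := sz_bits_le (table S)
  have h2 := sz_nats_le (List.ofFn I.d)
  have h3 := length_le_flatMap_encNat (List.ofFn I.d)
  have h4 := sz_nat_le_encNat I.K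
  have h5 := sz_tokens_le I.tree
  have h6 := sz_nats_le (List.ofFn fun i => (I.v i : ℕ))
  have h7 := sz_nat_le_encNat I.c
  have h8 := sz_nat_le_encNat I.num
  have h9 := sz_nat_le_encNat I.den
  have h10 := sz_nat_le_encNat k
  have h11 : (table S).length = I.m := by simp [table]
  rw [List.length_ofFn] at h3
  rw [← certCode_eq]
  simp only [cert, certCode, sz_prod, List.length_append]
  omega

/-! ### Membership in NP -/

lemma flatMap_nil_eq {A B : Type*} (l : List A) : (l.flatMap fun _ => ([] : List B)) = [] := by
  simp [List.flatMap_eq_nil_iff]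

lemma poly_inl {A B : Type} [Enc A] [Enc B] [Fintype A] [Fintype B] [Inhabited A] [Inhabited B] :
    Poly fun l : List (A ⊕ B) => l.flatMap fun x => x.elim (fun a => [a]) fun _ => [] := by
  have : Poly fun x : A ⊕ B => x.elim (fun a => [a]) fun _ => [] := Poly.of_finite _
  fun_prop

lemma poly_inr {A B : Type} [Enc A] [Enc B] [Fintype A] [Fintype B] [Inhabited A] [Inhabited B] :
    Poly fun l : List (A ⊕ B) => l.flatMap fun x => x.elim (fun _ => []) fun b => [b] := by
  have : Poly fun x : A ⊕ B => x.elim (fun _ => []) fun b => [b] := Poly.of_finite _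
  fun_prop

lemma computable_verify (b : Bool) : Nonempty (Turing.TM2ComputableInPolyTime
    (encodingProd (encodingList Sym) (encodingList Bool)).encode encodeBool
    fun p : List Sym × List Bool => verify b p.1 (decodeBits Cert p.2)) := by
  have h := (poly_verify b).comp ((poly_inl (A := Sym) (B := Bool)).prodMk
    ((poly_inr (A := Sym) (B := Bool)).decodeBits (β := Cert)))
  refine h.computable_bool _ _ fun p => ?_
  simp [encodingProd, encodingList, List.flatMap_append, List.flatMap_map, flatMap_nil_eq]

/-- The verifier for the existence of a relevant set of bounded size. -/
noncomputable def verifier (b : Bool) : NPVerifier Sym where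
  check p := verify b p.1 (decodeBits Cert p.2)
  bound := 20 * .X
  polyTime := computable_verify b

lemma verifier_accepts {b : Bool} {x : List Sym} {w : List Bool}
    (h : (verifier b).Accepts x w) : ∃ (I : Input) (k : ℕ) (S : Finset (Fin I.m)),
      x = encQuery I k ∧ (b = true → I.Boolean) ∧ (decodeBits Cert w).1 = table S ∧
      S.card ≤ k ∧ I.Relevant S :=
  exists_of_verify h.2

lemma exists_verifier_accepts (b : Bool) (I : Input) (k : ℕ) (S : Finset (Fin I.m))
    (hb : b = true → I.Boolean) (hS : S.card ≤ k) (h : I.Relevant S) :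
    ∃ w, (verifier b).Accepts (encQuery I k) w := by
  refine ⟨encodeBits (cert I k S), ?_, ?_⟩
  · have := sz_cert_le I k S
    simpa [verifier, length_encodeBits] using this
  · have := verify_cert b I k S hb hS h
    simpa [verifier, decodeBits_encodeBits] using this

theorem inNP_deltaProblem : InNP deltaProblem := by
  refine ⟨verifier true, fun x => ⟨?_, ?_⟩⟩
  · rintro ⟨I, k, rfl, hI, S, hS, h⟩
    exact exists_verifier_accepts true I k S (fun _ => hI) hS h
  · rintro ⟨w, hw⟩
    obtain ⟨I, k, S, rfl, hI, -, hS, h⟩ := verifier_accepts hw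
    exact ⟨I, k, rfl, hI rfl, S, hS, h⟩

lemma mem_cDeltaProblem_iff (x : List Sym) :
    x ∈ cDeltaProblem ↔ ∃ w, (verifier false).Accepts x w := by
  constructor
  · rintro ⟨I, k, rfl, S, hS, h⟩
    exact exists_verifier_accepts false I k S (by simp) hS h
  · rintro ⟨w, hw⟩
    obtain ⟨I, k, S, rfl, -, -, hS, h⟩ := verifier_accepts hw
    exact ⟨I, k, rfl, S, hS, h⟩

theorem inNP_cDeltaProblem : InNP cDeltaProblem := ⟨verifier false, mem_cDeltaProblem_iff⟩

/-- Relevance need not pass to supersets, but this is not used: below any relevant finite set there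
is a minimal one, and it is no larger. -/
lemma minCDeltaProblem_eq : minCDeltaProblem = cDeltaProblem := by
  ext x
  constructor
  · rintro ⟨I, k, rfl, S, hS, h⟩
    exact ⟨I, k, rfl, S, hS, h.prop⟩
  · rintro ⟨I, k, rfl, S, hS, h⟩
    obtain ⟨S', hle, hS'⟩ := exists_minimal_le_of_wellFoundedLT I.Relevant S h
    exact ⟨I, k, rfl, S', (Finset.card_le_card hle).trans hS, hS'⟩

theorem inNP_minCDeltaProblem : InNP minCDeltaProblem :=
  minCDeltaProblem_eq ▸ inNP_cDeltaProblem

end DTRelevance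

/-! ### Unique decodability, binary search, and the two oracle algorithms. -/

namespace DTRelevance

open PolyTM Computability

/-! ### The code of a query determines the query -/

lemma map_bit_append_comma_inj {a a' : List Bool} {l l' : List Sym}
    (h : a.map Γ'.bit ++ .comma :: l = a'.map Γ'.bit ++ .comma :: l') : a = a' ∧ l = l' := by
  induction a generalizing a' with
  | nil => cases a' <;> simp_all
  | cons b a ih =>
    cases a' with
    | nil => simp at h
    | cons b' a' =>
      simp only [List.map_cons, List.cons_append, List.cons.injEq, Γ'.bit.injEq] at h
      obtain ⟨rfl, rfl⟩ := ih h.2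
      exact ⟨by rw [h.1], rfl⟩

lemma map_bit_injective : Function.Injective (List.map Γ'.bit) :=
  List.map_injective_iff.2 fun _ _ h => by simpa using h

lemma encNat_append_inj {n n' : ℕ} {l l' : List Sym} (h : encNat n ++ l = encNat n' ++ l') :
    n = n' ∧ l = l' := by
  rw [encNat_eq, encNat_eq, List.append_assoc, List.append_assoc, List.singleton_append,
    List.singleton_append] at h
  obtain ⟨h1, h2⟩ := map_bit_append_comma_inj h
  exact ⟨bits_injective h1, h2⟩

lemma encNats_append_inj {n : ℕ} {f f' : Fin n → ℕ} {l l' : List Sym}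
    (h : encNats f ++ l = encNats f' ++ l') : f = f' ∧ l = l' := by
  have key : ∀ is : List (Fin n), (is.map fun i => encNat (f i)).flatten ++ l =
      (is.map fun i => encNat (f' i)).flatten ++ l' → (∀ i ∈ is, f i = f' i) ∧ l = l' := by
    intro is
    induction is with
    | nil => simp
    | cons i is ih =>
      intro h
      simp only [List.map_cons, List.flatten_cons, List.append_assoc] at h
      obtain ⟨h1, h2⟩ := encNat_append_inj h
      exact ⟨List.forall_mem_cons.2 ⟨h1, (ih h2).1⟩, (ih h2).2⟩
  obtain ⟨h1, h2⟩ := key (List.finRange n) (by simpa only [encNats, List.ofFn_eq_map] using h)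
  exact ⟨funext fun i => h1 i (List.mem_finRange i), h2⟩

lemma encSet_append_inj {n : ℕ} {S S' : Finset (Fin n)} {l l' : List Sym}
    (h : encSet S ++ l = encSet S' ++ l') : S = S' ∧ l = l' := by
  obtain ⟨h1, h2⟩ := List.append_inj h (by simp [encSet])
  rw [encSet_eq, encSet_eq] at h1
  exact ⟨table_injective (map_bit_injective h1), h2⟩

variable {m : ℕ} {d : Fin m → ℕ} {K : ℕ}

/-- The first symbol separates leaves from inner nodes; the number of edges is read before the
edges, and the lengths of the tables are known from the feature. -/
lemma DTree.enc_append_inj (T : DTree d K) : ∀ (T' : DTree d K) {l l' : List Sym},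
    T.enc ++ l = T'.enc ++ l' → T = T' ∧ l = l' := by
  induction T with
  | leaf c =>
    intro T' l l' h
    cases T' with
    | leaf c' =>
      obtain ⟨h1, h2⟩ := encNat_append_inj (List.cons.inj h).2
      exact ⟨by rw [Fin.ext h1], h2⟩
    | node => simp [enc] at h
  | node i r label child ih =>
    intro T' l l' h
    cases T' with
    | leaf c' => simp [enc] at h
    | node i' r' label' child' =>
      simp only [enc, List.cons_append, List.append_assoc, List.cons.injEq, true_and] at h
      obtain ⟨h1, h⟩ := encNat_append_inj h
      obtain ⟨rfl, h⟩ := encNat_append_inj h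
      obtain rfl := Fin.ext h1
      have key : ∀ (js : List (Fin r)) {l l' : List Sym},
          (js.map fun j => encSet (label j) ++ (child j).enc).flatten ++ l =
            (js.map fun j => encSet (label' j) ++ (child' j).enc).flatten ++ l' →
          (∀ j ∈ js, label j = label' j ∧ child j = child' j) ∧ l = l' := by
        intro js
        induction js with
        | nil => simp
        | cons j js ihj =>
          intro l l' h
          simp only [List.map_cons, List.flatten_cons, List.append_assoc] at h
          obtain ⟨h1, h⟩ := encSet_append_inj h
          obtain ⟨h2, h⟩ := ih j _ h
          exact ⟨List.forall_mem_cons.2 ⟨⟨h1, h2⟩, (ihj h).1⟩, (ihj h).2⟩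
      obtain ⟨h1, h2⟩ := key (List.finRange r) (by simpa only [List.ofFn_eq_map] using h)
      obtain rfl : label = label' := funext fun j => (h1 j (List.mem_finRange j)).1
      obtain rfl : child = child' := funext fun j => (h1 j (List.mem_finRange j)).2
      exact ⟨rfl, (List.cons.inj h2).2⟩

/-- Membership of a word, or an accepted certificate, only speaks of some input with that code.
Injectivity is what lets the oracle's answers be read as statements about the given input. -/
lemma encQuery_inj {I I' : Input} {k k' : ℕ} (h : encQuery I k = encQuery I' k') :
    I = I' ∧ k = k' := by
  obtain ⟨m, d, K, T, hT, v, c, hv, num, den, h1, h2⟩ := I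
  obtain ⟨m', d', K', T', hT', v', c', hv', num', den', h1', h2'⟩ := I'
  simp only [encQuery, Input.enc, List.append_assoc] at h
  obtain ⟨rfl, a1⟩ := encNat_append_inj h
  obtain ⟨rfl, a2⟩ := encNats_append_inj a1
  obtain ⟨rfl, a3⟩ := encNat_append_inj a2
  obtain ⟨rfl, a4⟩ := T.enc_append_inj _ a3
  obtain ⟨hv, a5⟩ := encNats_append_inj a4
  obtain ⟨hc, a6⟩ := encNat_append_inj a5
  obtain ⟨rfl, a7⟩ := encNat_append_inj a6
  obtain ⟨rfl, a8⟩ := encNat_append_inj a7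
  obtain ⟨rfl, -⟩ := encNat_append_inj (l := []) (l' := []) (by simpa using a8)
  obtain rfl : v = v' := funext fun i => Fin.ext (congrFun hv i)
  obtain rfl := Fin.ext hc
  exact ⟨rfl, rfl⟩

/-! ### The smallest size of a relevant set -/

/-- With all features fixed only `v` remains, so the probability is one and `δ ≤ 1` suffices. -/
lemma relevant_univ (I : Input) : I.Relevant Finset.univ := by
  classical
  rw [Input.Relevant, IsRelevant, Input.δ, condProb_ge_iff _ _ ⟨I.v, fun _ _ => rfl⟩ I.den_pos]
  have : ∀ x : Point I.d, (∀ i ∈ Finset.univ, x i = I.v i) →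
      I.tree.classify I.proper x = I.c := by
    intro x hx
    rw [← I.classify_v]
    congr 1
    exact funext fun i => hx i (Finset.mem_univ i)
  simp only [and_iff_right_of_imp (this _)]
  exact Nat.mul_le_mul_right _ I.num_le_den

/-- The smallest size of a relevant set. -/
lemma exists_isLeast (I : Input) :
    ∃ k ≤ I.m, IsLeast {k | ∃ S : Finset (Fin I.m), S.card ≤ k ∧ I.Relevant S} k := by
  classical
  have h : ∃ k, ∃ S : Finset (Fin I.m), S.card ≤ k ∧ I.Relevant S :=
    ⟨I.m, Finset.univ, by simp, relevant_univ I⟩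
  exact ⟨Nat.find h, Nat.find_min' h ⟨Finset.univ, by simp, relevant_univ I⟩, Nat.find_spec h,
    fun k hk => Nat.find_min' h hk⟩

lemma encQuery_mem_cDeltaProblem_iff {I : Input} {n : ℕ}
    (hn : IsLeast {k | ∃ S : Finset (Fin I.m), S.card ≤ k ∧ I.Relevant S} n) (k : ℕ) :
    encQuery I k ∈ cDeltaProblem ↔ n ≤ k := by
  constructor
  · rintro ⟨I', k', h, hS⟩
    obtain ⟨rfl, rfl⟩ := encQuery_inj h
    exact hn.2 hS
  · intro h
    obtain ⟨S, hS, hr⟩ := hn.1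
    exact ⟨I, k, rfl, S, hS.trans h, hr⟩

/-! ### Binary search -/

/-- The part of a word that precedes the first comma. -/
def firstPart (x : List Sym) : List Sym := x.takeWhile fun s => !decide (s = .comma)

/-- A step of the binary search, the answers being listed in reverse order: the binary digits of
the smallest size of a relevant set are determined from the most significant one downwards; there
are as many of them as there are digits of the number of features. -/
def search (x : List Sym) (a : List Bool) (out : List Sym) : Bool × List Sym :=
  bif ((firstPart x).drop a.length).isEmpty then (true, out)
  else (false, x ++ encNat (ofBits ((((firstPart x).drop a.length).tail.map fun _ => true) ++
    false :: a.map fun b => !b)))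

section

variable {α : Type} [Enc α]

@[fun_prop]
lemma poly_firstPart {x : α → List Sym} (hx : Poly x) : Poly fun a => firstPart (x a) := by
  -- Scanning from the right and starting afresh at each comma leaves the part before the first
  -- comma.
  have : Poly fun a => (x a).reverse.foldl
      (fun (l : List Sym) s => bif !decide (s = .comma) then s :: l else []) [] := by
    refine Poly.foldl (by fun_prop) (by fun_prop) (by fun_prop) (1 + .X) fun s l a => ?_
    have := sz_pos l
    cases decide (a = Γ'.comma) <;> simp <;> omega
  convert this using 2 with a
  rw [List.foldl_reverse, firstPart]
  induction x a with
  | nil => rfl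
  | cons s l ih =>
    rw [List.takeWhile_cons, List.foldr_cons, ih]
    cases decide (s = Γ'.comma) <;> rfl

@[fun_prop]
lemma poly_search {x out : α → List Sym} {a : α → List Bool} (hx : Poly x) (ha : Poly a)
    (ho : Poly out) : Poly fun p => search (x p) (a p) (out p) := by
  unfold search
  fun_prop

end

/-- Input and answers arrive in one word over a tagged alphabet and are separated by their tags. -/
lemma polyTimeStep_of_poly {A : Type} {encA : A → List Sym}
    {step : List Sym × List A → Bool × List Sym} {F : List Sym × List Sym → Bool × List Sym}
    (hF : Poly F) (h : ∀ p, step p = F (p.1, p.2.flatMap encA)) : PolyTimeStep encA step := by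
  have h1 := hF.comp ((poly_inl (A := Sym) (B := Sym)).prodMk (poly_inr (A := Sym) (B := Sym)))
  have h2 : Poly fun l : List (Sym ⊕ Sym) => (Γ'.bit (F (
      l.flatMap fun x => x.elim (fun a => [a]) fun _ => [],
      l.flatMap fun x => x.elim (fun _ => []) fun b => [b])).1 :: (F (
      l.flatMap fun x => x.elim (fun a => [a]) fun _ => [],
      l.flatMap fun x => x.elim (fun _ => []) fun b => [b])).2) :=
    (poly_bit h1.fst).cons h1.snd
  refine h2.computable_sym _ _ _ fun p => ?_
  rw [h]
  simp [List.flatMap_append, List.flatMap_map, flatMap_nil_eq]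

lemma clog_eq_size (n : ℕ) : Nat.clog 2 (n + 1) = n.size :=
  eq_of_forall_ge_iff fun c => by
    rw [Nat.clog_le_iff_le_pow Nat.one_lt_two, Nat.size_le, Nat.succ_le_iff]

lemma firstPart_enc (I : Input) : firstPart I.enc = I.m.bits.map Γ'.bit := by
  simp only [firstPart, Input.enc, encNat_eq, List.append_assoc]
  rw [List.takeWhile_append_of_pos
    (by rintro _ h; obtain ⟨b, -, rfl⟩ := List.mem_map.1 h; rfl)]
  simp

lemma length_firstPart (I : Input) : (firstPart I.enc).length = I.m.size := by
  rw [firstPart_enc, List.length_map, Nat.size_eq_bits_len]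

lemma ofBits_replicate_true (n : ℕ) : ofBits (List.replicate n true) + 1 = 2 ^ n := by
  induction n with
  | zero => rfl
  | succ n ih =>
    rw [List.replicate_succ, ofBits, Nat.bit_val, pow_succ, ← ih]
    simp only [Bool.toNat_true]
    omega

/-- Invariant with `n` queries left: the negated answers are the digits of `N / 2 ^ n`. The
predicate `J` transports information from the answers: its second argument is the largest number
still possible, i.e. the known digits followed by ones; it becomes `k` after a positive answer,
stays unchanged after a negative one, and ends as `N`. This one lemma serves both kinds of oracle.
-/
lemma oracleRun_search {A : Type} (I : Input) (O : List Sym → A) (yes : A → Bool)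
    (fl : List A → List Bool) (out : List Sym → List A → List Sym)
    {step : List Sym × List A → Bool × List Sym}
    (hstep : ∀ x t, step (x, t) = search x (fl t) (out x t)) (hnil : fl [] = [])
    (hfl : ∀ t a, fl (t ++ [a]) = yes a :: fl t) {N : ℕ} (hN : N ≤ I.m)
    (hO : ∀ k, yes (O (encQuery I k)) = true ↔ N ≤ k) (J : List A → ℕ → Prop)
    (hJ : J [] (2 ^ I.m.size - 1))
    (hyes : ∀ t k, yes (O (encQuery I k)) = true → J (t ++ [O (encQuery I k)]) k)
    (hno : ∀ t u k, yes (O (encQuery I k)) = false → J t u → J (t ++ [O (encQuery I k)]) u) :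
    ∃ t, oracleRun step O (2 * I.enc.length + 2) I.enc (Nat.clog 2 (I.m + 1)) [] =
      some (out I.enc t) ∧ ofBits ((fl t).map fun b => !b) = N ∧ J t N := by
  have key : ∀ n s, n + (fl s).length = I.m.size →
      ofBits ((fl s).map fun b => !b) = N / 2 ^ n →
      J s (2 ^ n * (N / 2 ^ n) + 2 ^ n - 1) →
      ∃ t, oracleRun step O (2 * I.enc.length + 2) I.enc n s = some (out I.enc t) ∧
        ofBits ((fl t).map fun b => !b) = N ∧ J t N := by
    intro n
    induction n with
    | zero =>
      intro t h1 h2 h3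
      have h4 : (firstPart I.enc).drop (fl t).length = [] := by
        rw [List.drop_eq_nil_iff, length_firstPart]
        omega
      refine ⟨t, ?_, by simpa using h2, by simpa using h3⟩
      simp [oracleRun, hstep, search, h4]
    | succ n ih =>
      intro t h1 h2 h3
      -- Low digits first: `n` ones, the digit zero on trial, then the digits known so far. This is
      -- the largest number with these leading digits, so `N ≤ k` iff the next digit of `N` is zero.
      let k := ofBits (List.replicate n true ++ false :: (fl t).map fun b => !b)
      have hk : k + 1 = 2 ^ n * (2 * (N / 2 ^ (n + 1)) + 1) := by
        have := ofBits_replicate_true n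
        simp only [k, ofBits_append, List.length_replicate, ofBits, h2, Nat.bit_val,
          Bool.toNat_false, ← this]
        ring
      have hs : step (I.enc, t) = (false, encQuery I k) := by
        have h4 : ((firstPart I.enc).drop (fl t).length).length = n + 1 := by
          rw [List.length_drop, length_firstPart]
          omega
        obtain ⟨s, l, hl⟩ := List.exists_cons_of_length_eq_add_one h4
        have h5 : l.length = n := by simpa [hl] using h4
        simp [hstep, search, hl, k, h5, encQuery, List.map_const']
      -- `k` has at most as many digits as the number of features, and those digits occur at the
      -- beginning of the code.
      have hq : (encQuery I k).length ≤ 2 * I.enc.length + 2 := by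
        have h4 : k.size ≤ I.m.size := by
          rw [Nat.size_le]
          have h5 := ofBits_lt (List.replicate n true ++ false :: (fl t).map fun b => !b)
          have h6 : (List.replicate n true ++ false :: (fl t).map fun b => !b).length =
              I.m.size := by simp; omega
          rwa [h6] at h5
        have h5 : I.m.size ≤ I.enc.length := by
          rw [← length_firstPart]
          exact (List.takeWhile_sublist _).length_le
        rw [encQuery, List.length_append, length_encNat]
        omega
      have hrun : oracleRun step O (2 * I.enc.length + 2) I.enc (n + 1) t =
          oracleRun step O (2 * I.enc.length + 2) I.enc n (t ++ [O (encQuery I k)]) := by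
        rw [oracleRun, hs]
        simp [hq]
      have hdiv : N / 2 ^ (n + 1) = N / 2 ^ n / 2 := by
        rw [pow_succ, Nat.div_div_eq_div_mul]
      have hiff : N ≤ k ↔ N / 2 ^ n < 2 * (N / 2 ^ (n + 1)) + 1 := by
        rw [Nat.div_lt_iff_lt_mul (by positivity), mul_comm _ (2 ^ n), ← hk, Nat.lt_succ_iff]
      rw [hrun]
      cases hy : yes (O (encQuery I k)) with
      | true =>
        have h4 := hiff.1 ((hO k).1 hy)
        have h5 : N / 2 ^ n = 2 * (N / 2 ^ (n + 1)) := by omega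
        refine ih _ ?_ ?_ ?_
        · rw [hfl, List.length_cons]
          omega
        · rw [hfl, hy, List.map_cons, ofBits, h2, h5, Nat.bit_val]
          rfl
        · have h6 : 2 ^ n * (N / 2 ^ n) + 2 ^ n - 1 = k := by
            rw [h5]
            rw [Nat.mul_add, Nat.mul_one] at hk
            omega
          rw [h6]
          exact hyes t k hy
      | false =>
        have h4 : ¬ N ≤ k := by
          rw [← hO k, hy]
          simp
        rw [hiff] at h4
        have h5 : N / 2 ^ n = 2 * (N / 2 ^ (n + 1)) + 1 := by omega
        refine ih _ ?_ ?_ ?_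
        · rw [hfl, List.length_cons]
          omega
        · rw [hfl, hy, List.map_cons, ofBits, h2, h5, Nat.bit_val]
          rfl
        · have h6 : 2 ^ n * (N / 2 ^ n) + 2 ^ n - 1 =
              2 ^ (n + 1) * (N / 2 ^ (n + 1)) + 2 ^ (n + 1) - 1 := by
            rw [h5, pow_succ]
            congr 1
            ring
          rw [h6]
          exact hno t _ k hy h3
  have hlt : N < 2 ^ I.m.size := hN.trans_lt I.m.lt_size_self
  rw [clog_eq_size]
  refine key I.m.size [] (by simp [hnil]) ?_ ?_
  · rw [hnil, Nat.div_eq_of_lt hlt]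
    rfl
  · rw [Nat.div_eq_of_lt hlt]
    simpa using hJ

/-! ### The smallest size with an oracle for a language in NP -/

/-- The step of the algorithm that determines the smallest size of a relevant set. -/
def sizeStep (p : List Sym × List Bool) : Bool × List Sym :=
  search p.1 p.2.reverse (encNat (ofBits (p.2.reverse.map fun b => !b)))

lemma polyTimeStep_sizeStep : PolyTimeStep (fun b => [.bit b]) sizeStep := by
  have h : Poly fun p : List Sym × List Sym => search p.1
      (p.2.map fun s => decide (s = Γ'.bit true)).reverse
      (encNat (ofBits ((p.2.map fun s => decide (s = Γ'.bit true)).reverse.map fun b => !b))) := by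
    fun_prop
  refine polyTimeStep_of_poly h fun p => ?_
  have : (p.2.flatMap fun b => [Γ'.bit b]).map (fun s => decide (s = Γ'.bit true)) = p.2 := by
    rw [List.map_flatMap]
    induction p.2 with
    | nil => rfl
    | cons b l ih => cases b <;> simp
  simp only [sizeStep, this]

lemma exists_oracleRun_sizeStep (I : Input) (O : List Sym → Bool)
    (hO : ∀ q, O q = true ↔ q ∈ cDeltaProblem) : ∃ y,
    oracleRun sizeStep O (2 * I.enc.length + 2) I.enc (Nat.clog 2 (I.m + 1)) [] = some y ∧
      IsMinSize I y := by
  obtain ⟨N, hN, hl⟩ := exists_isLeast I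
  obtain ⟨t, h1, h2, -⟩ := oracleRun_search I O (fun b => b) List.reverse
    (fun _ t => encNat (ofBits (t.reverse.map fun b => !b))) (step := sizeStep)
    (fun _ _ => rfl) rfl (fun t a => by simp) hN
    (fun k => by rw [hO, encQuery_mem_cDeltaProblem_iff hl])
    (fun _ _ => True) trivial (fun _ _ _ => trivial) (fun _ _ _ _ _ => trivial)
  rw [h2] at h1
  exact ⟨_, h1, N, rfl, hl⟩

theorem solvable_minSize {α : Type} (f : α → Input) :
    SolvableWithNPCalls (fun a => (f a).enc) (fun a => IsMinSize (f a))
      (fun a => Nat.clog 2 ((f a).m + 1)) := by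
  refine ⟨cDeltaProblem, inNP_cDeltaProblem, sizeStep, 2 * .X + 2, polyTimeStep_sizeStep,
    fun O hO a => ?_⟩
  simpa using exists_oracleRun_sizeStep (f a) O hO

/-! ### A smallest relevant set with an oracle that returns certificates -/

/-- The code of the answer of an oracle that returns certificates. -/
def encAnswer (a : Option (List Bool)) : List Sym :=
  match a with
  | none => [.comma]
  | some w => .bra :: w.map .bit ++ [.ket]

/-- Reading of a symbol of a list of answers; the state consists of the list of answers read so
far, the word being read, and the last certificate, all of them reversed. -/
def answerStep (st : List Bool × List Bool × List Bool) (s : Sym) :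
    List Bool × List Bool × List Bool :=
  bif decide (s = .comma) then (false :: st.1, st.2)
  else bif decide (s = .bra) then (st.1, [], st.2.2)
  else bif decide (s = .ket) then (true :: st.1, [], st.2.1)
  else (st.1, decide (s = .bit true) :: st.2.1, st.2.2)

/-- Reading of a list of answers. -/
def readAnswers (l : List Sym) : List Bool × List Bool × List Bool :=
  l.foldl answerStep ([], [], [])

lemma poly_answerStep : Poly fun p : (List Bool × List Bool × List Bool) × Sym =>
    answerStep p.1 p.2 := by
  unfold answerStep
  fun_prop

@[fun_prop]
lemma poly_readAnswers {α : Type} [Enc α] {f : α → List Sym} (hf : Poly f) :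
    Poly fun x => readAnswers (f x) := by
  refine Poly.foldl (f := fun _ => answerStep) hf (PolyTM.Poly.const _)
    (poly_answerStep.comp (g := fun p : α × (List Bool × List Bool × List Bool) × Sym =>
      (p.2.1, p.2.2)) (by fun_prop)) 6 fun _ st s => ?_
  have h1 : ∀ b : Bool, sz b ≤ 3 := by rintro (_ | _) <;> decide
  have h2 := h1 (decide (s = Γ'.bit true))
  have h3 := h1 true
  have h4 := h1 false
  have h5 := sz_pos st.2.1
  have h6 := sz_pos st.2.2
  unfold answerStep
  cases decide (s = Γ'.comma) <;> cases decide (s = Γ'.bra) <;> cases decide (s = Γ'.ket) <;>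
    simp only [cond_true, cond_false, sz_prod, sz_cons, sz_nil, Polynomial.eval_ofNat] <;> omega

/-- The reversed list of the answers and the reversed last certificate. -/
def lastAnswers (t : List (Option (List Bool))) : List Bool × List Bool × List Bool :=
  readAnswers (t.flatMap encAnswer)

lemma foldl_answerStep_bits (w c : List Bool) (f l : List Bool) :
    (w.map Γ'.bit).foldl answerStep (f, c, l) = (f, w.reverse ++ c, l) := by
  induction w generalizing c with
  | nil => rfl
  | cons b w ih => cases b <;> simp [answerStep, ih]

lemma lastAnswers_none (t : List (Option (List Bool))) :
    lastAnswers (t ++ [none]) = (false :: (lastAnswers t).1, (lastAnswers t).2) := by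
  simp [lastAnswers, readAnswers, encAnswer, answerStep]

/-- A new certificate replaces the previous one at its closing bracket, whereas a negative answer
leaves the stored one in place; the last certificate obtained is thus always at hand. -/
lemma lastAnswers_some (t : List (Option (List Bool))) (w : List Bool) :
    lastAnswers (t ++ [some w]) = (true :: (lastAnswers t).1, [], w.reverse) := by
  simp only [lastAnswers, readAnswers, List.flatMap_append, List.foldl_append]
  generalize (t.flatMap encAnswer).foldl answerStep ([], [], []) = st
  have h1 : answerStep st .bra = (st.1, [], st.2.2) := rfl
  have h2 : answerStep (st.1, w.reverse, st.2.2) .ket = (true :: st.1, [], w.reverse) := rfl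
  simp [encAnswer, h1, h2, foldl_answerStep_bits]

/-- As many ones as there are features. -/
def allFeatures (x : List Sym) : List Sym :=
  x.foldl (fun l _ => bif decide (l.length <
    ofBits ((firstPart x).map fun s => decide (s = .bit true))) then .bit true :: l else l) []

@[fun_prop]
lemma poly_allFeatures {α : Type} [Enc α] {f : α → List Sym} (hf : Poly f) :
    Poly fun x => allFeatures (f x) := by
  have h : Poly fun x : List Sym => allFeatures x := by
    unfold allFeatures
    refine Poly.foldl (by fun_prop) (by fun_prop) (by fun_prop)
      (Polynomial.C (1 + sz (Γ'.bit true))) fun x l s => ?_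
    cases decide (l.length < ofBits ((firstPart x).map fun s => decide (s = .bit true)))
    · simp
    · simp only [cond_true, sz_cons, Polynomial.eval_C]
      omega
  exact h.comp hf

/-- The set in a certificate. -/
def certSet (w : List Bool) : List Bool := (decodeBits Cert w).1

@[fun_prop]
lemma poly_certSet {α : Type} [Enc α] {f : α → List Bool} (hf : Poly f) :
    Poly fun x => certSet (f x) :=
  (hf.decodeBits (β := Cert)).fst

/-- The output of the algorithm that determines a smallest relevant set. -/
def setOutput (x : List Sym) (st : List Bool × List Bool × List Bool) : List Sym :=
  bif st.1.any fun b => b then (certSet st.2.2.reverse).map .bit else allFeatures x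

/-- The step of the algorithm that determines a smallest relevant set. -/
def setStep (p : List Sym × List (Option (List Bool))) : Bool × List Sym :=
  search p.1 (lastAnswers p.2).1 (setOutput p.1 (lastAnswers p.2))

lemma polyTimeStep_setStep : PolyTimeStep encAnswer setStep := by
  have h : Poly fun p : List Sym × List Sym =>
      search p.1 (readAnswers p.2).1 (setOutput p.1 (readAnswers p.2)) := by
    unfold setOutput
    fun_prop
  exact polyTimeStep_of_poly h fun p => rfl

lemma allFeatures_enc (I : Input) : allFeatures I.enc = encSet (Finset.univ : Finset (Fin I.m)) := by
  have h1 : ofBits ((firstPart I.enc).map fun s => decide (s = .bit true)) = I.m := by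
    rw [firstPart_enc, List.map_map]
    convert ofBits_bits I.m using 2
    conv_rhs => rw [← List.map_id I.m.bits]
    exact List.map_congr_left fun b _ => by cases b <;> rfl
  have key : ∀ (x : List Sym) (n : ℕ), n ≤ I.m →
      x.foldl (fun l _ => bif decide (l.length < I.m) then Γ'.bit true :: l else l)
        (List.replicate n (.bit true)) = List.replicate (min I.m (n + x.length)) (.bit true) := by
    intro x
    induction x with
    | nil => intro n h; simp [h]
    | cons s x ih =>
      intro n h
      rw [List.foldl_cons, List.length_replicate]
      by_cases h2 : n < I.m
      · rw [decide_eq_true h2, cond_true, ← List.replicate_succ, ih (n + 1) h2]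
        congr 2
        rw [List.length_cons]
        omega
      · rw [decide_eq_false h2, cond_false, ih n h]
        congr 1
        rw [List.length_cons]
        omega
  -- The code lists one domain size per feature, so a fold over the input has enough rounds to write
  -- `m` symbols although `m` is given in binary.
  have h2 : I.m ≤ I.enc.length := by
    have := length_le_flatMap_encNat (List.ofFn I.d)
    rw [List.length_ofFn, List.flatMap_def, List.map_ofFn] at this
    simp only [Input.enc, List.length_append, encNats]
    exact this.trans (by simp only [Function.comp_def]; omega)
  rw [allFeatures, h1]
  refine (key I.enc 0 (Nat.zero_le _)).trans ?_
  simp [encSet, h2, List.ofFn_const]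

lemma exists_oracleRun_setStep (I : Input) (O : List Sym → Option (List Bool))
    (hO : ∀ q, (∀ w, O q = some w → (verifier false).Accepts q w) ∧
      (O q = none → ∀ w, ¬ (verifier false).Accepts q w)) : ∃ y,
    oracleRun setStep O (2 * I.enc.length + 2) I.enc (Nat.clog 2 (I.m + 1)) [] = some y ∧
      IsMinSet I y := by
  obtain ⟨N, hN, hl⟩ := exists_isLeast I
  have hO' : ∀ q, (O q).isSome = true ↔ q ∈ cDeltaProblem := by
    intro q
    rw [mem_cDeltaProblem_iff]
    cases h : O q with
    | none => simpa using (hO q).2 h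
    | some w => simpa using ⟨w, (hO q).1 w h⟩
  have hsome : ∀ k w, O (encQuery I k) = some w →
      ∃ S : Finset (Fin I.m), certSet w = table S ∧ S.card ≤ k ∧ I.Relevant S := by
    intro k w h
    obtain ⟨I', k', S, h1, -, h2⟩ := verifier_accepts ((hO _).1 w h)
    obtain ⟨rfl, rfl⟩ := encQuery_inj h1
    exact ⟨S, h2⟩
  obtain ⟨t, h1, -, h2⟩ := oracleRun_search I O Option.isSome (fun t => (lastAnswers t).1)
    (fun x t => setOutput x (lastAnswers t)) (step := setStep) (fun _ _ => rfl) rfl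
    (fun t a => by cases a <;> simp [lastAnswers_none, lastAnswers_some]) hN
    (fun k => by rw [hO', encQuery_mem_cDeltaProblem_iff hl])
    -- Either no certificate has been seen and the upper bound is the initial one, or the stored
    -- certificate contains a relevant set whose size is within the current bound.
    (fun t u => ((lastAnswers t).1.any (fun b => b) = false ∧ u = 2 ^ I.m.size - 1) ∨
      ((lastAnswers t).1.any (fun b => b) = true ∧ ∃ S : Finset (Fin I.m),
        certSet (lastAnswers t).2.2.reverse = table S ∧ S.card ≤ u ∧ I.Relevant S))
    (.inl ⟨rfl, rfl⟩)
    (fun t k h => by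
      obtain ⟨w, hw⟩ := Option.isSome_iff_exists.1 h
      rw [hw, lastAnswers_some]
      exact .inr ⟨rfl, by simpa using hsome k w hw⟩)
    (fun t u k h hu => by
      rw [Option.isSome_eq_false_iff, Option.isNone_iff_eq_none] at h
      rw [h, lastAnswers_none]
      exact hu)
  refine ⟨_, h1, ?_⟩
  have hmin : ∀ S' : Finset (Fin I.m), I.Relevant S' → N ≤ S'.card :=
    fun S' h => hl.2 ⟨S', le_rfl, h⟩
  rcases h2 with ⟨h2, h3⟩ | ⟨h2, S, h3, h4, h5⟩
  -- All answers were negative, so `N = 2 ^ I.m.size - 1 ≥ m`: the full set is smallest, and no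
  -- extra query is needed to obtain a certificate for it.
  · refine ⟨Finset.univ, ?_, relevant_univ I, fun S' h => ?_⟩
    · rw [setOutput, h2, cond_false, allFeatures_enc]
    · have := hmin S' h
      have := I.m.lt_size_self
      rw [Finset.card_univ, Fintype.card_fin]
      omega
  · refine ⟨S, ?_, h5, fun S' h => h4.trans (hmin S' h)⟩
    rw [setOutput, h2, cond_true, h3, encSet_eq]

theorem solvable_minSet {α : Type} (f : α → Input) :
    SolvableWithNPWitnessCalls (fun a => (f a).enc) (fun a => IsMinSet (f a))
      (fun a => Nat.clog 2 ((f a).m + 1)) := by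
  refine ⟨verifier false, setStep, 2 * .X + 2, polyTimeStep_setStep, fun O hO a => ?_⟩
  simpa using exists_oracleRun_setStep (f a) O hO

end DTRelevance

/-- The boolean claims about oracle calls are the general algorithms restricted along the inclusion
of boolean inputs; only the languages need a separate verifier flag. -/
theorem mainTheorem1 :
    (DTRelevance.InNP DTRelevance.deltaProblem ∧
      DTRelevance.InNP DTRelevance.cDeltaProblem ∧
      DTRelevance.InNP DTRelevance.minCDeltaProblem) ∧
    (DTRelevance.SolvableWithNPCalls
        (fun I : {I : DTRelevance.Input // I.Boolean} => I.1.enc)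
        (fun I => DTRelevance.IsMinSize I.1) (fun I => Nat.clog 2 (I.1.m + 1)) ∧
      DTRelevance.SolvableWithNPWitnessCalls
        (fun I : {I : DTRelevance.Input // I.Boolean} => I.1.enc)
        (fun I => DTRelevance.IsMinSet I.1) (fun I => Nat.clog 2 (I.1.m + 1))) ∧
    (DTRelevance.SolvableWithNPCalls DTRelevance.Input.enc
        DTRelevance.IsMinSize (fun I => Nat.clog 2 (I.m + 1)) ∧
      DTRelevance.SolvableWithNPWitnessCalls DTRelevance.Input.enc
        DTRelevance.IsMinSet (fun I => Nat.clog 2 (I.m + 1))) :=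
  ⟨⟨DTRelevance.inNP_deltaProblem, DTRelevance.inNP_cDeltaProblem,
    DTRelevance.inNP_minCDeltaProblem⟩,
    ⟨DTRelevance.solvable_minSize Subtype.val, DTRelevance.solvable_minSet Subtype.val⟩,
    ⟨DTRelevance.solvable_minSize id, DTRelevance.solvable_minSet id⟩⟩
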